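/- Let $A$ be a unital associative complex algebra (for instance the one underlying a conditionally non-commutative probability space $(A,\varphi,\psi)$) with a vector space basis $(e_j)_{j\in I}$, whose elements are called letters. Let $H=T(T_+(A))$ be the double tensor algebra, $T_+(A)=\bigoplus_{n\ge1}A^{\otimes n}$, with concatenation product $|$, unit $\mathbf 1$ and counit $\epsilon$. On a word $w=a_1\cdots a_n$ put $$\Delta(w)=\sum_{S\subseteq[n]}w_S\otimes w_{J_1}|\cdots|w_{J_r},$$ where $J_1,\dots,J_r$ are the connected components of $[n]\setminus S$ in increasing order, and let $\Delta_\prec(w)$, $\Delta_\succ(w)$ be the subsums over $S\ni1$, resp. $S\not\ni1$. Extend $\Delta$ multiplicatively, and extend the half-coproducts by $\Delta_{\prec}(\mathbf 1)=0$, $\Delta_\prec(w_1|x)=\Delta_\prec(w_1)\Delta(x)$, and likewise for $\Delta_\succ$. For linear forms $f,g$ on $H$ let $f*g$, $f\prec g$, $f\succ g$ be $m_{\mathbb C}\circ(f\otimes g)$ composed with $\Delta$, $\Delta_\prec$, $\Delta_\succ$. For an infinitesimal character $\alpha$ (one with $\alpha(\mathbf 1)=0=\alpha(w_1|\cdots|w_k)$,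 $k\ge2$) let $\mathcal E_\succ(\alpha)=\sum_{n\ge0}\alpha^{\succ n}$, where $\alpha^{\succ0}=\epsilon$ and $\alpha^{\succ(n+1)}=\alpha^{\succ n}\succ\alpha$. For pairs of characters put $$(\Phi_1,\Psi_1)*(\Phi_2,\Psi_2)=\bigl(\mathcal E_\succ(\beta_2+\Psi_2^{*-1}\succ\beta_1\prec\Psi_2),\ \Psi_1*\Psi_2\bigr),\qquad \Phi_i=\mathcal E_\succ(\beta_i),$$ with $\beta_i$ an infinitesimal character and $\Psi_2^{*-1}$ the inverse for $*$. A distribution is a linear functional $\mu:\mathbb C[X]\to\mathbb C$ with $\mu(1)=1$. A character $\Phi$ on $H$ extends $\mu$ on the letter $a$ if $\Phi(a^{\otimes n})=\mu(X^n)$ for all $n\ge0$ and $\Phi(w)=0$ for every word $w$ in the letters that contains a letter different from $a$. The free cumulants $k_n$ of $\nu$ and the c-free cumulants $k_n^{(c)}$ of $(\mu,\nu)$ are defined by $$\nu(X^n)=\sum_{\pi\in \mathrm{NC}(n)}\prod_{P\in\pi}k_{|P|},\qquad \mu(X^n)=\sum_{\pi\in\mathrm{NC}(n)}\ \prod_{P\in\pi\text{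 outer}}k^{(c)}_{|P|}\prod_{P\in\pi\text{ inner}}k_{|P|}\qquad(n\ge1).$$ The convolutions $\nu_1\boxplus\nu_2$ and $\nu_1\blacktriangleright\nu_2$ are the distribution of $x+y$ for free, resp. monotone independent, random variables $x,y$ with distributions $\nu_1,\nu_2$, where freeness refers to the unital and monotone independence to the non-unital subalgebras generated by $x$ and $y$. The c-free convolution $(\mu_1,\nu_1)\boxplus(\mu_2,\nu_2)$ is the pair $(\mu,\nu)$ with $\nu=\nu_1\boxplus\nu_2$ and $k_n^{(c)}(\mu,\nu)=k_n^{(c)}(\mu_1,\nu_1)+k_n^{(c)}(\mu_2,\nu_2)$ for all $n\ge1$. The c-monotone convolution $(\mu_1,\nu_1)\blacktriangleright(\mu_2,\nu_2)$ is the pair $(\mu,\nu)$ where $\mu$ is the first component of $(\mu_1,\delta_0)\boxplus(\mu_2,\nu_2)$, $\delta_0$ being the distribution of $0$, and $\nu=\nu_1\blacktriangleright\nu_2$. **Theorem.** Let $(\mu_1,\nu_1)$ and $(\mu_2,\nu_2)$ be pairs of distributions, and let $(\Phi_1,\Psi_1)$ and $(\Phi_2,\Psi_2)$ be pairs of characters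 on $H$ that extend them on the letters $a_1$ and $a_2$, respectively. Then $(\mu,\nu)=(\mu_1,\nu_1)\blacktriangleright(\mu_2,\nu_2)$ and $(\Phi,\Psi)=(\Phi_1,\Psi_1)*(\Phi_2,\Psi_2)$ are well defined (each exists and is unique), and $(\Phi,\Psi)$ is a pair of characters extending $(\mu,\nu)$ in the following sense. If $a_1\ne a_2$, then for all $n\ge0$ $$\Phi\bigl((a_1+a_2)^{\otimes n}\bigr)=\mu(X^n),\qquad \Psi\bigl((a_1+a_2)^{\otimes n}\bigr)=\nu(X^n).$$ If $a_1=a_2=a$, then $\Phi$ and $\Psi$ extend $\mu$ and $\nu$ on the letter $a$. -/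

import Mathlib

open scoped TensorProduct Polynomial

/-! ## Distributions, independence and convolutions -/

/-- A distribution (of one random variable): a unital linear functional on `ℂ[X]`. -/
def IsDistribution (μ : ℂ[X] →ₗ[ℂ] ℂ) : Prop := μ 1 = 1

/-- The distribution of the random variable `x` with respect to `χ`: `X ^ n ↦ χ (x ^ n)`. -/
noncomputable def distributionOf {B : Type*} [Ring B] [Algebra ℂ B] (χ : B →ₗ[ℂ] ℂ) (x : B) :
    ℂ[X] →ₗ[ℂ] ℂ :=
  χ ∘ₗ (Polynomial.aeval x).toLinearMap

/-- The distribution `δ₀` of the random variable `0`. -/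
noncomputable def deltaZero : ℂ[X] →ₗ[ℂ] ℂ := (Polynomial.aeval (0 : ℂ)).toLinearMap

/-- Free independence of unital subalgebras.  A word `a₁ ⋯ aₙ` with `aᵣ` in the subalgebra
of index `iᵣ` is encoded as the list of the pairs `(iᵣ, aᵣ)`. -/
def IsFreelyIndependent {B : Type*} [Ring B] [Algebra ℂ B] (χ : B →ₗ[ℂ] ℂ) {k : ℕ}
    (S : Fin k → Subalgebra ℂ B) : Prop :=
  ∀ w : List (Fin k × B), 2 ≤ w.length → (w.map Prod.fst).IsChain (· ≠ ·) →
    (∀ p ∈ w, p.2 ∈ S p.1 ∧ χ p.2 = 0) → χ (w.map Prod.snd).prod = 0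

/-- Monotone independence of (not necessarily unital) subalgebras: in an alternating word
`u c v` whose letter `c` has an index larger than those of its neighbours (a neighbour that
does not exist imposes no condition), the letter `c` factors out. -/
def IsMonotoneIndependent {B : Type*} [Ring B] [Algebra ℂ B] (χ : B →ₗ[ℂ] ℂ) {k : ℕ}
    (S : Fin k → NonUnitalSubalgebra ℂ B) : Prop :=
  ∀ (u v : List (Fin k × B)) (c : Fin k × B),
    ((u ++ c :: v).map Prod.fst).IsChain (· ≠ ·) →
    (∀ p ∈ u ++ c :: v, p.2 ∈ S p.1) →
    (∀ d ∈ u.getLast?, d.1 < c.1) → (∀ d ∈ v.head?, d.1 < c.1) →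
    χ ((u ++ c :: v).map Prod.snd).prod = χ c.2 * χ ((u ++ v).map Prod.snd).prod

/-- `x`, `y` are free random variables in `(B, χ)` with distributions `μ₁`, `μ₂`. -/
def IsFreeRealization {B : Type*} [Ring B] [Algebra ℂ B] (χ : B →ₗ[ℂ] ℂ) (x y : B)
    (μ₁ μ₂ : ℂ[X] →ₗ[ℂ] ℂ) : Prop :=
  χ 1 = 1 ∧ IsFreelyIndependent χ ![Algebra.adjoin ℂ {x}, Algebra.adjoin ℂ {y}] ∧
    distributionOf χ x = μ₁ ∧ distributionOf χ y = μ₂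

/-- `x`, `y` are monotone independent (in this order) random variables in `(B, χ)` with
distributions `μ₁`, `μ₂`. -/
def IsMonotoneRealization {B : Type*} [Ring B] [Algebra ℂ B] (χ : B →ₗ[ℂ] ℂ) (x y : B)
    (μ₁ μ₂ : ℂ[X] →ₗ[ℂ] ℂ) : Prop :=
  χ 1 = 1 ∧
    IsMonotoneIndependent χ
      ![NonUnitalAlgebra.adjoin ℂ {x}, NonUnitalAlgebra.adjoin ℂ {y}] ∧
    distributionOf χ x = μ₁ ∧ distributionOf χ y = μ₂

/-- `μ = μ₁ ⊞ μ₂`: free random variables with distributions `μ₁`, `μ₂` exist, and the sum of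
any two such random variables has distribution `μ`. -/
def IsFreeConv (μ₁ μ₂ μ : ℂ[X] →ₗ[ℂ] ℂ) : Prop :=
  (∃ (B : Type) (_ : Ring B) (_ : Algebra ℂ B) (χ : B →ₗ[ℂ] ℂ) (x y : B),
      IsFreeRealization χ x y μ₁ μ₂) ∧
    ∀ (B : Type) [Ring B] [Algebra ℂ B] (χ : B →ₗ[ℂ] ℂ) (x y : B),
      IsFreeRealization χ x y μ₁ μ₂ → distributionOf χ (x + y) = μ

/-- `μ = μ₁ ▶ μ₂`: monotone independent random variables with distributions `μ₁`, `μ₂` exist,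
and the sum of any two such random variables has distribution `μ`. -/
def IsMonotoneConv (μ₁ μ₂ μ : ℂ[X] →ₗ[ℂ] ℂ) : Prop :=
  (∃ (B : Type) (_ : Ring B) (_ : Algebra ℂ B) (χ : B →ₗ[ℂ] ℂ) (x y : B),
      IsMonotoneRealization χ x y μ₁ μ₂) ∧
    ∀ (B : Type) [Ring B] [Algebra ℂ B] (χ : B →ₗ[ℂ] ℂ) (x y : B),
      IsMonotoneRealization χ x y μ₁ μ₂ → distributionOf χ (x + y) = μ

/-! ## Non-crossing partitions and cumulants of distributions -/

/-- Non-crossing set partitions of an `n`-element chain. -/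
def IsNonCrossing {n : ℕ} (π : Finpartition (Finset.univ : Finset (Fin n))) : Prop :=
  ∀ P ∈ π.parts, ∀ Q ∈ π.parts, ∀ a b c d : Fin n, a < b → b < c → c < d →
    a ∈ P → c ∈ P → b ∈ Q → d ∈ Q → P = Q

/-- The finite set `NC(n)`. -/
noncomputable def nonCrossing (n : ℕ) :
    Finset (Finpartition (Finset.univ : Finset (Fin n))) :=
  open Classical in Finset.univ.filter IsNonCrossing

/-- A block is outer if it is not nested inside another block. -/
def IsOuterBlock {n : ℕ} (π : Finpartition (Finset.univ : Finset (Fin n)))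
    (P : Finset (Fin n)) : Prop :=
  ¬ ∃ Q ∈ π.parts, Q ≠ P ∧ ∃ a ∈ Q, ∃ b ∈ Q, ∀ c ∈ P, a < c ∧ c < b

/-- `k` (its value at `0` is irrelevant) is the sequence of free cumulants of `ν`. -/
def IsFreeCumulants (ν : ℂ[X] →ₗ[ℂ] ℂ) (k : ℕ → ℂ) : Prop :=
  ∀ n : ℕ, 1 ≤ n →
    ν (Polynomial.X ^ n) = ∑ π ∈ nonCrossing n, ∏ P ∈ π.parts, k P.card

/-- `kc` (its value at `0` is irrelevant) is the sequence of c-free cumulants of `(μ, ν)`: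
outer blocks carry `kc`, inner blocks the free cumulants of `ν`. -/
def IsCFreeCumulants (μ ν : ℂ[X] →ₗ[ℂ] ℂ) (kc : ℕ → ℂ) : Prop :=
  ∃ k : ℕ → ℂ, IsFreeCumulants ν k ∧ ∀ n : ℕ, 1 ≤ n →
    μ (Polynomial.X ^ n) = ∑ π ∈ nonCrossing n,
      open Classical in
      (∏ P ∈ π.parts.filter (fun P => IsOuterBlock π P), kc P.card) *
        ∏ P ∈ π.parts.filter (fun P => ¬ IsOuterBlock π P), k P.card

/-- `p = p₁ ⊞ p₂`, the c-free additive convolution of pairs of distributions. -/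
def IsCFreeConv (p₁ p₂ p : (ℂ[X] →ₗ[ℂ] ℂ) × (ℂ[X] →ₗ[ℂ] ℂ)) : Prop :=
  IsDistribution p.1 ∧ IsFreeConv p₁.2 p₂.2 p.2 ∧
    ∃ k₁ k₂ : ℕ → ℂ, IsCFreeCumulants p₁.1 p₁.2 k₁ ∧ IsCFreeCumulants p₂.1 p₂.2 k₂ ∧
      IsCFreeCumulants p.1 p.2 (k₁ + k₂)

/-- `p = p₁ ▶ p₂`, the c-monotone additive convolution of pairs of distributions:
`(μ, ν)` where `μ` is the first component of `(μ₁, δ₀) ⊞ (μ₂, ν₂)` and `ν = ν₁ ▶ ν₂`. -/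
def IsCMonotoneConv (p₁ p₂ p : (ℂ[X] →ₗ[ℂ] ℂ) × (ℂ[X] →ₗ[ℂ] ℂ)) : Prop :=
  (∃ ν' : ℂ[X] →ₗ[ℂ] ℂ, IsCFreeConv (p₁.1, deltaZero) p₂ (p.1, ν')) ∧
    IsMonotoneConv p₁.2 p₂.2 p.2

/-! ## The double tensor algebra and its coproducts -/

section DoubleTensor

variable (A : Type*) [AddCommGroup A] [Module ℂ A]

/-- `T₊(A) = ⨁_{n ≥ 1} A^{⊗ n}` (the summand of index `n` is `A^{⊗ (n + 1)}`). -/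
abbrev TPlus : Type _ := DirectSum ℕ (fun n => ⨂[ℂ]^(n + 1) A)

/-- `T(T₊(A))`; its product is the concatenation with bars. -/
abbrev DoubleTensor : Type _ := TensorAlgebra ℂ (TPlus A)

/-- The word `a₁ ⋯ aₙ` as an element of `T(T₊(A))`; the empty word is the unit. -/
noncomputable def wordMap : (n : ℕ) → MultilinearMap ℂ (fun _ : Fin n => A) (DoubleTensor A)
  | 0 => MultilinearMap.constOfIsEmpty ℂ _ 1
  | n + 1 =>
    ((TensorAlgebra.ι ℂ) ∘ₗ (DirectSum.lof ℂ ℕ (fun n => ⨂[ℂ]^(n + 1) A) n)).compMultilinearMap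
      (PiTensorProduct.tprod ℂ)

variable {A}

/-- The subword of `a` with positions in the list `L`. -/
noncomputable def subword {m : ℕ} (L : List (Fin m)) (a : Fin m → A) : DoubleTensor A :=
  wordMap A L.length (fun k => a (L.get k))

/-- The bar product of the subwords of `a` given by a list of lists of positions. -/
noncomputable def barWords {m : ℕ} (Ls : List (List (Fin m))) (a : Fin m → A) :
    DoubleTensor A :=
  (Ls.map (fun J => subword J a)).prod

theorem subword_update_of_notMem {m : ℕ} (L : List (Fin m)) (a : Fin m → A) (i : Fin m)
    (h : i ∉ L) (x : A) : subword L (Function.update a i x) = subword L a := by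
  unfold subword
  congr 1
  funext k
  have : L.get k ≠ i := fun hk => h (hk ▸ List.get_mem L k)
  simp only [Function.update_of_ne this]

theorem subword_update_of_mem {m : ℕ} (L : List (Fin m)) (hL : L.Nodup) (i : Fin m)
    (h : i ∈ L) : ∃ k : Fin L.length, ∀ (a : Fin m → A) (x : A),
      subword L (Function.update a i x) =
        wordMap A L.length (Function.update (fun k => a (L.get k)) k x) := by
  obtain ⟨k, hk⟩ := List.get_of_mem h
  refine ⟨k, fun a x => ?_⟩
  unfold subword
  congr 1
  funext j
  by_cases hj : j = k
  · subst hj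
    rw [hk, Function.update_self, Function.update_self]
  · have : L.get j ≠ i := fun hji => hj (List.nodup_iff_injective_get.1 hL (hji.trans hk.symm))
    rw [Function.update_of_ne this, Function.update_of_ne hj]

theorem barWords_update_of_notMem {m : ℕ} (Ls : List (List (Fin m))) (a : Fin m → A)
    (i : Fin m) (h : i ∉ Ls.flatten) (x : A) :
    barWords Ls (Function.update a i x) = barWords Ls a := by
  unfold barWords
  congr 1
  refine List.map_congr_left fun J hJ => subword_update_of_notMem J a i (fun hi => h ?_) x
  exact List.mem_flatten.2 ⟨J, hJ, hi⟩

/-- If no position is repeated, `barWords` depends linearly on each letter that occurs. -/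
theorem barWords_linear {m : ℕ} (Ls : List (List (Fin m))) (hLs : Ls.flatten.Nodup)
    (a : Fin m → A) (i : Fin m) (h : i ∈ Ls.flatten) :
    (∀ x y : A, barWords Ls (Function.update a i (x + y)) =
        barWords Ls (Function.update a i x) + barWords Ls (Function.update a i y)) ∧
      ∀ (c : ℂ) (x : A), barWords Ls (Function.update a i (c • x)) =
        c • barWords Ls (Function.update a i x) := by
  induction Ls with
  | nil => simp at h
  | cons J Js ih =>
    rw [List.flatten_cons, List.nodup_append] at hLs
    obtain ⟨hJ, hJs, hdisj⟩ := hLs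
    have hcons : ∀ b : Fin m → A, barWords (J :: Js) b = subword J b * barWords Js b :=
      fun b => by simp [barWords]
    rw [List.flatten_cons, List.mem_append] at h
    by_cases hi : i ∈ J
    · have hn : i ∉ Js.flatten := fun hi' => hdisj i hi i hi' rfl
      obtain ⟨k, hk⟩ := subword_update_of_mem (A := A) J hJ i hi
      constructor
      · intro x y
        simp only [hcons, barWords_update_of_notMem Js a i hn, hk,
          MultilinearMap.map_update_add, add_mul]
      · intro c x
        simp only [hcons, barWords_update_of_notMem Js a i hn, hk,
          MultilinearMap.map_update_smul, smul_mul_assoc]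
    · obtain ⟨h₁, h₂⟩ := ih hJs (h.resolve_left hi)
      constructor
      · intro x y
        simp only [hcons, subword_update_of_notMem J a i hi, h₁, mul_add]
      · intro c x
        simp only [hcons, subword_update_of_notMem J a i hi, h₂, mul_smul_comm]

/-- The positions in `S`, in increasing order. -/
def chosen {m : ℕ} (S : Finset (Fin m)) : List (Fin m) :=
  (List.finRange m).filter (fun i => decide (i ∈ S))

/-- The connected components of the complement of `S`, in increasing order: the maximal runs
of consecutive positions outside `S`.  (Empty runs may be listed; they give empty words.) -/
def gaps {m : ℕ} (S : Finset (Fin m)) : List (List (Fin m)) :=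
  (List.finRange m).splitOnP (fun i => decide (i ∈ S))

theorem flatten_splitOnP {α : Type*} (p : α → Bool) (l : List α) :
    (l.splitOnP p).flatten = l.filter (fun x => !p x) := by
  induction l with
  | nil => simp
  | cons x xs ih =>
    rw [List.splitOnP_cons_eq_if_modifyHead]
    by_cases hx : p x = true
    · simp [hx, ih]
    · obtain ⟨y, ys, hy⟩ := List.exists_cons_of_ne_nil (List.splitOnP_ne_nil p xs)
      rw [hy] at ih
      simp only [hy, hx, List.modifyHead_cons, List.flatten_cons, Bool.false_eq_true, if_false,
        List.cons_append] at ih ⊢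
      simp [hx, ih]

theorem nodup_flatten_gaps {m : ℕ} (S : Finset (Fin m)) : (gaps S).flatten.Nodup := by
  unfold gaps
  rw [flatten_splitOnP]
  exact (List.nodup_finRange m).filter _

theorem mem_flatten_gaps {m : ℕ} (S : Finset (Fin m)) (i : Fin m) :
    i ∈ (gaps S).flatten ↔ i ∉ S := by
  unfold gaps
  rw [flatten_splitOnP]
  simp

theorem mem_chosen {m : ℕ} (S : Finset (Fin m)) (i : Fin m) : i ∈ chosen S ↔ i ∈ S := by
  simp [chosen]

/-- The term `w_S ⊗ w_{J₁} | ⋯ | w_{J_r}` of the coproduct of a word `w` of length `m`. -/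
noncomputable def coproductTerm {m : ℕ} (S : Finset (Fin m)) :
    MultilinearMap ℂ (fun _ : Fin m => A) (DoubleTensor A ⊗[ℂ] DoubleTensor A) where
  toFun a := subword (chosen S) a ⊗ₜ[ℂ] barWords (gaps S) a
  map_update_add' := by
    intro hdec a i x y
    rw [Subsingleton.elim hdec (instDecidableEqFin m)]
    by_cases hi : i ∈ S
    · obtain ⟨k, hk⟩ := subword_update_of_mem (A := A) (chosen S)
        ((List.nodup_finRange m).filter _) i ((mem_chosen S i).2 hi)
      have hn : i ∉ (gaps S).flatten := fun h => (mem_flatten_gaps S i).1 h hi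
      simp only [hk, barWords_update_of_notMem _ a i hn, MultilinearMap.map_update_add,
        TensorProduct.add_tmul]
    · have hn : i ∉ chosen S := fun h => hi ((mem_chosen S i).1 h)
      simp only [subword_update_of_notMem _ a i hn, (barWords_linear (gaps S)
        (nodup_flatten_gaps S) a i ((mem_flatten_gaps S i).2 hi)).1, TensorProduct.tmul_add]
  map_update_smul' := by
    intro hdec a i c x
    rw [Subsingleton.elim hdec (instDecidableEqFin m)]
    by_cases hi : i ∈ S
    · obtain ⟨k, hk⟩ := subword_update_of_mem (A := A) (chosen S)
        ((List.nodup_finRange m).filter _) i ((mem_chosen S i).2 hi)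
      have hn : i ∉ (gaps S).flatten := fun h => (mem_flatten_gaps S i).1 h hi
      simp only [hk, barWords_update_of_notMem _ a i hn, MultilinearMap.map_update_smul,
        TensorProduct.smul_tmul']
    · have hn : i ∉ chosen S := fun h => hi ((mem_chosen S i).1 h)
      simp only [subword_update_of_notMem _ a i hn, (barWords_linear (gaps S)
        (nodup_flatten_gaps S) a i ((mem_flatten_gaps S i).2 hi)).2, TensorProduct.tmul_smul]

/-- The linear map `w ↦ ∑_S w_S ⊗ w_{J₁} | ⋯ | w_{J_r}` on `T₊(A)`, where for a word of length
`n + 1` the sum runs over the sets `S` in `F n`. -/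
noncomputable def coproductOver (F : (n : ℕ) → Finset (Finset (Fin (n + 1)))) :
    TPlus A →ₗ[ℂ] DoubleTensor A ⊗[ℂ] DoubleTensor A :=
  DirectSum.toModule ℂ ℕ _
    (fun n => PiTensorProduct.lift (∑ S ∈ F n, coproductTerm S))

/-- `Δ` on words: all `S`. -/
noncomputable def coproductWord : TPlus A →ₗ[ℂ] DoubleTensor A ⊗[ℂ] DoubleTensor A :=
  coproductOver (fun _ => Finset.univ)

/-- `Δ_≺` on words: the `S` that contain the first position. -/
noncomputable def leftCoproductWord : TPlus A →ₗ[ℂ] DoubleTensor A ⊗[ℂ] DoubleTensor A :=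
  coproductOver (fun _ => Finset.univ.filter (fun S => 0 ∈ S))

/-- `Δ_≻` on words: the `S` that do not contain the first position. -/
noncomputable def rightCoproductWord : TPlus A →ₗ[ℂ] DoubleTensor A ⊗[ℂ] DoubleTensor A :=
  coproductOver (fun _ => Finset.univ.filter (fun S => 0 ∉ S))

/-- The coproduct `Δ` of `T(T₊(A))`: the multiplicative extension. -/
noncomputable def coproduct : DoubleTensor A →ₐ[ℂ] DoubleTensor A ⊗[ℂ] DoubleTensor A :=
  TensorAlgebra.lift ℂ coproductWord

/-- Auxiliary: given `δ` on words, the algebra morphism with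
`w ↦ !![0, δ w; 0, Δ w]`. -/
noncomputable def matrixExtension
    (δ : TPlus A →ₗ[ℂ] DoubleTensor A ⊗[ℂ] DoubleTensor A) :
    DoubleTensor A →ₐ[ℂ] Matrix (Fin 2) (Fin 2) (DoubleTensor A ⊗[ℂ] DoubleTensor A) :=
  TensorAlgebra.lift ℂ
    { toFun := fun w => !![0, δ w; 0, coproductWord w]
      map_add' := fun v w => by
        ext i j
        fin_cases i <;> fin_cases j <;> simp
      map_smul' := fun c w => by
        ext i j
        fin_cases i <;> fin_cases j <;> simp }

/-- The extension `D` of a map `δ` on words to `T(T₊(A))` with `D 1 = 0` and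
`D (w₁ | w₂ | ⋯ | w_k) = δ w₁ · Δ (w₂ | ⋯ | w_k)`
(see `halfExtension_one` and `halfExtension_ι_mul`). -/
noncomputable def halfExtension
    (δ : TPlus A →ₗ[ℂ] DoubleTensor A ⊗[ℂ] DoubleTensor A) :
    DoubleTensor A →ₗ[ℂ] DoubleTensor A ⊗[ℂ] DoubleTensor A where
  toFun x := matrixExtension δ x 0 1
  map_add' x y := by simp
  map_smul' c x := by simp

theorem halfExtension_one (δ : TPlus A →ₗ[ℂ] DoubleTensor A ⊗[ℂ] DoubleTensor A) :
    halfExtension δ 1 = 0 := by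
  simp [halfExtension]

theorem matrixExtension_one_one (δ : TPlus A →ₗ[ℂ] DoubleTensor A ⊗[ℂ] DoubleTensor A)
    (x : DoubleTensor A) :
    matrixExtension δ x 1 0 = 0 ∧ matrixExtension δ x 1 1 = coproduct x := by
  induction x using TensorAlgebra.induction with
  | algebraMap r => simp [Matrix.algebraMap_matrix_apply]
  | ι w => simp [matrixExtension, coproduct]
  | mul x y hx hy =>
    simp [Matrix.mul_apply, Fin.sum_univ_two, hx.1, hx.2, hy.1, hy.2]
  | add x y hx hy => simp [hx.1, hx.2, hy.1, hy.2]

theorem halfExtension_ι_mul (δ : TPlus A →ₗ[ℂ] DoubleTensor A ⊗[ℂ] DoubleTensor A)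
    (w : TPlus A) (x : DoubleTensor A) :
    halfExtension δ (TensorAlgebra.ι ℂ w * x) = δ w * coproduct x := by
  have h := (matrixExtension_one_one δ x).2
  simp only [halfExtension, LinearMap.coe_mk, AddHom.coe_mk, map_mul, Matrix.mul_apply,
    Fin.sum_univ_two, h]
  simp [matrixExtension]

/-- `Δ_≺` on `T(T₊(A))`. -/
noncomputable def leftCoproduct : DoubleTensor A →ₗ[ℂ] DoubleTensor A ⊗[ℂ] DoubleTensor A :=
  halfExtension leftCoproductWord

/-- `Δ_≻` on `T(T₊(A))`. -/
noncomputable def rightCoproduct : DoubleTensor A →ₗ[ℂ] DoubleTensor A ⊗[ℂ] DoubleTensor A :=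
  halfExtension rightCoproductWord

/-! ## Convolution, half-shuffles, characters -/

/-- The counit `ε`. -/
noncomputable def counitForm : Module.Dual ℂ (DoubleTensor A) :=
  (TensorAlgebra.algebraMapInv (R := ℂ) (M := TPlus A)).toLinearMap

/-- The convolution product `f * g`. -/
noncomputable def conv (f g : Module.Dual ℂ (DoubleTensor A)) :
    Module.Dual ℂ (DoubleTensor A) :=
  LinearMap.mul' ℂ ℂ ∘ₗ TensorProduct.map f g ∘ₗ coproduct.toLinearMap

/-- The left half-shuffle `f ≺ g`. -/
noncomputable def leftShuffle (f g : Module.Dual ℂ (DoubleTensor A)) :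
    Module.Dual ℂ (DoubleTensor A) :=
  LinearMap.mul' ℂ ℂ ∘ₗ TensorProduct.map f g ∘ₗ leftCoproduct

/-- The right half-shuffle `f ≻ g`. -/
noncomputable def rightShuffle (f g : Module.Dual ℂ (DoubleTensor A)) :
    Module.Dual ℂ (DoubleTensor A) :=
  LinearMap.mul' ℂ ℂ ∘ₗ TensorProduct.map f g ∘ₗ rightCoproduct

/-- Characters: unital multiplicative linear forms. -/
def IsCharacter (f : Module.Dual ℂ (DoubleTensor A)) : Prop :=
  f 1 = 1 ∧ ∀ x y, f (x * y) = f x * f y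

/-- Infinitesimal characters: they vanish on `1` and on `w₁ | ⋯ | w_k` for `k ≥ 2`. -/
def IsInfinitesimal (α : Module.Dual ℂ (DoubleTensor A)) : Prop :=
  ∀ l : List (TPlus A), l.length ≠ 1 → α (l.map (TensorAlgebra.ι ℂ)).prod = 0

/-- The powers `α^{≻ n}`: `α^{≻ 0} = ε`, `α^{≻ (n + 1)} = α^{≻ n} ≻ α`. -/
noncomputable def rightPow (α : Module.Dual ℂ (DoubleTensor A)) :
    ℕ → Module.Dual ℂ (DoubleTensor A)
  | 0 => counitForm
  | n + 1 => rightShuffle (rightPow α n) α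

/-- `Φ = 𝓔_≻(α) = ∑_{n ≥ 0} α^{≻ n}`, a sum with finitely many non-zero terms at each point. -/
def IsRightExp (α Φ : Module.Dual ℂ (DoubleTensor A)) : Prop :=
  ∀ x, ∃ N : ℕ, (∀ n, N ≤ n → rightPow α n x = 0) ∧
    Φ x = ∑ n ∈ Finset.range N, rightPow α n x

/-- `g` is the inverse of `f` with respect to `*`. -/
def IsConvInverse (f g : Module.Dual ℂ (DoubleTensor A)) : Prop :=
  conv f g = counitForm ∧ conv g f = counitForm

/-- `P = P₁ * P₂` for pairs `Pᵢ = (Φᵢ, Ψᵢ)`: with `βᵢ` the infinitesimal character such that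
`Φᵢ = 𝓔_≻(βᵢ)`, the pair `P` is `(𝓔_≻(β₂ + Ψ₂^{*-1} ≻ β₁ ≺ Ψ₂), Ψ₁ * Ψ₂)`. -/
def IsCharConv
    (P₁ P₂ P : Module.Dual ℂ (DoubleTensor A) × Module.Dual ℂ (DoubleTensor A)) : Prop :=
  ∃ β₁ β₂ θ : Module.Dual ℂ (DoubleTensor A),
    (IsInfinitesimal β₁ ∧ IsRightExp β₁ P₁.1) ∧ (IsInfinitesimal β₂ ∧ IsRightExp β₂ P₂.1) ∧
    IsConvInverse P₂.2 θ ∧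
    IsRightExp (β₂ + rightShuffle θ (leftShuffle β₁ P₂.2)) P.1 ∧
    P.2 = conv P₁.2 P₂.2

/-- `Φ` extends the distribution `μ`, carried by the letter `e i`, to a character on
`T(T₊(A))`, words being written in the letters `e j` of a basis of `A`:
`Φ (a^{⊗ n}) = μ (X ^ n)` for `a = e i`, and `Φ` vanishes on every word that contains a
letter different from `a`. -/
def ExtendsOnLetter {I : Type*} (e : Module.Basis I ℂ A) (i : I) (μ : ℂ[X] →ₗ[ℂ] ℂ)
    (Φ : Module.Dual ℂ (DoubleTensor A)) : Prop :=
  IsCharacter Φ ∧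
    (∀ n : ℕ, Φ (wordMap A n (fun _ => e i)) = μ (Polynomial.X ^ n)) ∧
    ∀ (n : ℕ) (w : Fin n → I), (∃ k, w k ≠ i) → Φ (wordMap A n (fun k => e (w k))) = 0

/-- `Φ` is a character that restricts to the distribution `μ` on the words in the single
letter `x`. -/
def ExtendsAt (x : A) (μ : ℂ[X] →ₗ[ℂ] ℂ) (Φ : Module.Dual ℂ (DoubleTensor A)) : Prop :=
  IsCharacter Φ ∧ ∀ n : ℕ, Φ (wordMap A n (fun _ => x)) = μ (Polynomial.X ^ n)

end DoubleTensor

/-!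
Both sides of the theorem are computed in terms of Boolean cumulants.

A character is determined by its values on words, that is, by a series indexed by words (`hat`).
Reading a word from the left turns the sum over sets of positions in the coproduct into the
recursion `wsubst`, a non-commutative form of the composition `f ↦ g · f(z g)` of power series
(`sum_gapProd_smul_eq_wsubst`, `contract_coproduct_word`).  Its associativity (`wsubst_assoc`)
makes the characters a group that acts on `T(T₊(A))` (`contract_coproduct_contract`), which gives
existence and uniqueness of the inverse for `*`.  For an infinitesimal character `β`, the equation
`Φ = ε + Φ ≻ β` reads `Φ = 1 + β · Φ` for the Cauchy product of series (`IsRightExp.cauchy_hat`), so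
that `β` consists of the Boolean cumulants of `Φ`.  Linear forms with prescribed recursive values
are obtained as fixed points (`exists_eq_self_of_contracting`), which takes care of
multilinearity.  The form `θ ≻ β₁ ≺ Ψ₂` with `θ = Ψ₂^{*-1}` is infinitesimal
(`IsInfinitesimal.adjoint`), and on the powers of one letter its series is `β₁(z G) / G`, where `G`
is the moment series of `Ψ₂` (`IsInfinitesimal.hatVia_adjoint`, `letterSeries_wsubst`).  Hence
`Φ` has the Boolean cumulant series `β₂ + β₁(z G) / G`.

On the side of distributions, splitting a non-crossing partition at the second element of its
first block (`ncSumAt_rec`) shows that the Boolean cumulant series `B` of `μ` and the c-free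
cumulants `k` of `(μ, ν)` are related by `G · B = k(z G)`, with `G` the moment series of `ν`
(`exists_boolean_ncSum`).  With respect to `δ₀`, c-free and Boolean cumulants agree, so the first
component of `(μ₁, δ₀) ⊞ (μ₂, ν₂)` has the Boolean cumulant series `β₂ + β₁(z G) / G`, too
(`IsCFreeConv.boolean`); here `δ₀ ⊞ ν₂ = ν₂` (`isFreeConv_deltaZero_iff`).  For the second
component, the monotone rule gives the moments of `x + y` by the same substitution that computes
`Ψ₁ * Ψ₂` (`IsMonotoneRealization.moments`).
-/

/-! ### Series indexed by words -/

/-- The left derivative of a function on words: `w ↦ f (a w)`. -/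
def lderiv {α M : Type*} (a : α) (f : List α → M) : List α → M := fun l => f (a :: l)

/-- The unit for `cauchy`: `1` on the empty word and `0` elsewhere. -/
def unitSeries {α : Type*} : List α → ℂ
  | [] => 1
  | _ :: _ => 0

/-- The Cauchy product `w ↦ ∑_{w = w' w''} u w' • f w''`. -/
noncomputable def cauchy {α M : Type*} [AddCommGroup M] [Module ℂ M] :
    (List α → ℂ) → (List α → M) → List α → M
  | u, f, [] => u [] • f []
  | u, f, a :: l => u [] • f (a :: l) + cauchy (lderiv a u) f l

/-- The substitution `w ↦ ∑_S (u w_{J₀} * g w_{J₁} * ⋯ * g w_{J_s}) • f w_S`, where `S` runs over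
the sets of positions of `w`, say with `s` elements, and `J₀, …, J_s` are the (possibly empty)
runs of positions before, between and after the elements of `S`.  The recursion reads `w` from
the left; `u` weighs the run that is being read. -/
noncomputable def wsubst {α M : Type*} [AddCommGroup M] [Module ℂ M] (g : List α → ℂ) :
    (List α → M) → (List α → ℂ) → List α → M
  | f, u, [] => u [] • f []
  | f, u, a :: l => u [] • wsubst g (lderiv a f) g l + wsubst g f (lderiv a u) l

@[simp] theorem lderiv_apply {α M : Type*} (a : α) (f : List α → M) (l : List α) :
    lderiv a f l = f (a :: l) := rfl

theorem lderiv_add {α M : Type*} [Add M] (a : α) (f g : List α → M) :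
    lderiv a (f + g) = lderiv a f + lderiv a g := rfl

section WordSeries

variable {α γ M N : Type*} [AddCommGroup M] [Module ℂ M] [AddCommGroup N] [Module ℂ N]

@[simp] theorem unitSeries_nil : unitSeries ([] : List α) = 1 := rfl

@[simp] theorem unitSeries_cons (a : α) (l : List α) : unitSeries (a :: l) = 0 := rfl

@[simp] theorem lderiv_unitSeries (a : α) : lderiv a (unitSeries (α := α)) = 0 := rfl

theorem lderiv_smul (a : α) (c : ℂ) (f : List α → M) : lderiv a (c • f) = c • lderiv a f := rfl

@[simp] theorem cauchy_nil (u : List α → ℂ) (f : List α → M) : cauchy u f [] = u [] • f [] := rfl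

theorem cauchy_cons (u : List α → ℂ) (f : List α → M) (a : α) (l : List α) :
    cauchy u f (a :: l) = u [] • f (a :: l) + cauchy (lderiv a u) f l := rfl

@[simp] theorem wsubst_nil (g : List α → ℂ) (f : List α → M) (u : List α → ℂ) :
    wsubst g f u [] = u [] • f [] := rfl

theorem wsubst_cons (g : List α → ℂ) (f : List α → M) (u : List α → ℂ) (a : α) (l : List α) :
    wsubst g f u (a :: l) = u [] • wsubst g (lderiv a f) g l + wsubst g f (lderiv a u) l := rfl

theorem lderiv_wsubst (g : List α → ℂ) (f : List α → M) (u : List α → ℂ) (a : α) :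
    lderiv a (wsubst g f u) = u [] • wsubst g (lderiv a f) g + wsubst g f (lderiv a u) := rfl

theorem map_cauchy (φ : M →ₗ[ℂ] N) (u : List α → ℂ) (f : List α → M) (l : List α) :
    φ (cauchy u f l) = cauchy u (fun l => φ (f l)) l := by
  induction l generalizing u with
  | nil => simp
  | cons a l ih => simp [cauchy_cons, ih]

theorem map_wsubst (φ : M →ₗ[ℂ] N) (g : List α → ℂ) (f : List α → M) (u : List α → ℂ)
    (l : List α) : φ (wsubst g f u l) = wsubst g (fun l => φ (f l)) u l := by
  induction l generalizing f u with
  | nil => simp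
  | cons a l ih => simp only [wsubst_cons, map_add, map_smul, ih]; rfl

theorem cauchy_add_left (u v : List α → ℂ) (f : List α → M) :
    cauchy (u + v) f = cauchy u f + cauchy v f := by
  funext l
  induction l generalizing u v with
  | nil => simp [add_smul]
  | cons a l ih =>
    have := ih (lderiv a u) (lderiv a v)
    simp only [Pi.add_apply] at this
    simp only [cauchy_cons, Pi.add_apply, lderiv_add, this, add_smul]
    abel

theorem cauchy_smul_left (c : ℂ) (u : List α → ℂ) (f : List α → M) :
    cauchy (c • u) f = c • cauchy u f := by
  funext l
  induction l generalizing u with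
  | nil => simp [mul_smul]
  | cons a l ih =>
    have := ih (lderiv a u)
    simp only [Pi.smul_apply] at this
    simp only [cauchy_cons, Pi.smul_apply, lderiv_smul, this, smul_add, smul_eq_mul, mul_smul]

@[simp] theorem cauchy_zero_left (f : List α → M) : cauchy (0 : List α → ℂ) f = 0 := by
  have := cauchy_smul_left 0 (0 : List α → ℂ) f
  simpa using this

@[simp] theorem unitSeries_cauchy (f : List α → M) : cauchy unitSeries f = f := by
  funext l
  cases l <;> simp [cauchy_cons]

@[simp] theorem cauchy_unitSeries (u : List α → ℂ) : cauchy u unitSeries = u := by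
  funext l
  induction l generalizing u with
  | nil => simp
  | cons a l ih => simp [cauchy_cons, ih]

theorem wsubst_add_right (g : List α → ℂ) (f : List α → M) (u v : List α → ℂ) :
    wsubst g f (u + v) = wsubst g f u + wsubst g f v := by
  funext l
  induction l generalizing u v with
  | nil => simp [add_smul]
  | cons a l ih =>
    have := ih (lderiv a u) (lderiv a v)
    simp only [Pi.add_apply] at this
    simp only [wsubst_cons, Pi.add_apply, lderiv_add, this, add_smul]
    abel

theorem wsubst_smul_right (g : List α → ℂ) (f : List α → M) (c : ℂ) (u : List α → ℂ) :
    wsubst g f (c • u) = c • wsubst g f u := by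
  funext l
  induction l generalizing u with
  | nil => simp [mul_smul]
  | cons a l ih =>
    have := ih (lderiv a u)
    simp only [Pi.smul_apply] at this
    simp only [wsubst_cons, Pi.smul_apply, lderiv_smul, this, smul_add, smul_eq_mul, mul_smul]

@[simp] theorem wsubst_zero_right (g : List α → ℂ) (f : List α → M) : wsubst g f 0 = 0 := by
  have := wsubst_smul_right g f 0 0
  simpa using this

theorem wsubst_add_left (g : List α → ℂ) (f f' : List α → M) (u : List α → ℂ) :
    wsubst g (f + f') u = wsubst g f u + wsubst g f' u := by
  funext l
  induction l generalizing f f' u with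
  | nil => simp
  | cons a l ih =>
    have h₁ := ih (lderiv a f) (lderiv a f') g
    have h₂ := ih f f' (lderiv a u)
    simp only [Pi.add_apply] at h₁ h₂
    simp only [wsubst_cons, Pi.add_apply, lderiv_add, h₁, h₂, smul_add]
    abel

theorem wsubst_smul_left (g : List α → ℂ) (c : ℂ) (f : List α → M) (u : List α → ℂ) :
    wsubst g (c • f) u = c • wsubst g f u := by
  funext l
  exact (map_wsubst (c • (LinearMap.id : M →ₗ[ℂ] M)) g f u l).symm

@[simp] theorem wsubst_zero_left (g u : List α → ℂ) : wsubst g (0 : List α → M) u = 0 := by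
  have := wsubst_smul_left g 0 (0 : List α → M) u
  simpa using this

/-- Substitution is associative.  The letters are read one at a time, so that the three weights
`f`, `u`, `v` have to vary in the induction. -/
theorem wsubst_assoc (f : List α → M) (g h u v : List α → ℂ) :
    wsubst h (wsubst g f u) v = wsubst (wsubst h g h) f (wsubst h u v) := by
  funext l
  induction l generalizing f u v with
  | nil => simp [smul_smul]
  | cons a l ih =>
    rw [wsubst_cons, lderiv_wsubst, wsubst_add_left, wsubst_smul_left, wsubst_cons, lderiv_wsubst,
      wsubst_add_right, wsubst_smul_right]
    simp only [Pi.add_apply, Pi.smul_apply, ih, wsubst_nil, smul_eq_mul, mul_smul, smul_add]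
    abel

/-- The first run splits off as a factor. -/
theorem wsubst_eq_cauchy (g : List α → ℂ) (f : List α → M) (u : List α → ℂ) :
    wsubst g f u = cauchy u (wsubst g f unitSeries) := by
  funext l
  induction l generalizing u with
  | nil => simp
  | cons a l ih => simp [wsubst_cons, cauchy_cons, ih]

@[simp] theorem wsubst_unitSeries (f : List α → M) : wsubst unitSeries f unitSeries = f := by
  funext l
  induction l generalizing f with
  | nil => simp
  | cons a l ih => simp [wsubst_cons, ih]

theorem wsubst_unitSeries_eq_cauchy (f : List α → M) (u : List α → ℂ) :
    wsubst unitSeries f u = cauchy u f := by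
  rw [wsubst_eq_cauchy, wsubst_unitSeries]

theorem wsubst_unitSeries_left (g u : List α → ℂ) : wsubst g unitSeries u = u := by
  have : wsubst g (unitSeries (α := α)) unitSeries = unitSeries := by
    funext l
    cases l <;> simp [wsubst_cons]
  rw [wsubst_eq_cauchy, this, cauchy_unitSeries]

theorem cauchy_map (φ : α → γ) (u : List γ → ℂ) (f : List γ → M) (l : List α) :
    cauchy u f (l.map φ) = cauchy (fun l => u (l.map φ)) (fun l => f (l.map φ)) l := by
  induction l generalizing u with
  | nil => simp
  | cons a l ih => simp only [List.map_cons, cauchy_cons, ih]; rfl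

theorem wsubst_map (φ : α → γ) (g : List γ → ℂ) (f : List γ → M) (u : List γ → ℂ) (l : List α) :
    wsubst g f u (l.map φ) =
      wsubst (fun l => g (l.map φ)) (fun l => f (l.map φ)) (fun l => u (l.map φ)) l := by
  induction l generalizing f u with
  | nil => simp
  | cons a l ih => simp only [List.map_cons, wsubst_cons, ih]; rfl

theorem cauchy_congr_right (u : List α → ℂ) {f f' : List α → M} (l : List α)
    (h : ∀ l' : List α, l'.length ≤ l.length → f l' = f' l') : cauchy u f l = cauchy u f' l := by
  induction l generalizing u with
  | nil => simp [h]
  | cons a l ih =>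
    rw [cauchy_cons, cauchy_cons, h _ le_rfl, ih]
    exact fun l' hl' => h l' (hl'.trans (by simp))

/-- In `cauchy u f w`, the value of `u` at `w` itself enters only through `u w • f []`. -/
theorem cauchy_sub_congr_left {u u' : List α → ℂ} (f : List α → M) (l : List α)
    (h : ∀ l' : List α, l'.length < l.length → u l' = u' l') :
    cauchy u f l - u l • f [] = cauchy u' f l - u' l • f [] := by
  induction l generalizing u u' with
  | nil => simp
  | cons a l ih =>
    have := ih (u := lderiv a u) (u' := lderiv a u') fun l' hl' => h (a :: l') (by simpa using hl')
    simp only [cauchy_cons, h [] (by simp), add_sub_assoc]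
    simpa using this

/-- In `wsubst g f g w`, the value of `g` at `w` itself enters only through `g w • f []`. -/
theorem wsubst_sub_congr {g g' : List α → ℂ} {u u' : List α → ℂ} (f : List α → M) (l : List α)
    (hg : ∀ l' : List α, l'.length < l.length → g l' = g' l')
    (h : ∀ l' : List α, l'.length < l.length → u l' = u' l') :
    wsubst g f u l - u l • f [] = wsubst g' f u' l - u' l • f [] := by
  induction l generalizing f u u' with
  | nil => simp
  | cons a l ih =>
    have hg' : ∀ l' : List α, l'.length ≤ l.length → g l' = g' l' :=
      fun l' hl' => hg l' (by simpa [Nat.lt_succ_iff] using hl')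
    have h₁ := ih (u := lderiv a u) (u' := lderiv a u') f (fun l' hl' => hg' l' hl'.le)
      fun l' hl' => h (a :: l') (by simpa using hl')
    have h₂ := ih (u := g) (u' := g') (lderiv a f) (fun l' hl' => hg' l' hl'.le)
      fun l' hl' => hg' l' hl'.le
    rw [hg' l le_rfl, sub_left_inj] at h₂
    simp only [wsubst_cons, h [] (by simp), h₂, add_sub_assoc]
    simpa using h₁

/-- `f` vanishes on the words of length at most `n` that contain a letter outside `s`. -/
def VanishesOff (s : Set α) (n : ℕ) (f : List α → ℂ) : Prop :=
  ∀ l : List α, l.length ≤ n → (∃ a ∈ l, a ∉ s) → f l = 0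

theorem VanishesOff.lderiv {s : Set α} {n : ℕ} {f : List α → ℂ} (hf : VanishesOff s (n + 1) f)
    (a : α) : VanishesOff s n (lderiv a f) := fun l hl ⟨b, hb, hbs⟩ =>
  hf (a :: l) (by simpa using hl) ⟨b, by simp [hb], hbs⟩

theorem VanishesOff.cauchy {s : Set α} {n : ℕ} {u f : List α → ℂ} (hu : VanishesOff s n u)
    (hf : VanishesOff s n f) : VanishesOff s n (cauchy u f) := by
  intro l
  induction l generalizing n u with
  | nil => simp
  | cons a l ih =>
    rintro hl ⟨b, hb, hbs⟩
    obtain ⟨n, rfl⟩ : ∃ m, n = m + 1 := ⟨n - 1, by simp at hl; omega⟩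
    have hf' : VanishesOff s n f := fun l' hl' => hf l' (by omega)
    rw [cauchy_cons, hf _ hl ⟨b, hb, hbs⟩, smul_zero, zero_add]
    by_cases hbl : b ∈ l
    · exact ih (hu.lderiv a) hf' (by simpa using hl) ⟨b, hbl, hbs⟩
    · obtain rfl : b = a := by simpa [hbl] using hb
      -- every prefix that enters starts with the letter `b`
      have key : ∀ (m : ℕ) (v : List α → ℂ) (l : List α), l.length ≤ m →
          (∀ l' : List α, l'.length ≤ m → v l' = 0) → _root_.cauchy v f l = 0 := by
        intro m v l
        induction l generalizing m v with
        | nil => intro _ h; simp [h]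
        | cons c l ih' =>
          intro hl h
          obtain ⟨m, rfl⟩ : ∃ k, m = k + 1 := ⟨m - 1, by simp at hl; omega⟩
          rw [cauchy_cons, h [] (by simp), zero_smul, zero_add]
          exact ih' m _ (by simpa using hl) fun l' hl' => h (c :: l') (by simpa using hl')
      exact key n _ l (by simpa using hl) fun l' hl' => hu (b :: l') (by simpa using hl')
        ⟨b, by simp, hbs⟩

theorem VanishesOff.wsubst {s : Set α} {g f u : List α → ℂ} (hg : ∀ n, VanishesOff s n g)
    (hf : ∀ n, VanishesOff s n f) (hu : ∀ n, VanishesOff s n u) (n : ℕ) :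
    VanishesOff s n (wsubst g f u) := by
  intro l
  induction l generalizing f u with
  | nil => simp
  | cons a l ih =>
    rintro hl ⟨b, hb, hbs⟩
    have hl' : l.length ≤ n := (Nat.le_succ _).trans hl
    rw [wsubst_cons]
    by_cases hbl : b ∈ l
    · rw [ih (fun n => (hf _).lderiv a) hg hl'
        ⟨b, hbl, hbs⟩, ih hf (fun n => (hu _).lderiv a)
        hl' ⟨b, hbl, hbs⟩]
      simp
    · obtain rfl : b = a := by simpa [hbl] using hb
      have h₁ : _root_.lderiv b f = 0 := funext fun l' => hf _ (b :: l') le_rfl ⟨b, by simp, hbs⟩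
      have h₂ : _root_.lderiv b u = 0 := funext fun l' => hu _ (b :: l') le_rfl ⟨b, by simp, hbs⟩
      simp [h₁, h₂]

/-- The multiplicative inverse of a series that vanishes on the words with a letter outside `s`
vanishes there, too. -/
theorem VanishesOff.inverse {s : Set α} {u v : List α → ℂ} (hu : ∀ n, VanishesOff s n u)
    (h : _root_.cauchy u v = unitSeries) (n : ℕ) : VanishesOff s n v := by
  induction n with
  | zero => rintro l hl ⟨b, hb, -⟩; simp_all
  | succ n ih =>
    rintro l hl ⟨b, hb, hbs⟩
    have h₀ : u [] ≠ 0 := fun h₀ => by simpa [h₀] using congrFun h []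
    -- apart from `u [] * v l`, the product at `l` involves only shorter words in `v`
    cases l with
    | nil => simp at hb
    | cons a l =>
      have h₁ := congrFun h (a :: l)
      rw [cauchy_cons, unitSeries_cons] at h₁
      have h₂ : _root_.cauchy (_root_.lderiv a u) v l = 0 := by
        by_cases hbl : b ∈ l
        · exact ((hu _).lderiv a).cauchy ih l (by simpa using hl) ⟨b, hbl, hbs⟩
        · obtain rfl : b = a := by simpa [hbl] using hb
          have : _root_.lderiv b u = 0 :=
            funext fun l' => hu _ (b :: l') le_rfl ⟨b, by simp, hbs⟩
          simp [this]
      rw [h₂, add_zero, smul_eq_mul] at h₁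
      exact (mul_eq_zero.1 h₁).resolve_left h₀

end WordSeries

/-! ### Words in the double tensor algebra -/

/-- The word with the letters of a list, as an element of `T(T₊(A))`. -/
noncomputable def word {A : Type*} [AddCommGroup A] [Module ℂ A] (l : List A) : DoubleTensor A :=
  wordMap A l.length l.get

/-- The non-empty word `a l` as an element of `T₊(A)`. -/
noncomputable def plusWord {A : Type*} [AddCommGroup A] [Module ℂ A] (a : A) (l : List A) :
    TPlus A :=
  DirectSum.lof ℂ ℕ (fun n => ⨂[ℂ]^(n + 1) A) l.length
    (PiTensorProduct.tprod ℂ fun i : Fin (l.length + 1) => (a :: l).get i)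

/-- The series of the values of a linear form on words. -/
noncomputable def hat {A : Type*} [AddCommGroup A] [Module ℂ A]
    (f : Module.Dual ℂ (DoubleTensor A)) : List A → ℂ := fun l => f (word l)

/-- The contraction `u ⊗ v ↦ g v • u` of the second tensor factor. -/
noncomputable def contract {A : Type*} [AddCommGroup A] [Module ℂ A]
    (g : Module.Dual ℂ (DoubleTensor A)) :
    DoubleTensor A ⊗[ℂ] DoubleTensor A →ₗ[ℂ] DoubleTensor A :=
  (TensorProduct.rid ℂ (DoubleTensor A)).toLinearMap ∘ₗ g.lTensor (DoubleTensor A)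

/-- `g (w | x) = g w * g' x` for all words `w ∈ T₊(A)`.  Characters satisfy it with `g' = g`,
infinitesimal characters with `g' = ε`. -/
def IsMulBy {A : Type*} [AddCommGroup A] [Module ℂ A]
    (g g' : Module.Dual ℂ (DoubleTensor A)) : Prop :=
  ∀ (w : TPlus A) (x : DoubleTensor A),
    g (TensorAlgebra.ι ℂ w * x) = g (TensorAlgebra.ι ℂ w) * g' x

/-- The weight `u J₀ * g J₁ * ⋯ * g J_s` of a list of runs. -/
noncomputable def gapProd {α : Type*} (u g : List α → ℂ) : List (List α) → ℂ
  | [] => 1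
  | J :: Js => u J * (Js.map g).prod

theorem splitOnP_congr {α : Type*} {p q : α → Bool} {l : List α} (h : ∀ a ∈ l, p a = q a) :
    l.splitOnP p = l.splitOnP q := by
  induction l with
  | nil => simp
  | cons a l ih =>
    rw [List.splitOnP_cons_eq_if_modifyHead, List.splitOnP_cons_eq_if_modifyHead, h a (by simp),
      ih fun b hb => h b (by simp [hb])]

/-- The closed form of `wsubst`: the sum over sets of positions. -/
theorem sum_gapProd_smul_eq_wsubst {ι M : Type*} [DecidableEq ι] [AddCommGroup M] [Module ℂ M]
    (g : List ι → ℂ) (F : List ι → M) (u : List ι → ℂ) (L : List ι) (hL : L.Nodup) :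
    ∑ S ∈ L.toFinset.powerset, gapProd u g (L.splitOnP (fun i => decide (i ∈ S))) •
      F (L.filter (fun i => decide (i ∈ S))) = wsubst g F u L := by
  induction L generalizing F u with
  | nil => simp [gapProd]
  | cons i L ih =>
    obtain ⟨hi, hL⟩ := List.nodup_cons.1 hL
    have hi' : i ∉ L.toFinset := by simpa using hi
    rw [List.toFinset_cons, Finset.sum_powerset_insert hi', wsubst_cons, ← ih _ _ hL, ← ih _ _ hL,
      add_comm, Finset.smul_sum]
    congr 1
    · refine Finset.sum_congr rfl fun T _ => ?_
      have h₁ : ∀ j ∈ L, decide (j ∈ insert i T) = decide (j ∈ T) := fun j hj => by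
        have : j ≠ i := fun h => hi (h ▸ hj)
        simp [this]
      have h₂ : L.splitOnP (fun j => decide (j ∈ insert i T)) =
          L.splitOnP (fun j => decide (j ∈ T)) :=
        splitOnP_congr h₁
      rw [List.splitOnP_cons_eq_if_modifyHead, h₂]
      have h₃ : (i :: L).filter (fun j => decide (j ∈ insert i T)) =
          i :: L.filter (fun j => decide (j ∈ T)) := by
        rw [List.filter_cons_of_pos (by simp), List.filter_congr h₁]
      rw [h₃]
      obtain ⟨J, Js, hJ⟩ := List.exists_cons_of_ne_nil
        (List.splitOnP_ne_nil (fun j => decide (j ∈ T)) L)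
      simp [hJ, gapProd, smul_smul]
    · refine Finset.sum_congr rfl fun T hT => ?_
      have hiT : i ∉ T := fun h => hi' (Finset.mem_powerset.1 hT h)
      rw [List.splitOnP_cons_eq_if_modifyHead]
      obtain ⟨J, Js, hJ⟩ := List.exists_cons_of_ne_nil
        (List.splitOnP_ne_nil (fun j => decide (j ∈ T)) L)
      simp [hiT, hJ, gapProd]

theorem ιInv_one {R M : Type*} [CommRing R] [AddCommGroup M] [Module R M] :
    TensorAlgebra.ιInv (1 : TensorAlgebra R M) = 0 := by
  let _ : Module Rᵐᵒᵖ M := Module.compHom _ ((RingHom.id R).fromOpposite mul_comm)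
  have _ : IsCentralScalar R M := ⟨fun _ _ => rfl⟩
  have h : TensorAlgebra.ιInv (1 : TensorAlgebra R M) =
    (TensorAlgebra.toTrivSqZeroExt (1 : TensorAlgebra R M)).snd := rfl
  rw [h, map_one, TrivSqZeroExt.snd_one]

theorem ιInv_ι_mul {R M : Type*} [CommRing R] [AddCommGroup M] [Module R M] (w : M)
    (x : TensorAlgebra R M) :
    TensorAlgebra.ιInv (TensorAlgebra.ι R w * x) = TensorAlgebra.algebraMapInv x • w := by
  let _ : Module Rᵐᵒᵖ M := Module.compHom _ ((RingHom.id R).fromOpposite mul_comm)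
  have _ : IsCentralScalar R M := ⟨fun _ _ => rfl⟩
  have hfst : (TrivSqZeroExt.fstHom R R M).comp TensorAlgebra.toTrivSqZeroExt =
      TensorAlgebra.algebraMapInv := TensorAlgebra.hom_ext (by
        ext
        simp [TensorAlgebra.algebraMapInv])
  have hx : (TensorAlgebra.toTrivSqZeroExt x).fst = TensorAlgebra.algebraMapInv x :=
    DFunLike.congr_fun hfst x
  have hsnd : ∀ y : TensorAlgebra R M,
      TensorAlgebra.ιInv y = (TensorAlgebra.toTrivSqZeroExt y).snd := fun y => rfl
  rw [hsnd, map_mul, TrivSqZeroExt.snd_mul, hx]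
  simp [TensorAlgebra.toTrivSqZeroExt_ι]

section Words

variable {A : Type*} [AddCommGroup A] [Module ℂ A]

theorem wordMap_cast {m n : ℕ} (h : m = n) (w : Fin m → A) (w' : Fin n → A)
    (hw : ∀ i, w i = w' (Fin.cast h i)) : wordMap A m w = wordMap A n w' := by
  subst h
  congr 1
  funext i
  exact hw i

theorem wordMap_eq_word {n : ℕ} (w : Fin n → A) : wordMap A n w = word (List.ofFn w) :=
  wordMap_cast (by simp) _ _ fun i => by simp

theorem subword_eq_word {m : ℕ} (L : List (Fin m)) (a : Fin m → A) :
    subword L a = word (L.map a) :=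
  wordMap_cast (by simp) _ _ fun i => by simp

theorem barWords_eq {m : ℕ} (Ls : List (List (Fin m))) (a : Fin m → A) :
    barWords Ls a = (Ls.map fun J => word (J.map a)).prod := by
  simp only [barWords, subword_eq_word]

@[simp] theorem word_nil : word ([] : List A) = 1 := by
  simp [word, wordMap]

theorem word_cons (a : A) (l : List A) : word (a :: l) = TensorAlgebra.ι ℂ (plusWord a l) := rfl

@[simp] theorem hat_nil (f : Module.Dual ℂ (DoubleTensor A)) : hat f [] = f 1 := by simp [hat]

theorem hat_cons (f : Module.Dual ℂ (DoubleTensor A)) (a : A) (l : List A) :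
    hat f (a :: l) = f (TensorAlgebra.ι ℂ (plusWord a l)) := rfl

theorem hat_counitForm : hat (counitForm (A := A)) = unitSeries := by
  funext l
  cases l with
  | nil => simp [counitForm]
  | cons a l => rw [hat_cons]; simp [counitForm, TensorAlgebra.algebraMapInv]

theorem tPlus_hom_ext {M : Type*} [AddCommGroup M] [Module ℂ M] {f g : TPlus A →ₗ[ℂ] M}
    (h : ∀ (a : A) (l : List A), f (plusWord a l) = g (plusWord a l)) : f = g := by
  refine DirectSum.linearMap_ext _ fun n => ?_
  refine PiTensorProduct.ext (MultilinearMap.ext fun w => ?_)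
  have hw : ∀ (a : A) (l : List A) (hl : l.length = n) (w : Fin (n + 1) → A),
      (∀ i, w i = (a :: l).get (Fin.cast (by simp [hl]) i)) →
      DirectSum.lof ℂ ℕ (fun n => ⨂[ℂ]^(n + 1) A) n (PiTensorProduct.tprod ℂ w) =
        plusWord a l := by
    rintro a l rfl w hw
    unfold plusWord
    congr 2
    funext i
    exact hw i
  have := hw (w 0) (List.ofFn fun i => w (Fin.succ i)) (by simp) w fun i => by
    cases i using Fin.cases <;> simp
  simp only [LinearMap.compMultilinearMap_apply, LinearMap.comp_apply, this, h]

theorem algHom_ext_word {B : Type*} [Ring B] [Algebra ℂ B] {f g : DoubleTensor A →ₐ[ℂ] B}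
    (h : ∀ l, f (word l) = g (word l)) : f = g := by
  refine TensorAlgebra.hom_ext (tPlus_hom_ext fun a l => ?_)
  exact h (a :: l)

theorem span_prod_word :
    Submodule.span ℂ (Set.range fun Ls : List (List A) => (Ls.map word).prod) = ⊤ := by
  have h₁ : Algebra.adjoin ℂ (Set.range (word (A := A))) = ⊤ := by
    have : ∀ x : TPlus A,
        TensorAlgebra.ι ℂ x ∈ Algebra.adjoin ℂ (Set.range (word (A := A))) := by
      intro x
      have := tPlus_hom_ext (f := (Submodule.mkQ (Subalgebra.toSubmodule
        (Algebra.adjoin ℂ (Set.range (word (A := A)))))) ∘ₗ TensorAlgebra.ι ℂ) (g := 0)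
        fun a l => by
          simp only [LinearMap.comp_apply, LinearMap.zero_apply, Submodule.mkQ_apply,
            Submodule.Quotient.mk_eq_zero]
          exact Algebra.subset_adjoin ⟨a :: l, rfl⟩
      have := LinearMap.congr_fun this x
      simpa [Submodule.Quotient.mk_eq_zero] using this
    rw [eq_top_iff, ← TensorAlgebra.adjoin_range_ι, Algebra.adjoin_le_iff]
    rintro _ ⟨x, rfl⟩
    exact this x
  have h₂ := congrArg Subalgebra.toSubmodule h₁
  rw [Algebra.adjoin_eq_span] at h₂
  rw [eq_top_iff, ← Algebra.top_toSubmodule, ← h₂, Submodule.span_le]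
  intro x hx
  obtain ⟨L, hL, rfl⟩ := Submonoid.exists_list_of_mem_closure hx
  choose! f hf using hL
  refine Submodule.subset_span ⟨L.map f, ?_⟩
  simp only [List.map_map]
  congr 1
  conv_rhs => rw [← List.map_id L]
  exact List.map_congr_left fun y hy => hf y hy

theorem linearMap_ext_prod_word {M : Type*} [AddCommGroup M] [Module ℂ M]
    {f g : DoubleTensor A →ₗ[ℂ] M}
    (h : ∀ Ls : List (List A), f (Ls.map word).prod = g (Ls.map word).prod) : f = g := by
  refine LinearMap.ext_on_range span_prod_word h

theorem linearMap_ext_one_ι_mul {M : Type*} [AddCommGroup M] [Module ℂ M]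
    {f g : DoubleTensor A →ₗ[ℂ] M} (h₁ : f 1 = g 1)
    (h : ∀ w x, f (TensorAlgebra.ι ℂ w * x) = g (TensorAlgebra.ι ℂ w * x)) : f = g := by
  refine linearMap_ext_prod_word fun Ls => ?_
  induction Ls with
  | nil => simpa using h₁
  | cons l Ls ih =>
    cases l with
    | nil => simpa using ih
    | cons a l => simpa [word_cons] using h _ _

/-! ### Characters and infinitesimal characters -/

/-- A character as an algebra morphism. -/
noncomputable def IsCharacter.toAlgHom {f : Module.Dual ℂ (DoubleTensor A)} (hf : IsCharacter f) :
    DoubleTensor A →ₐ[ℂ] ℂ :=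
  AlgHom.ofLinearMap f hf.1 hf.2

theorem IsCharacter.toAlgHom_apply {f : Module.Dual ℂ (DoubleTensor A)} (hf : IsCharacter f)
    (x : DoubleTensor A) : hf.toAlgHom x = f x := rfl

theorem isCharacter_algHom (f : DoubleTensor A →ₐ[ℂ] ℂ) : IsCharacter f.toLinearMap :=
  ⟨map_one f, map_mul f⟩

theorem isCharacter_counitForm : IsCharacter (counitForm (A := A)) := isCharacter_algHom _

theorem IsCharacter.isMulBy {f : Module.Dual ℂ (DoubleTensor A)} (hf : IsCharacter f) :
    IsMulBy f f := fun _ _ => hf.2 _ _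

theorem IsCharacter.ext {f g : Module.Dual ℂ (DoubleTensor A)} (hf : IsCharacter f)
    (hg : IsCharacter g) (h : hat f = hat g) : f = g := by
  have : hf.toAlgHom = hg.toAlgHom := algHom_ext_word fun l => congrFun h l
  exact LinearMap.ext fun x => DFunLike.congr_fun this x

/-- The character with given values on `T₊(A)`. -/
noncomputable def charForm (φ : Module.Dual ℂ (TPlus A)) : Module.Dual ℂ (DoubleTensor A) :=
  (TensorAlgebra.lift ℂ φ).toLinearMap

theorem isCharacter_charForm (φ : Module.Dual ℂ (TPlus A)) : IsCharacter (charForm φ) :=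
  isCharacter_algHom _

@[simp] theorem charForm_ι (φ : Module.Dual ℂ (TPlus A)) (w : TPlus A) :
    charForm φ (TensorAlgebra.ι ℂ w) = φ w := by simp [charForm]

theorem hat_charForm_cons (φ : Module.Dual ℂ (TPlus A)) (a : A) (l : List A) :
    hat (charForm φ) (a :: l) = φ (plusWord a l) := by rw [hat_cons, charForm_ι]

/-- The infinitesimal character with given values on `T₊(A)`. -/
noncomputable def infForm (φ : Module.Dual ℂ (TPlus A)) : Module.Dual ℂ (DoubleTensor A) :=
  φ ∘ₗ TensorAlgebra.ιInv

@[simp] theorem infForm_ι (φ : Module.Dual ℂ (TPlus A)) (w : TPlus A) :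
    infForm φ (TensorAlgebra.ι ℂ w) = φ w := by
  simp only [infForm, LinearMap.comp_apply]
  rw [TensorAlgebra.ι_leftInverse w]

theorem hat_infForm_cons (φ : Module.Dual ℂ (TPlus A)) (a : A) (l : List A) :
    hat (infForm φ) (a :: l) = φ (plusWord a l) := by rw [hat_cons, infForm_ι]

theorem isMulBy_infForm (φ : Module.Dual ℂ (TPlus A)) : IsMulBy (infForm φ) counitForm := by
  intro w x
  rw [infForm_ι, infForm, LinearMap.comp_apply, ιInv_ι_mul, map_smul, smul_eq_mul, mul_comm]
  rfl

theorem infForm_one (φ : Module.Dual ℂ (TPlus A)) : infForm φ 1 = 0 := by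
  rw [infForm, LinearMap.comp_apply, ιInv_one, map_zero]

theorem isInfinitesimal_of_isMulBy {α : Module.Dual ℂ (DoubleTensor A)} (h₁ : α 1 = 0)
    (h : IsMulBy α counitForm) : IsInfinitesimal α := by
  intro l hl
  match l with
  | [] => simpa using h₁
  | [a] => simp at hl
  | a :: b :: l =>
    rw [List.map_cons, List.prod_cons, h, List.map_cons, List.prod_cons,
      isCharacter_counitForm.2]
    simp [counitForm, TensorAlgebra.algebraMapInv]

theorem IsInfinitesimal.eq_infForm {α : Module.Dual ℂ (DoubleTensor A)} (h : IsInfinitesimal α) :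
    α = infForm (α ∘ₗ TensorAlgebra.ι ℂ) := by
  have h' := isInfinitesimal_of_isMulBy (infForm_one (α ∘ₗ TensorAlgebra.ι ℂ))
    (isMulBy_infForm _)
  refine linearMap_ext_prod_word fun Ls => ?_
  obtain ⟨l, hl⟩ : ∃ l : List (TPlus A), (l.map (TensorAlgebra.ι ℂ)).prod =
      (Ls.map word).prod := by
    induction Ls with
    | nil => exact ⟨[], rfl⟩
    | cons L Ls ih =>
      obtain ⟨l, hl⟩ := ih
      cases L with
      | nil => exact ⟨l, by simp [hl]⟩
      | cons a L => exact ⟨plusWord a L :: l, by simp [hl, word_cons]⟩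
  rw [← hl]
  by_cases hlen : l.length = 1
  · obtain ⟨a, rfl⟩ := List.length_eq_one_iff.1 hlen
    simp
  · rw [h l hlen, h' l hlen]

theorem IsInfinitesimal.isMulBy {α : Module.Dual ℂ (DoubleTensor A)} (h : IsInfinitesimal α) :
    IsMulBy α counitForm := by
  rw [h.eq_infForm]
  exact isMulBy_infForm _

theorem IsInfinitesimal.one {α : Module.Dual ℂ (DoubleTensor A)} (h : IsInfinitesimal α) :
    α 1 = 0 := by
  rw [h.eq_infForm]
  exact infForm_one _

theorem IsInfinitesimal.ext {α β : Module.Dual ℂ (DoubleTensor A)} (hα : IsInfinitesimal α)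
    (hβ : IsInfinitesimal β) (h : ∀ a l, hat α (a :: l) = hat β (a :: l)) : α = β := by
  rw [hα.eq_infForm, hβ.eq_infForm]
  congr 1
  exact tPlus_hom_ext fun a l => h a l

end Words

/-! ### The coproducts on words -/

section Coproducts

variable {A : Type*} [AddCommGroup A] [Module ℂ A]

@[simp] theorem contract_tmul (g : Module.Dual ℂ (DoubleTensor A)) (u v : DoubleTensor A) :
    contract g (u ⊗ₜ v) = g v • u := by
  simp [contract]

theorem mul'_map_eq (f g : Module.Dual ℂ (DoubleTensor A))
    (t : DoubleTensor A ⊗[ℂ] DoubleTensor A) :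
    LinearMap.mul' ℂ ℂ (TensorProduct.map f g t) = f (contract g t) := by
  induction t with
  | zero => simp
  | tmul u v => simp [mul_comm]
  | add s t hs ht => simp only [map_add, hs, ht]

theorem conv_apply (f g : Module.Dual ℂ (DoubleTensor A)) (x : DoubleTensor A) :
    conv f g x = f (contract g (coproduct x)) := mul'_map_eq f g _

theorem leftShuffle_apply (f g : Module.Dual ℂ (DoubleTensor A)) (x : DoubleTensor A) :
    leftShuffle f g x = f (contract g (leftCoproduct x)) := mul'_map_eq f g _

theorem rightShuffle_apply (f g : Module.Dual ℂ (DoubleTensor A)) (x : DoubleTensor A) :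
    rightShuffle f g x = f (contract g (rightCoproduct x)) := mul'_map_eq f g _

/-- Multiplicativity of the contraction holds as soon as `g` is multiplicative on the right
tensor factors that occur. -/
theorem contract_tmul_mul {g g' : Module.Dual ℂ (DoubleTensor A)} (u v : DoubleTensor A)
    (h : ∀ y, g (v * y) = g v * g' y) (t : DoubleTensor A ⊗[ℂ] DoubleTensor A) :
    contract g (u ⊗ₜ v * t) = contract g (u ⊗ₜ v) * contract g' t := by
  induction t with
  | zero => simp
  | tmul x y => simp [h, smul_smul, mul_comm]
  | add s t hs ht => simp only [mul_add, map_add, hs, ht]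

theorem IsCharacter.contract_mul {g : Module.Dual ℂ (DoubleTensor A)} (hg : IsCharacter g)
    (s t : DoubleTensor A ⊗[ℂ] DoubleTensor A) :
    contract g (s * t) = contract g s * contract g t := by
  induction s with
  | zero => simp
  | tmul u v => exact contract_tmul_mul u v (hg.2 v) t
  | add s s' hs hs' => simp only [add_mul, map_add, hs, hs']

theorem coproductOver_plusWord (F : (n : ℕ) → Finset (Finset (Fin (n + 1)))) (a : A)
    (l : List A) : coproductOver F (plusWord a l) =
      ∑ S ∈ F l.length, coproductTerm S (fun i : Fin (l.length + 1) => (a :: l).get i) := by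
  unfold coproductOver plusWord
  rw [DirectSum.toModule_lof, PiTensorProduct.lift.tprod, sum_apply]

theorem coproductTerm_apply {m : ℕ} (S : Finset (Fin m)) (a : Fin m → A) :
    coproductTerm S a = subword (chosen S) a ⊗ₜ[ℂ] barWords (gaps S) a := rfl

theorem halfExtension_ι (δ : TPlus A →ₗ[ℂ] DoubleTensor A ⊗[ℂ] DoubleTensor A) (w : TPlus A) :
    halfExtension δ (TensorAlgebra.ι ℂ w) = δ w := by
  have := halfExtension_ι_mul δ w 1
  simpa using this

theorem sum_filter_mem_zero {n : ℕ} {M : Type*} [AddCommMonoid M]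
    (X : Finset (Fin (n + 1)) → M) :
    ∑ S ∈ Finset.univ.filter (fun S : Finset (Fin (n + 1)) => 0 ∈ S), X S =
      ∑ T ∈ (((List.finRange n).map Fin.succ).toFinset).powerset, X (insert 0 T) := by
  have hL : (Finset.univ : Finset (Fin (n + 1))) =
      insert 0 ((List.finRange n).map Fin.succ).toFinset := by
    rw [← List.toFinset_cons, ← List.finRange_succ, List.toFinset_finRange]
  have h0 : (0 : Fin (n + 1)) ∉ ((List.finRange n).map Fin.succ).toFinset := by simp
  rw [← Finset.powerset_univ, hL, Finset.sum_filter, Finset.sum_powerset_insert h0]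
  have : ∀ T ∈ (((List.finRange n).map Fin.succ).toFinset).powerset,
      (if (0 : Fin (n + 1)) ∈ T then X T else 0) = 0 := fun T hT =>
    if_neg fun h => h0 (Finset.mem_powerset.1 hT h)
  rw [Finset.sum_eq_zero this, zero_add]
  exact Finset.sum_congr rfl fun T _ => if_pos (Finset.mem_insert_self _ _)

theorem sum_filter_notMem_zero {n : ℕ} {M : Type*} [AddCommMonoid M]
    (X : Finset (Fin (n + 1)) → M) :
    ∑ S ∈ Finset.univ.filter (fun S : Finset (Fin (n + 1)) => 0 ∉ S), X S =
      ∑ T ∈ (((List.finRange n).map Fin.succ).toFinset).powerset, X T := by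
  refine Finset.sum_congr (Finset.ext fun S => ?_) fun _ _ => rfl
  simp only [Finset.mem_filter, Finset.mem_univ, true_and, Finset.mem_powerset]
  constructor
  · intro h i hi
    cases i using Fin.cases with
    | zero => exact absurd hi h
    | succ i => simp
  · intro h h0
    simpa using h h0

theorem IsCharacter.prod_map_hat {g : Module.Dual ℂ (DoubleTensor A)} (hg : IsCharacter g)
    {m : ℕ} (Ls : List (List (Fin m))) (a : Fin m → A) :
    g (barWords Ls a) = (Ls.map fun J => hat g (J.map a)).prod := by
  rw [barWords_eq, ← hg.toAlgHom_apply, map_list_prod, List.map_map]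
  rfl

theorem map_succ_get_cons {α : Type*} (a : α) (l : List α) :
    ((List.finRange l.length).map Fin.succ).map
      (fun i : Fin (l.length + 1) => (a :: l).get i) = l := by
  rw [List.map_map]
  exact List.ext_get (by simp) fun i h₁ h₂ => by simp

theorem contract_leftCoproduct_word {g : Module.Dual ℂ (DoubleTensor A)} (hg : IsCharacter g)
    (a : A) (l : List A) : contract g (leftCoproduct (word (a :: l))) =
      wsubst (hat g) (lderiv a word) (hat g) l := by
  have key := sum_gapProd_smul_eq_wsubst
    (fun J => hat g (J.map fun i : Fin (l.length + 1) => (a :: l).get i))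
    (fun J => lderiv a word (J.map fun i : Fin (l.length + 1) => (a :: l).get i))
    (fun J => hat g (J.map fun i : Fin (l.length + 1) => (a :: l).get i))
    ((List.finRange l.length).map Fin.succ)
    ((List.nodup_finRange _).map (Fin.succ_injective _))
  rw [← wsubst_map, map_succ_get_cons] at key
  rw [← key, word_cons, leftCoproduct, halfExtension_ι, leftCoproductWord,
    coproductOver_plusWord, sum_filter_mem_zero, map_sum]
  refine Finset.sum_congr rfl fun T hT => ?_
  have h₁ : ∀ j ∈ (List.finRange l.length).map Fin.succ,
      decide (j ∈ insert 0 T) = decide (j ∈ T) := by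
    simpa using fun j (h : ¬j = 0) h' => absurd h' h
  have hc : chosen (insert 0 T) =
      0 :: ((List.finRange l.length).map Fin.succ).filter (fun i => decide (i ∈ T)) := by
    rw [chosen, List.finRange_succ, List.filter_cons_of_pos (by simp), List.filter_congr h₁]
  have hG : gaps (insert 0 T) =
      [] :: ((List.finRange l.length).map Fin.succ).splitOnP (fun i => decide (i ∈ T)) := by
    rw [gaps, List.finRange_succ, List.splitOnP_cons_eq_if_modifyHead, splitOnP_congr h₁]
    simp
  rw [coproductTerm_apply, contract_tmul, hg.prod_map_hat, subword_eq_word, hc, hG]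
  obtain ⟨J, Js, hJ⟩ := List.exists_cons_of_ne_nil
    (List.splitOnP_ne_nil (fun i => decide (i ∈ T)) ((List.finRange l.length).map Fin.succ))
  simp [hJ, gapProd, hg.1]

/-- The right factors of `Δ_≻` of a word start with a non-empty word. -/
theorem exists_barWords_gaps {n : ℕ} {T : Finset (Fin (n + 1))} (hT : 0 ∉ T)
    (w : Fin (n + 1) → A) :
    ∃ J Js, ((List.finRange n).map Fin.succ).splitOnP (fun i => decide (i ∈ T)) = J :: Js ∧
      barWords (gaps T) w =
        TensorAlgebra.ι ℂ (plusWord (w 0) (J.map w)) * barWords Js w := by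
  obtain ⟨J, Js, hJ⟩ := List.exists_cons_of_ne_nil
    (List.splitOnP_ne_nil (fun i => decide (i ∈ T)) ((List.finRange n).map Fin.succ))
  refine ⟨J, Js, hJ, ?_⟩
  have hG : gaps T = (0 :: J) :: Js := by
    rw [gaps, List.finRange_succ, List.splitOnP_cons_eq_if_modifyHead, hJ]
    simp [hT]
  rw [hG, barWords_eq, barWords_eq, List.map_cons, List.prod_cons, List.map_cons, word_cons]

theorem contract_rightCoproduct_word {g g' : Module.Dual ℂ (DoubleTensor A)}
    (hg : IsMulBy g g') (hg' : IsCharacter g') (a : A) (l : List A) :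
    contract g (rightCoproduct (word (a :: l))) =
      wsubst (hat g') word (lderiv a (hat g)) l := by
  have key := sum_gapProd_smul_eq_wsubst
    (fun J => hat g' (J.map fun i : Fin (l.length + 1) => (a :: l).get i))
    (fun J => word (J.map fun i : Fin (l.length + 1) => (a :: l).get i))
    (fun J => lderiv a (hat g) (J.map fun i : Fin (l.length + 1) => (a :: l).get i))
    ((List.finRange l.length).map Fin.succ)
    ((List.nodup_finRange _).map (Fin.succ_injective _))
  rw [← wsubst_map, map_succ_get_cons] at key
  rw [← key, word_cons, rightCoproduct, halfExtension_ι, rightCoproductWord,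
    coproductOver_plusWord, sum_filter_notMem_zero, map_sum]
  refine Finset.sum_congr rfl fun T hT => ?_
  have hT0 : 0 ∉ T := fun h => by simpa using Finset.mem_powerset.1 hT h
  have hc : chosen T =
      ((List.finRange l.length).map Fin.succ).filter (fun i => decide (i ∈ T)) := by
    rw [chosen, List.finRange_succ, List.filter_cons_of_neg (by simpa using hT0)]
  obtain ⟨J, Js, hJ, hb⟩ := exists_barWords_gaps hT0
    (fun i : Fin (l.length + 1) => (a :: l).get i)
  rw [coproductTerm_apply, contract_tmul, hb, hg, hg'.prod_map_hat, subword_eq_word, hc, hJ]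
  simp [gapProd, hat_cons]

theorem coproduct_word_cons (a : A) (l : List A) :
    coproduct (word (a :: l)) =
      leftCoproduct (word (a :: l)) + rightCoproduct (word (a :: l)) := by
  rw [word_cons, coproduct, TensorAlgebra.lift_ι_apply, leftCoproduct, rightCoproduct,
    halfExtension_ι, halfExtension_ι, coproductWord, leftCoproductWord, rightCoproductWord,
    coproductOver_plusWord, coproductOver_plusWord, coproductOver_plusWord,
    Finset.sum_filter_add_sum_filter_not]

theorem contract_coproduct_word {g : Module.Dual ℂ (DoubleTensor A)} (hg : IsCharacter g)
    (l : List A) : contract g (coproduct (word l)) = wsubst (hat g) word (hat g) l := by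
  cases l with
  | nil =>
    rw [word_nil, map_one, Algebra.TensorProduct.one_def, contract_tmul]
    simp
  | cons a l =>
    rw [coproduct_word_cons, map_add, contract_leftCoproduct_word hg,
      contract_rightCoproduct_word hg.isMulBy hg, wsubst_cons, hat_nil, hg.1, one_smul]

theorem contract_coproduct_mul {g : Module.Dual ℂ (DoubleTensor A)} (hg : IsCharacter g)
    (x y : DoubleTensor A) : contract g (coproduct (x * y)) =
      contract g (coproduct x) * contract g (coproduct y) := by
  rw [map_mul, hg.contract_mul]

theorem contract_coproduct_one {g : Module.Dual ℂ (DoubleTensor A)} (hg : IsCharacter g) :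
    contract g (coproduct 1) = 1 := by
  rw [map_one, Algebra.TensorProduct.one_def, contract_tmul, hg.1, one_smul]

theorem contract_leftCoproduct_ι_mul {g : Module.Dual ℂ (DoubleTensor A)} (hg : IsCharacter g)
    (w : TPlus A) (x : DoubleTensor A) :
    contract g (leftCoproduct (TensorAlgebra.ι ℂ w * x)) =
      contract g (leftCoproduct (TensorAlgebra.ι ℂ w)) * contract g (coproduct x) := by
  rw [leftCoproduct, halfExtension_ι_mul, halfExtension_ι, hg.contract_mul]

theorem contract_rightCoproduct_ι_mul {g g' : Module.Dual ℂ (DoubleTensor A)}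
    (hg : IsMulBy g g') (hg' : IsCharacter g') (w : TPlus A) (x : DoubleTensor A) :
    contract g (rightCoproduct (TensorAlgebra.ι ℂ w * x)) =
      contract g (rightCoproduct (TensorAlgebra.ι ℂ w)) * contract g' (coproduct x) := by
  rw [rightCoproduct, halfExtension_ι_mul, halfExtension_ι]
  have : contract g ∘ₗ LinearMap.mulRight ℂ (coproduct x) ∘ₗ rightCoproductWord (A := A) =
      LinearMap.mulRight ℂ (contract g' (coproduct x)) ∘ₗ contract g ∘ₗ rightCoproductWord := by
    refine tPlus_hom_ext fun a l => ?_
    simp only [LinearMap.comp_apply, LinearMap.mulRight_apply, rightCoproductWord,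
      coproductOver_plusWord, map_sum]
    refine Finset.sum_congr rfl fun T hT => ?_
    obtain ⟨J, Js, -, hb⟩ := exists_barWords_gaps (Finset.mem_filter.1 hT).2
      (fun i : Fin (l.length + 1) => (a :: l).get i)
    rw [coproductTerm_apply]
    refine contract_tmul_mul _ _ (fun y => ?_) _
    rw [hb, mul_assoc, hg, hg, hg'.2, mul_assoc]
  exact LinearMap.congr_fun this w

/-! ### The group of characters -/

theorem hat_conv {f g : Module.Dual ℂ (DoubleTensor A)} (hg : IsCharacter g) :
    hat (conv f g) = wsubst (hat g) (hat f) (hat g) := by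
  funext l
  rw [hat, conv_apply, contract_coproduct_word hg, map_wsubst]
  rfl

theorem IsCharacter.conv {f g : Module.Dual ℂ (DoubleTensor A)} (hf : IsCharacter f)
    (hg : IsCharacter g) : IsCharacter (conv f g) :=
  ⟨by rw [conv_apply, contract_coproduct_one hg, hf.1], fun x y => by
    simp only [conv_apply, contract_coproduct_mul hg, hf.2]⟩

/-- The comodule property of the contractions; it replaces the coassociativity of `Δ`. -/
theorem contract_coproduct_contract {g h : Module.Dual ℂ (DoubleTensor A)} (hg : IsCharacter g)
    (hh : IsCharacter h) (x : DoubleTensor A) :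
    contract g (coproduct (contract h (coproduct x))) =
      contract (conv g h) (coproduct x) := by
  have : (contract g ∘ₗ coproduct.toLinearMap) ∘ₗ (contract h ∘ₗ coproduct.toLinearMap) =
      contract (_root_.conv g h) ∘ₗ (coproduct (A := A)).toLinearMap := by
    refine linearMap_ext_prod_word fun Ls => ?_
    simp only [LinearMap.comp_apply, AlgHom.toLinearMap_apply]
    induction Ls with
    | nil => simp only [List.map_nil, List.prod_nil, contract_coproduct_one hh,
        contract_coproduct_one hg, contract_coproduct_one (hg.conv hh)]
    | cons l Ls ih =>
      rw [List.map_cons, List.prod_cons, contract_coproduct_mul hh, contract_coproduct_mul hg, ih,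
        contract_coproduct_mul (hg.conv hh), contract_coproduct_word hh,
        contract_coproduct_word (hg.conv hh), hat_conv hh]
      have := map_wsubst (contract g ∘ₗ (coproduct (A := A)).toLinearMap) (hat h) word (hat h) l
      simp only [LinearMap.comp_apply, AlgHom.toLinearMap_apply, contract_coproduct_word hg] at this
      rw [this, ← wsubst_assoc]
  exact LinearMap.congr_fun this x

theorem contract_counitForm_coproduct (x : DoubleTensor A) :
    contract counitForm (coproduct x) = x := by
  have : contract counitForm ∘ₗ (coproduct (A := A)).toLinearMap = LinearMap.id := by
    refine linearMap_ext_prod_word fun Ls => ?_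
    simp only [LinearMap.comp_apply, AlgHom.toLinearMap_apply, LinearMap.id_apply]
    induction Ls with
    | nil => simp only [List.map_nil, List.prod_nil, contract_coproduct_one isCharacter_counitForm]
    | cons l Ls ih =>
      rw [List.map_cons, List.prod_cons, contract_coproduct_mul isCharacter_counitForm, ih,
        contract_coproduct_word isCharacter_counitForm, hat_counitForm, wsubst_unitSeries]
  exact LinearMap.congr_fun this x

theorem conv_counitForm (f : Module.Dual ℂ (DoubleTensor A)) : conv f counitForm = f :=
  LinearMap.ext fun x => by rw [conv_apply, contract_counitForm_coproduct]

theorem counitForm_conv {f : Module.Dual ℂ (DoubleTensor A)} (hf : IsCharacter f) :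
    conv counitForm f = f :=
  (isCharacter_counitForm.conv hf).ext hf (by
    rw [hat_conv hf, hat_counitForm, wsubst_unitSeries_left])

theorem conv_assoc (f : Module.Dual ℂ (DoubleTensor A)) {g h : Module.Dual ℂ (DoubleTensor A)}
    (hg : IsCharacter g) (hh : IsCharacter h) : conv (conv f g) h = conv f (conv g h) :=
  LinearMap.ext fun x => by
    rw [conv_apply, conv_apply, conv_apply, contract_coproduct_contract hg hh]

/-- A map on linear forms on `T₊(A)` has a fixed point if the values of `T φ` on the words of
length at most `n + 1` depend only on the values of `φ` on the words of length at most `n`.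
(The word `plusWord a l` has length `l.length + 1`.) -/
theorem exists_eq_self_of_contracting (T : Module.Dual ℂ (TPlus A) → Module.Dual ℂ (TPlus A))
    (hT : ∀ (n : ℕ) (φ φ' : Module.Dual ℂ (TPlus A)),
      (∀ (a : A) (l : List A), l.length < n → φ (plusWord a l) = φ' (plusWord a l)) →
      ∀ (a : A) (l : List A), l.length < n + 1 → T φ (plusWord a l) = T φ' (plusWord a l)) :
    ∃ φ, T φ = φ := by
  have stable : ∀ (n k : ℕ) (a : A) (l : List A), l.length < n →
      T^[n + k] 0 (plusWord a l) = T^[n] 0 (plusWord a l) := by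
    intro n
    induction n with
    | zero => intro k a l hl; omega
    | succ n ih =>
      intro k a l hl
      rw [show n + 1 + k = (n + k) + 1 by omega, Function.iterate_succ_apply',
        Function.iterate_succ_apply']
      exact hT n _ _ (ih k) a l hl
  let φ : Module.Dual ℂ (TPlus A) := DirectSum.toModule ℂ ℕ ℂ fun n =>
    T^[n + 1] 0 ∘ₗ DirectSum.lof ℂ ℕ (fun n => ⨂[ℂ]^(n + 1) A) n
  have hφ : ∀ (a : A) (l : List A), φ (plusWord a l) = T^[l.length + 1] 0 (plusWord a l) := by
    intro a l
    simp only [φ]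
    unfold plusWord
    rw [DirectSum.toModule_lof]
    rfl
  refine ⟨φ, tPlus_hom_ext fun a l => ?_⟩
  rw [hφ, Function.iterate_succ_apply']
  refine hT l.length _ _ (fun b l' hl' => ?_) a l (Nat.lt_succ_self _)
  rw [hφ]
  obtain ⟨k, hk⟩ := Nat.exists_eq_add_of_lt hl'
  rw [show l.length = l'.length + 1 + k by omega, stable (l'.length + 1) k b l' (by omega)]

/-- Right inverses: the term of `f * g` at a word `w` with an empty left factor is `g w`, and the
other terms involve `g` only on shorter words. -/
theorem exists_conv_eq_counitForm {f : Module.Dual ℂ (DoubleTensor A)} (hf : IsCharacter f) :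
    ∃ g, IsCharacter g ∧ conv f g = counitForm := by
  obtain ⟨φ, hφ⟩ := exists_eq_self_of_contracting
    (fun φ => φ - conv f (charForm φ) ∘ₗ TensorAlgebra.ι ℂ) (by
    intro n φ φ' h a l hl
    have h' : ∀ l' : List A, l'.length < (a :: l).length →
        hat (charForm φ) l' = hat (charForm φ') l' := by
      intro l' hl'
      cases l' with
      | nil => rw [hat_nil, hat_nil, (isCharacter_charForm φ).1, (isCharacter_charForm φ').1]
      | cons b l' =>
        rw [hat_charForm_cons, hat_charForm_cons]
        simp only [List.length_cons] at hl'
        exact h b l' (by omega)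
    have key := wsubst_sub_congr (hat f) (a :: l) h' h'
    rw [← hat_conv (isCharacter_charForm φ), ← hat_conv (isCharacter_charForm φ'), hat_nil, hf.1,
      hat_charForm_cons, hat_charForm_cons, hat_cons, hat_cons] at key
    simp only [smul_eq_mul, mul_one] at key
    simp only [LinearMap.sub_apply, LinearMap.comp_apply]
    linear_combination -key)
  refine ⟨charForm φ, isCharacter_charForm φ, ?_⟩
  refine (hf.conv (isCharacter_charForm φ)).ext isCharacter_counitForm (funext fun l => ?_)
  rw [hat_counitForm]
  cases l with
  | nil => rw [hat_nil, (hf.conv (isCharacter_charForm φ)).1, unitSeries_nil]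
  | cons a l =>
    rw [sub_eq_self] at hφ
    exact LinearMap.congr_fun hφ (plusWord a l)

theorem exists_isConvInverse {f : Module.Dual ℂ (DoubleTensor A)} (hf : IsCharacter f) :
    ∃ g, IsCharacter g ∧ IsConvInverse f g := by
  obtain ⟨g, hg, hfg⟩ := exists_conv_eq_counitForm hf
  obtain ⟨h, hh, hgh⟩ := exists_conv_eq_counitForm hg
  have : f = h := by
    rw [← conv_counitForm f, ← hgh, ← conv_assoc f hg hh, hfg, counitForm_conv hh]
  exact ⟨g, hg, hfg, this ▸ hgh⟩

/-- The inverse of a character is unique among all linear forms, not only among characters. -/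
theorem IsConvInverse.unique {f g h : Module.Dual ℂ (DoubleTensor A)} (hf : IsCharacter f)
    (hg : IsCharacter g) (hfg : IsConvInverse f g) (hfh : IsConvInverse f h) : h = g := by
  rw [← conv_counitForm h, ← hfg.1, ← conv_assoc h hf hg, hfh.2, counitForm_conv hg]

end Coproducts

/-! ### The exponential of the right half-shuffle -/

section RightExp

variable {A : Type*} [AddCommGroup A] [Module ℂ A]

/-- The right contraction by an infinitesimal character removes a non-empty initial segment of
the first word. -/
theorem IsInfinitesimal.contract_rightCoproduct_word {β : Module.Dual ℂ (DoubleTensor A)}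
    (hβ : IsInfinitesimal β) (a : A) (l : List A) :
    contract β (rightCoproduct (word (a :: l))) = cauchy (lderiv a (hat β)) word l := by
  rw [_root_.contract_rightCoproduct_word hβ.isMulBy isCharacter_counitForm, hat_counitForm,
    wsubst_unitSeries_eq_cauchy]

theorem IsInfinitesimal.contract_rightCoproduct_ι_mul {β : Module.Dual ℂ (DoubleTensor A)}
    (hβ : IsInfinitesimal β) (w : TPlus A) (x : DoubleTensor A) :
    contract β (rightCoproduct (TensorAlgebra.ι ℂ w * x)) =
      contract β (rightCoproduct (TensorAlgebra.ι ℂ w)) * x := by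
  rw [_root_.contract_rightCoproduct_ι_mul hβ.isMulBy isCharacter_counitForm,
    contract_counitForm_coproduct]

theorem rightPow_eq (β : Module.Dual ℂ (DoubleTensor A)) (n : ℕ) (x : DoubleTensor A) :
    rightPow β n x = counitForm ((contract β ∘ₗ rightCoproduct)^[n] x) := by
  induction n generalizing x with
  | zero => rfl
  | succ n ih =>
    rw [rightPow, rightShuffle_apply, ih, Function.iterate_succ_apply]
    rfl

theorem cauchy_mem {α M : Type*} [AddCommGroup M] [Module ℂ M] (p : Submodule ℂ M)
    (u : List α → ℂ) (f : List α → M) (l : List α)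
    (h : ∀ l' : List α, l'.length ≤ l.length → f l' ∈ p) : cauchy u f l ∈ p := by
  induction l generalizing u with
  | nil => exact p.smul_mem _ (h [] le_rfl)
  | cons a l ih =>
    exact p.add_mem (p.smul_mem _ (h _ le_rfl)) (ih _ fun l' hl' => h l' (hl'.trans (by simp)))

/-- Contraction by an infinitesimal character shortens a bar product of words. -/
theorem IsInfinitesimal.iterate_eq_zero {β : Module.Dual ℂ (DoubleTensor A)}
    (hβ : IsInfinitesimal β) (n : ℕ) (Ls : List (List A))
    (h : (Ls.map List.length).sum < n) :
    ((contract β ∘ₗ rightCoproduct) ^ n) (Ls.map word).prod = 0 := by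
  induction n generalizing Ls with
  | zero => omega
  | succ n ih =>
    induction Ls with
    | nil =>
      rw [pow_succ, Module.End.mul_apply, List.map_nil, List.prod_nil, LinearMap.comp_apply,
        rightCoproduct, halfExtension_one, map_zero, map_zero]
    | cons l Ls ihL =>
      cases l with
      | nil => simpa using ihL (by simpa using h)
      | cons a l =>
        rw [pow_succ, Module.End.mul_apply, List.map_cons, List.prod_cons, LinearMap.comp_apply,
          word_cons, hβ.contract_rightCoproduct_ι_mul, ← word_cons,
          hβ.contract_rightCoproduct_word]
        have := map_cauchy (LinearMap.mulRight ℂ (Ls.map word).prod) (lderiv a (hat β)) word l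
        rw [LinearMap.mulRight_apply] at this
        rw [this, ← LinearMap.mem_ker]
        refine cauchy_mem _ _ _ _ fun l' hl' => ?_
        rw [LinearMap.mem_ker, LinearMap.mulRight_apply]
        refine ih (l' :: Ls) ?_
        simp only [List.map_cons, List.sum_cons, List.length_cons] at h ⊢
        omega

theorem IsInfinitesimal.exists_iterate_eq_zero {β : Module.Dual ℂ (DoubleTensor A)}
    (hβ : IsInfinitesimal β) (x : DoubleTensor A) :
    ∃ N, ∀ n, N ≤ n → ((contract β ∘ₗ rightCoproduct) ^ n) x = 0 := by
  have hx : x ∈ Submodule.span ℂ (Set.range fun Ls : List (List A) => (Ls.map word).prod) := by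
    rw [span_prod_word]
    exact Submodule.mem_top
  induction hx using Submodule.span_induction with
  | mem x hx =>
    obtain ⟨Ls, rfl⟩ := hx
    exact ⟨(Ls.map List.length).sum + 1, fun n hn => hβ.iterate_eq_zero n Ls hn⟩
  | zero => exact ⟨0, fun n _ => map_zero _⟩
  | add x y _ _ hx hy =>
    obtain ⟨N, hN⟩ := hx
    obtain ⟨N', hN'⟩ := hy
    exact ⟨max N N', fun n hn => by
      rw [map_add, hN n (le_of_max_le_left hn), hN' n (le_of_max_le_right hn), add_zero]⟩
  | smul c x _ hx =>
    obtain ⟨N, hN⟩ := hx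
    exact ⟨N, fun n hn => by rw [map_smul, hN n hn, smul_zero]⟩

theorem IsRightExp.unique {β Φ Φ' : Module.Dual ℂ (DoubleTensor A)} (h : IsRightExp β Φ)
    (h' : IsRightExp β Φ') : Φ = Φ' := by
  refine LinearMap.ext fun x => ?_
  obtain ⟨N, hN, hx⟩ := h x
  obtain ⟨N', hN', hx'⟩ := h' x
  rw [hx, hx']
  rcases le_total N N' with hle | hle
  · refine Finset.sum_subset (by simpa using hle) fun n _ hn => hN n (by simpa using hn)
  · refine (Finset.sum_subset (by simpa using hle) fun n _ hn => hN' n (by simpa using hn)).symm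

/-- A character `Φ` with `Φ = ε + Φ ≻ β` on words is the right exponential of `β`: the equation
extends to all of `T(T₊(A))` and may be iterated. -/
theorem IsCharacter.isRightExp {β Φ : Module.Dual ℂ (DoubleTensor A)} (hΦ : IsCharacter Φ)
    (hβ : IsInfinitesimal β)
    (h : ∀ a l, hat Φ (a :: l) = cauchy (lderiv a (hat β)) (hat Φ) l) : IsRightExp β Φ := by
  have hfix : Φ = counitForm + Φ ∘ₗ contract β ∘ₗ rightCoproduct := by
    refine linearMap_ext_one_ι_mul ?_ fun w x => ?_
    · simp [hΦ.1, isCharacter_counitForm.1, rightCoproduct, halfExtension_one]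
    · have hw : Φ ∘ₗ TensorAlgebra.ι ℂ =
          (Φ ∘ₗ contract β ∘ₗ rightCoproduct) ∘ₗ TensorAlgebra.ι ℂ := by
        refine tPlus_hom_ext fun a l => ?_
        have := h a l
        rw [hat_cons] at this
        simp only [LinearMap.comp_apply]
        rw [this, ← word_cons, hβ.contract_rightCoproduct_word, map_cauchy]
        rfl
      have hw' := LinearMap.congr_fun hw w
      simp only [LinearMap.comp_apply] at hw'
      rw [hΦ.2, hw', LinearMap.add_apply, isCharacter_counitForm.2, LinearMap.comp_apply,
        LinearMap.comp_apply, hβ.contract_rightCoproduct_ι_mul, hΦ.2]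
      simp [counitForm, TensorAlgebra.algebraMapInv]
  have hsum : ∀ (N : ℕ) (x : DoubleTensor A), Φ x = ∑ n ∈ Finset.range N, rightPow β n x +
      Φ (((contract β ∘ₗ rightCoproduct) ^ N) x) := by
    intro N x
    induction N with
    | zero => simp
    | succ N ih =>
      rw [ih, Finset.sum_range_succ, add_assoc, rightPow_eq, ← Module.End.pow_apply, pow_succ',
        Module.End.mul_apply]
      congr 1
      exact LinearMap.congr_fun hfix _
  intro x
  obtain ⟨N, hN⟩ := hβ.exists_iterate_eq_zero x
  refine ⟨N, fun n hn => ?_, ?_⟩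
  · rw [rightPow_eq, ← Module.End.pow_apply, hN n hn, map_zero]
  · rw [hsum N x, hN N le_rfl, map_zero, add_zero]

theorem IsInfinitesimal.exists_isRightExp {β : Module.Dual ℂ (DoubleTensor A)}
    (hβ : IsInfinitesimal β) :
    ∃ Φ, IsCharacter Φ ∧ IsRightExp β Φ ∧
      ∀ a l, hat Φ (a :: l) = cauchy (lderiv a (hat β)) (hat Φ) l := by
  have value : ∀ (φ : Module.Dual ℂ (TPlus A)) (a : A) (l : List A),
      rightShuffle (charForm φ) β (TensorAlgebra.ι ℂ (plusWord a l)) =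
        cauchy (lderiv a (hat β)) (hat (charForm φ)) l := by
    intro φ a l
    rw [← word_cons, rightShuffle_apply, hβ.contract_rightCoproduct_word, map_cauchy]
    rfl
  obtain ⟨φ, hφ⟩ := exists_eq_self_of_contracting
    (fun φ => rightShuffle (charForm φ) β ∘ₗ TensorAlgebra.ι ℂ) (by
    intro n φ φ' h a l hl
    simp only [LinearMap.comp_apply, value]
    refine cauchy_congr_right _ _ fun l' hl' => ?_
    cases l' with
    | nil => rw [hat_nil, hat_nil, (isCharacter_charForm φ).1, (isCharacter_charForm φ').1]
    | cons b l' =>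
      rw [hat_charForm_cons, hat_charForm_cons]
      simp only [List.length_cons] at hl'
      exact h b l' (by omega))
  have h : ∀ a l, hat (charForm φ) (a :: l) =
      cauchy (lderiv a (hat β)) (hat (charForm φ)) l := by
    intro a l
    rw [hat_charForm_cons, ← value]
    exact (LinearMap.congr_fun hφ (plusWord a l)).symm
  exact ⟨charForm φ, isCharacter_charForm φ, (isCharacter_charForm φ).isRightExp hβ h, h⟩

theorem IsRightExp.isCharacter {β Φ : Module.Dual ℂ (DoubleTensor A)} (h : IsRightExp β Φ)
    (hβ : IsInfinitesimal β) : IsCharacter Φ := by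
  obtain ⟨Φ', hΦ', h', -⟩ := hβ.exists_isRightExp
  rwa [h.unique h']

theorem IsRightExp.hat_cons {β Φ : Module.Dual ℂ (DoubleTensor A)} (h : IsRightExp β Φ)
    (hβ : IsInfinitesimal β) (a : A) (l : List A) :
    hat Φ (a :: l) = cauchy (lderiv a (hat β)) (hat Φ) l := by
  obtain ⟨Φ', -, h', hc⟩ := hβ.exists_isRightExp
  rw [h.unique h', hc]

/-- Every character is a right exponential: `Φ ≻ β` at a word `w` is `β w` plus terms with `β` on
shorter words. -/
theorem IsCharacter.exists_isRightExp {Φ : Module.Dual ℂ (DoubleTensor A)} (hΦ : IsCharacter Φ) :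
    ∃ β, IsInfinitesimal β ∧ IsRightExp β Φ := by
  have inf : ∀ φ : Module.Dual ℂ (TPlus A), IsInfinitesimal (infForm φ) := fun φ =>
    isInfinitesimal_of_isMulBy (infForm_one φ) (isMulBy_infForm φ)
  have value : ∀ (φ : Module.Dual ℂ (TPlus A)) (a : A) (l : List A),
      rightShuffle Φ (infForm φ) (TensorAlgebra.ι ℂ (plusWord a l)) =
        cauchy (lderiv a (hat (infForm φ))) (hat Φ) l := by
    intro φ a l
    rw [← word_cons, rightShuffle_apply, (inf φ).contract_rightCoproduct_word, map_cauchy]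
    rfl
  obtain ⟨φ, hφ⟩ := exists_eq_self_of_contracting
    (fun φ => φ + (Φ - rightShuffle Φ (infForm φ)) ∘ₗ TensorAlgebra.ι ℂ) (by
    intro n φ φ' h a l hl
    have key := cauchy_sub_congr_left (u := lderiv a (hat (infForm φ)))
      (u' := lderiv a (hat (infForm φ'))) (hat Φ) l fun l' hl' => by
        rw [lderiv_apply, lderiv_apply, hat_infForm_cons, hat_infForm_cons]
        exact h a l' (by omega)
    rw [hat_nil, hΦ.1, lderiv_apply, lderiv_apply, hat_infForm_cons, hat_infForm_cons] at key
    simp only [smul_eq_mul, mul_one] at key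
    simp only [LinearMap.add_apply, LinearMap.comp_apply, LinearMap.sub_apply, value]
    linear_combination -key)
  refine ⟨infForm φ, inf φ, hΦ.isRightExp (inf φ) fun a l => ?_⟩
  rw [add_eq_left] at hφ
  have := LinearMap.congr_fun hφ (plusWord a l)
  simp only [LinearMap.comp_apply, LinearMap.sub_apply, value, LinearMap.zero_apply] at this
  exact sub_eq_zero.1 this

theorem IsRightExp.unique_left {β β' Φ : Module.Dual ℂ (DoubleTensor A)} (h : IsRightExp β Φ)
    (h' : IsRightExp β' Φ) (hβ : IsInfinitesimal β) (hβ' : IsInfinitesimal β') : β = β' := by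
  have key : ∀ (n : ℕ) (a : A) (l : List A), l.length = n →
      hat β (a :: l) = hat β' (a :: l) := by
    intro n
    induction n using Nat.strong_induction_on with
    | _ n ih =>
      rintro a l rfl
      have h₁ := cauchy_sub_congr_left (u := lderiv a (hat β)) (u' := lderiv a (hat β'))
        (hat Φ) l fun l' hl' => ih _ hl' a l' rfl
      rw [← h.hat_cons hβ, ← h'.hat_cons hβ', hat_nil, (h.isCharacter hβ).1] at h₁
      simpa using h₁
  exact hβ.ext hβ' fun a l => key _ a l rfl

/-- Boolean cumulants: the series of `𝓔_≻(β)` is the inverse of `1 - β`. -/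
theorem IsRightExp.cauchy_hat {β Φ : Module.Dual ℂ (DoubleTensor A)} (h : IsRightExp β Φ)
    (hβ : IsInfinitesimal β) :
    hat Φ = unitSeries + cauchy (hat β) (hat Φ) := by
  funext l
  cases l with
  | nil => simp [(h.isCharacter hβ).1, hβ.one]
  | cons a l => rw [h.hat_cons hβ, Pi.add_apply, cauchy_cons, hat_nil, hβ.one]; simp

/-! ### The adjoint action on infinitesimal characters -/

theorem hat_leftShuffle_cons {β ψ : Module.Dual ℂ (DoubleTensor A)} (hψ : IsCharacter ψ)
    (a : A) (l : List A) :
    hat (leftShuffle β ψ) (a :: l) = wsubst (hat ψ) (lderiv a (hat β)) (hat ψ) l := by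
  rw [hat, leftShuffle_apply, contract_leftCoproduct_word hψ, map_wsubst]
  rfl

theorem leftShuffle_one (β ψ : Module.Dual ℂ (DoubleTensor A)) : leftShuffle β ψ 1 = 0 := by
  rw [leftShuffle_apply, leftCoproduct, halfExtension_one, map_zero, map_zero]

theorem rightShuffle_one (β ψ : Module.Dual ℂ (DoubleTensor A)) : rightShuffle β ψ 1 = 0 := by
  rw [rightShuffle_apply, rightCoproduct, halfExtension_one, map_zero, map_zero]

/-- The left factors of `Δ_≺` of a word are non-empty words, on which `β` is multiplicative up to
`ε`. -/
theorem IsInfinitesimal.apply_contract_mul {β ψ : Module.Dual ℂ (DoubleTensor A)}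
    (hβ : IsInfinitesimal β) (hψ : IsCharacter ψ) (w : TPlus A) (y : DoubleTensor A) :
    β (contract ψ (leftCoproduct (TensorAlgebra.ι ℂ w)) * y) =
      β (contract ψ (leftCoproduct (TensorAlgebra.ι ℂ w))) * counitForm y := by
  have : β ∘ₗ LinearMap.mulRight ℂ y ∘ₗ contract ψ ∘ₗ leftCoproduct ∘ₗ TensorAlgebra.ι ℂ =
      counitForm y • β ∘ₗ contract ψ ∘ₗ leftCoproduct ∘ₗ TensorAlgebra.ι ℂ := by
    refine tPlus_hom_ext fun a l => ?_
    simp only [LinearMap.comp_apply, LinearMap.smul_apply, ← word_cons,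
      contract_leftCoproduct_word hψ]
    have h₁ := map_wsubst (β ∘ₗ LinearMap.mulRight ℂ y) (hat ψ) (lderiv a word) (hat ψ) l
    have h₂ := map_wsubst (counitForm y • β) (hat ψ) (lderiv a word) (hat ψ) l
    simp only [LinearMap.comp_apply, LinearMap.smul_apply] at h₁ h₂
    rw [h₁, h₂]
    congr 1
    funext l'
    rw [LinearMap.mulRight_apply, lderiv_apply, word_cons, hβ.isMulBy, smul_eq_mul, mul_comm]
  rw [mul_comm]
  exact LinearMap.congr_fun this w

/-- The form `β ≺ ψ` sees only one word; the remaining ones are evaluated with `ψ`. -/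
theorem IsInfinitesimal.isMulBy_leftShuffle {β ψ : Module.Dual ℂ (DoubleTensor A)}
    (hβ : IsInfinitesimal β) (hψ : IsCharacter ψ) : IsMulBy (leftShuffle β ψ) ψ := by
  intro w x
  rw [leftShuffle_apply, leftShuffle_apply, contract_leftCoproduct_ι_mul hψ,
    hβ.apply_contract_mul hψ, ← conv_apply, counitForm_conv hψ]

/-- The values on further words assemble to `θ * ψ = ε`. -/
theorem IsInfinitesimal.adjoint {β ψ θ : Module.Dual ℂ (DoubleTensor A)}
    (hβ : IsInfinitesimal β) (hψ : IsCharacter ψ) (hθ : IsCharacter θ)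
    (hθψ : conv θ ψ = counitForm) : IsInfinitesimal (rightShuffle θ (leftShuffle β ψ)) := by
  refine isInfinitesimal_of_isMulBy (rightShuffle_one _ _) fun w x => ?_
  rw [rightShuffle_apply, rightShuffle_apply,
    _root_.contract_rightCoproduct_ι_mul (hβ.isMulBy_leftShuffle hψ) hψ, hθ.2, ← conv_apply, hθψ]

theorem IsInfinitesimal.add {α β : Module.Dual ℂ (DoubleTensor A)} (hα : IsInfinitesimal α)
    (hβ : IsInfinitesimal β) : IsInfinitesimal (α + β) := fun l hl => by
  rw [LinearMap.add_apply, hα l hl, hβ l hl, add_zero]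

/-- The series of `θ ≻ β ≺ ψ` is the product of the series of `β ≺ ψ` with the inverse of the
series of `ψ`. -/
theorem IsInfinitesimal.hat_adjoint {β ψ θ : Module.Dual ℂ (DoubleTensor A)}
    (hβ : IsInfinitesimal β) (hψ : IsCharacter ψ) (hθψ : conv θ ψ = counitForm) :
    ∃ y : List A → ℂ, cauchy (hat ψ) y = unitSeries ∧
      hat (rightShuffle θ (leftShuffle β ψ)) = cauchy (hat (leftShuffle β ψ)) y := by
  refine ⟨wsubst (hat ψ) (hat θ) unitSeries, ?_, ?_⟩
  · rw [← wsubst_eq_cauchy, ← hat_conv hψ, hθψ, hat_counitForm]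
  · funext l
    cases l with
    | nil => rw [hat_nil, rightShuffle_one, cauchy_nil, hat_nil, leftShuffle_one, zero_smul]
    | cons a l =>
      rw [cauchy_cons, hat_nil, leftShuffle_one, zero_smul, zero_add, ← wsubst_eq_cauchy]
      rw [hat, rightShuffle_apply,
        _root_.contract_rightCoproduct_word (hβ.isMulBy_leftShuffle hψ) hψ, map_wsubst]
      rfl

end RightExp

/-! ### Sums over non-crossing partitions of finite chains -/

/-- `F` is the set of blocks of a non-crossing partition of `s`. -/
structure IsNCFamily {α : Type*} [LinearOrder α] (s : Finset α) (F : Finset (Finset α)) :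
    Prop where
  nonempty : ∀ P ∈ F, P.Nonempty
  subset : ∀ P ∈ F, P ⊆ s
  cover : ∀ x ∈ s, ∃ P ∈ F, x ∈ P
  disj : ∀ P ∈ F, ∀ Q ∈ F, ∀ x ∈ P, x ∈ Q → P = Q
  nc : ∀ P ∈ F, ∀ Q ∈ F, ∀ a b c d : α, a < b → b < c → c < d →
    a ∈ P → c ∈ P → b ∈ Q → d ∈ Q → P = Q

/-- `P` is not nested inside another block of `F`. -/
def IsOuterIn {α : Type*} [LinearOrder α] (F : Finset (Finset α)) (P : Finset α) : Prop :=
  ¬ ∃ Q ∈ F, Q ≠ P ∧ ∃ a ∈ Q, ∃ b ∈ Q, ∀ c ∈ P, a < c ∧ c < b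

open Classical in
/-- The non-crossing partitions of `s`. -/
noncomputable def ncFamilies {α : Type*} [LinearOrder α] (s : Finset α) :
    Finset (Finset (Finset α)) :=
  s.powerset.powerset.filter (IsNCFamily s)

open Classical in
/-- The weight of a block: `kc` if it is outer and `k` if it is inner. -/
noncomputable def blockWeight {α : Type*} [LinearOrder α] (k kc : ℕ → ℂ)
    (F : Finset (Finset α)) (P : Finset α) : ℂ :=
  if IsOuterIn F P then kc P.card else k P.card

/-- The sum over the non-crossing partitions of `s` of the products of the block weights. -/
noncomputable def ncSum {α : Type*} [LinearOrder α] (k kc : ℕ → ℂ) (s : Finset α) : ℂ :=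
  ∑ F ∈ ncFamilies s, ∏ P ∈ F, blockWeight k kc F P

/-- The variant of `ncSum` in which the block of `a` carries the weight `w`. -/
noncomputable def ncSumAt {α : Type*} [LinearOrder α] (k kc : ℕ → ℂ) (a : α) (w : ℕ → ℂ)
    (s : Finset α) : ℂ :=
  ∑ F ∈ ncFamilies s, ∏ P ∈ F, if a ∈ P then w P.card else blockWeight k kc F P

section NonCrossing

variable {α : Type*} [LinearOrder α]

theorem mem_ncFamilies {s : Finset α} {F : Finset (Finset α)} :
    F ∈ ncFamilies s ↔ IsNCFamily s F := by
  classical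
  simp only [ncFamilies, Finset.mem_filter, Finset.mem_powerset, and_iff_right_iff_imp]
  exact fun h P hP => Finset.mem_powerset.2 (h.subset P hP)

theorem blockWeight_self (k : ℕ → ℂ) (F : Finset (Finset α)) (P : Finset α) :
    blockWeight k k F P = k P.card := by simp [blockWeight]

/-- The block of the minimum is outer. -/
theorem ncSum_eq_ncSumAt (k kc : ℕ → ℂ) {s : Finset α} {a : α} (ha : ∀ x ∈ s, a ≤ x) :
    ncSum k kc s = ncSumAt k kc a kc s := by
  refine Finset.sum_congr rfl fun F hF => Finset.prod_congr rfl fun P hP => ?_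
  have hF := mem_ncFamilies.1 hF
  split_ifs with haP
  · have : IsOuterIn F P := by
      rintro ⟨Q, hQ, -, x, hx, y, -, h⟩
      exact absurd (h a haP).1 (not_lt.2 (ha x (hF.subset Q hQ hx)))
    rw [blockWeight, if_pos this]
  · rfl

/-- `p` follows `a` in a block of `F`. -/
def IsSecond (F : Finset (Finset α)) (a p : α) : Prop :=
  ∃ P ∈ F, a ∈ P ∧ p ∈ P ∧ p ≠ a ∧ ∀ x ∈ P, x = a ∨ p ≤ x

/-- Adds `a` to the sets that contain `p`. -/
def insertAt (a p : α) (Q : Finset α) : Finset α := if p ∈ Q then insert a Q else Q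

theorem mem_insertAt {a p x : α} {Q : Finset α} :
    x ∈ insertAt a p Q ↔ x ∈ Q ∨ (x = a ∧ p ∈ Q) := by
  unfold insertAt
  split_ifs with h <;> simp [h, or_comm]

theorem IsNCFamily.insert_singleton {s : Finset α} {a : α} (ha : a ∈ s) (hmin : ∀ x ∈ s, a ≤ x)
    {G : Finset (Finset α)} (hG : IsNCFamily (s.erase a) G) :
    IsNCFamily s (insert {a} G) := by
  have hsub : ∀ P ∈ G, ∀ x ∈ P, x ∈ s ∧ a < x := fun P hP x hx => by
    have := Finset.mem_erase.1 (hG.subset P hP hx)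
    exact ⟨this.2, lt_of_le_of_ne (hmin x this.2) (Ne.symm this.1)⟩
  refine ⟨?_, ?_, ?_, ?_, ?_⟩
  · intro P hP
    rcases Finset.mem_insert.1 hP with rfl | hP
    · exact Finset.singleton_nonempty a
    · exact hG.nonempty P hP
  · intro P hP x hx
    rcases Finset.mem_insert.1 hP with rfl | hP
    · rwa [Finset.mem_singleton.1 hx]
    · exact (hsub P hP x hx).1
  · intro x hx
    by_cases hxa : x = a
    · exact ⟨{a}, by simp, by simp [hxa]⟩
    · obtain ⟨P, hP, hxP⟩ := hG.cover x (Finset.mem_erase.2 ⟨hxa, hx⟩)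
      exact ⟨P, Finset.mem_insert_of_mem hP, hxP⟩
  · intro P hP Q hQ x hxP hxQ
    rcases Finset.mem_insert.1 hP with rfl | hP <;> rcases Finset.mem_insert.1 hQ with rfl | hQ
    · rfl
    · exact absurd (hsub Q hQ x hxQ).2 (by simp [Finset.mem_singleton.1 hxP])
    · exact absurd (hsub P hP x hxP).2 (by simp [Finset.mem_singleton.1 hxQ])
    · exact hG.disj P hP Q hQ x hxP hxQ
  · intro P hP Q hQ x y z t hxy hyz hzt hx hz hy ht
    rcases Finset.mem_insert.1 hP with rfl | hP <;> rcases Finset.mem_insert.1 hQ with rfl | hQ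
    · rfl
    · rw [Finset.mem_singleton] at hx hz
      exact absurd (hxy.trans hyz) (by simp [hx, hz])
    · rw [Finset.mem_singleton] at hy ht
      exact absurd (hyz.trans hzt) (by simp [hy, ht])
    · exact hG.nc P hP Q hQ x y z t hxy hyz hzt hx hz hy ht

theorem IsNCFamily.erase_singleton {s : Finset α} {a : α} {F : Finset (Finset α)}
    (hF : IsNCFamily s F) (h : {a} ∈ F) : IsNCFamily (s.erase a) (F.erase {a}) := by
  refine ⟨fun P hP => hF.nonempty P (Finset.mem_of_mem_erase hP), ?_, ?_,
    fun P hP Q hQ => hF.disj P (Finset.mem_of_mem_erase hP) Q (Finset.mem_of_mem_erase hQ),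
    fun P hP Q hQ => hF.nc P (Finset.mem_of_mem_erase hP) Q (Finset.mem_of_mem_erase hQ)⟩
  · intro P hP x hx
    obtain ⟨hne, hPF⟩ := Finset.mem_erase.1 hP
    refine Finset.mem_erase.2 ⟨?_, hF.subset P hPF hx⟩
    rintro rfl
    exact hne (hF.disj P hPF _ h x hx (by simp))
  · intro x hx
    obtain ⟨hxa, hx⟩ := Finset.mem_erase.1 hx
    obtain ⟨P, hP, hxP⟩ := hF.cover x hx
    refine ⟨P, Finset.mem_erase.2 ⟨?_, hP⟩, hxP⟩
    rintro rfl
    exact hxa (by simpa using hxP)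

open Classical in
/-- The partitions in which the minimum `a` is a singleton. -/
theorem sum_singleton_mem (k kc w : ℕ → ℂ) {s : Finset α} {a : α} (ha : a ∈ s)
    (hmin : ∀ x ∈ s, a ≤ x) :
    ∑ F ∈ (ncFamilies s).filter (fun F => {a} ∈ F),
        ∏ P ∈ F, (if a ∈ P then w P.card else blockWeight k kc F P) =
      w 1 * ncSum k kc (s.erase a) := by
  rw [ncSum, Finset.mul_sum]
  have hnot : ∀ G ∈ ncFamilies (s.erase a), ∀ P ∈ G, a ∉ P := fun G hG P hP h => by
    simpa using (mem_ncFamilies.1 hG).subset P hP h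
  refine (Finset.sum_nbij' (fun G => insert {a} G) (fun F => F.erase {a}) ?_ ?_ ?_ ?_ ?_).symm
  · intro G hG
    simp only [Finset.mem_filter, mem_ncFamilies, Finset.mem_insert_self, and_true]
    exact (mem_ncFamilies.1 hG).insert_singleton ha hmin
  · intro F hF
    obtain ⟨hF, h⟩ := Finset.mem_filter.1 hF
    exact mem_ncFamilies.2 ((mem_ncFamilies.1 hF).erase_singleton h)
  · intro G hG
    exact Finset.erase_insert fun h => hnot G hG _ h (by simp)
  · intro F hF
    exact Finset.insert_erase (Finset.mem_filter.1 hF).2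
  · intro G hG
    have hG' := mem_ncFamilies.1 hG
    rw [Finset.prod_insert fun h => hnot G hG _ h (by simp)]
    simp only [Finset.mem_singleton, if_true, Finset.card_singleton]
    congr 1
    refine Finset.prod_congr rfl fun P hP => ?_
    rw [if_neg (hnot G hG P hP), blockWeight, blockWeight]
    have : IsOuterIn (insert {a} G) P ↔ IsOuterIn G P := by
      unfold IsOuterIn
      refine not_congr ⟨?_, ?_⟩
      · rintro ⟨Q, hQ, hne, x, hx, y, hy, h⟩
        rcases Finset.mem_insert.1 hQ with rfl | hQ
        · obtain ⟨c, hc⟩ := hG'.nonempty P hP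
          rw [Finset.mem_singleton] at hx hy
          exact absurd ((h c hc).1.trans (h c hc).2) (by simp [hx, hy])
        · exact ⟨Q, hQ, hne, x, hx, y, hy, h⟩
      · rintro ⟨Q, hQ, h⟩
        exact ⟨Q, Finset.mem_insert_of_mem hQ, h⟩
    simp only [this]

/-- If `p` follows the minimum `a` in a block `P` of a non-crossing partition, every other block
lies on one side of `p`. -/
theorem IsNCFamily.side {s : Finset α} {a p : α} (hmin : ∀ x ∈ s, a ≤ x)
    {F : Finset (Finset α)} (hF : IsNCFamily s F) {P : Finset α} (hP : P ∈ F) (haP : a ∈ P)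
    (hpP : p ∈ P) {Q : Finset α} (hQ : Q ∈ F) (hQP : Q ≠ P) :
    Q ⊆ (s.erase a).filter (· < p) ∨ Q ⊆ (s.erase a).filter (p ≤ ·) := by
  have h₁ : ∀ x ∈ Q, x ∈ s.erase a := fun x hx => Finset.mem_erase.2
    ⟨fun h => hQP (hF.disj Q hQ P hP x hx (h ▸ haP)), hF.subset Q hQ hx⟩
  have hp : ∀ x ∈ Q, x ≠ p := fun x hx h => hQP (hF.disj Q hQ P hP x hx (h ▸ hpP))
  by_contra! hcon
  obtain ⟨⟨y, hy, hyp⟩, x, hx, hxp⟩ := And.imp Finset.not_subset.1 Finset.not_subset.1 hcon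
  have hyp' : p < y := by
    simp only [Finset.mem_filter, h₁ y hy, true_and, not_lt] at hyp
    exact lt_of_le_of_ne hyp (hp y hy).symm
  have hxp' : x < p := by simpa [h₁ x hx] using hxp
  have hax : a < x := by
    have := Finset.mem_erase.1 (h₁ x hx)
    exact lt_of_le_of_ne (hmin x this.2) (Ne.symm this.1)
  exact hQP (hF.nc P hP Q hQ a x p y hax hxp' hyp' haP hpP hx hy).symm

theorem IsNCFamily.glue {s : Finset α} {a p : α} (ha : a ∈ s) (hmin : ∀ x ∈ s, a ≤ x)
    (hp : p ∈ s.erase a) {G H : Finset (Finset α)}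
    (hG : IsNCFamily ((s.erase a).filter (· < p)) G)
    (hH : IsNCFamily ((s.erase a).filter (p ≤ ·)) H) :
    IsNCFamily s (G ∪ H.image (insertAt a p)) := by
  have hap : a < p := by
    have := Finset.mem_erase.1 hp
    exact lt_of_le_of_ne (hmin p this.2) (Ne.symm this.1)
  have hGs : ∀ P ∈ G, ∀ x ∈ P, x ∈ s ∧ a < x ∧ x < p := fun P hP x hx => by
    have := Finset.mem_filter.1 (hG.subset P hP hx)
    have h' := Finset.mem_erase.1 this.1
    exact ⟨h'.2, lt_of_le_of_ne (hmin x h'.2) (Ne.symm h'.1), this.2⟩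
  have hHs : ∀ P ∈ H, ∀ x ∈ P, x ∈ s ∧ p ≤ x := fun P hP x hx => by
    have := Finset.mem_filter.1 (hH.subset P hP hx)
    exact ⟨(Finset.mem_erase.1 this.1).2, this.2⟩
  have hHi : ∀ P ∈ H, ∀ x ∈ insertAt a p P, x = a ∨ p ≤ x := fun P hP x hx => by
    rcases mem_insertAt.1 hx with hx | hx
    · exact Or.inr (hHs P hP x hx).2
    · exact Or.inl hx.1
  have hmem : ∀ P, P ∈ G ∪ H.image (insertAt a p) → P ∈ G ∨ ∃ Q ∈ H, insertAt a p Q = P :=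
    fun P hP => by simpa using hP
  obtain ⟨P₀, hP₀, hpP₀⟩ := hH.cover p (Finset.mem_filter.2 ⟨hp, le_rfl⟩)
  refine ⟨?_, ?_, ?_, ?_, ?_⟩
  · intro P hP
    rcases hmem P hP with hP | ⟨Q, hQ, rfl⟩
    · exact hG.nonempty P hP
    · obtain ⟨x, hx⟩ := hH.nonempty Q hQ
      exact ⟨x, mem_insertAt.2 (Or.inl hx)⟩
  · intro P hP x hx
    rcases hmem P hP with hP | ⟨Q, hQ, rfl⟩
    · exact (hGs P hP x hx).1
    · rcases mem_insertAt.1 hx with hx | ⟨rfl, -⟩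
      · exact (hHs Q hQ x hx).1
      · exact ha
  · intro x hx
    by_cases hxa : x = a
    · exact ⟨insertAt a p P₀, Finset.mem_union_right _ (Finset.mem_image_of_mem _ hP₀),
        mem_insertAt.2 (Or.inr ⟨hxa, hpP₀⟩)⟩
    have hx' := Finset.mem_erase.2 ⟨hxa, hx⟩
    rcases lt_or_ge x p with hxp | hxp
    · obtain ⟨P, hP, hxP⟩ := hG.cover x (Finset.mem_filter.2 ⟨hx', hxp⟩)
      exact ⟨P, Finset.mem_union_left _ hP, hxP⟩
    · obtain ⟨P, hP, hxP⟩ := hH.cover x (Finset.mem_filter.2 ⟨hx', hxp⟩)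
      exact ⟨insertAt a p P, Finset.mem_union_right _ (Finset.mem_image_of_mem _ hP),
        mem_insertAt.2 (Or.inl hxP)⟩
  · intro P hPu Q hQu x hxP hxQ
    rcases hmem P hPu with hP | ⟨P, hP, rfl⟩ <;> rcases hmem Q hQu with hQ | ⟨Q, hQ, rfl⟩
    · exact hG.disj P hP Q hQ x hxP hxQ
    · have := hGs P hP x hxP
      rcases hHi Q hQ x hxQ with h | h
      · exact absurd this.2.1 (by simp [h])
      · exact absurd this.2.2 (not_lt.2 h)
    · have := hGs Q hQ x hxQ
      rcases hHi P hP x hxP with h | h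
      · exact absurd this.2.1 (by simp [h])
      · exact absurd this.2.2 (not_lt.2 h)
    · congr 1
      have hnota : ∀ R ∈ H, a ∉ R := fun R hR h => absurd (hHs R hR a h).2 (not_le.2 hap)
      rcases mem_insertAt.1 hxP with hxP | ⟨rfl, hpP⟩ <;>
        rcases mem_insertAt.1 hxQ with hxQ | ⟨h, hpQ⟩
      · exact hH.disj P hP Q hQ x hxP hxQ
      · exact absurd (h ▸ hxP) (hnota P hP)
      · exact absurd hxQ (hnota Q hQ)
      · exact hH.disj P hP Q hQ p hpP hpQ
  · intro P hPu Q hQu x y z t hxy hyz hzt hx hz hy ht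
    rcases hmem P hPu with hP | ⟨P, hP, rfl⟩ <;> rcases hmem Q hQu with hQ | ⟨Q, hQ, rfl⟩
    · exact hG.nc P hP Q hQ x y z t hxy hyz hzt hx hz hy ht
    · have h₁ := hGs P hP x hx
      have h₂ := hGs P hP z hz
      rcases hHi Q hQ y hy with h | h
      · exact absurd (h₁.2.1.trans hxy) (by simp [h])
      · exact absurd (hyz.trans h₂.2.2) (not_lt.2 h)
    · have h₁ := hGs Q hQ y hy
      have h₂ := hGs Q hQ t ht
      rcases hHi P hP z hz with h | h
      · exact absurd (h₁.2.1.trans hyz) (by simp [h])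
      · exact absurd (hzt.trans h₂.2.2) (not_lt.2 h)
    · congr 1
      -- all positions but possibly the first one are beyond `a`
      have hax : a ≤ x := by
        rcases hHi P hP x hx with h | h
        · exact h.ge
        · exact hap.le.trans h
      have key : ∀ R, ∀ u ∈ insertAt a p R, a < u → u ∈ R := fun R u hu hau => by
        rcases mem_insertAt.1 hu with h | ⟨rfl, -⟩
        · exact h
        · exact absurd hau (lt_irrefl _)
      have hy' := key Q y hy (hax.trans_lt hxy)
      have hz' := key P z hz ((hax.trans_lt hxy).trans hyz)
      have ht' := key Q t ht (((hax.trans_lt hxy).trans hyz).trans hzt)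
      rcases mem_insertAt.1 hx with hx | ⟨-, hpP⟩
      · exact hH.nc P hP Q hQ x y z t hxy hyz hzt hx hz' hy' ht'
      · rcases (hHs Q hQ y hy').2.eq_or_lt with rfl | hpy
        · exact hH.disj P hP Q hQ p hpP hy'
        · exact hH.nc P hP Q hQ p y z t hpy hyz hzt hpP hz' hy' ht'

theorem IsNCFamily.lower {s : Finset α} {a p : α} (hmin : ∀ x ∈ s, a ≤ x)
    {F : Finset (Finset α)} (hF : IsNCFamily s F) (h : IsSecond F a p) :
    IsNCFamily ((s.erase a).filter (· < p))
      (F.filter (· ⊆ (s.erase a).filter (· < p))) := by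
  obtain ⟨P, hP, haP, hpP, hpa, hPx⟩ := h
  refine ⟨fun Q hQ => hF.nonempty Q (Finset.mem_filter.1 hQ).1,
    fun Q hQ => (Finset.mem_filter.1 hQ).2, ?_,
    fun Q hQ R hR => hF.disj Q (Finset.mem_filter.1 hQ).1 R (Finset.mem_filter.1 hR).1,
    fun Q hQ R hR => hF.nc Q (Finset.mem_filter.1 hQ).1 R (Finset.mem_filter.1 hR).1⟩
  intro x hx
  obtain ⟨hx', hxp⟩ := Finset.mem_filter.1 hx
  obtain ⟨hxa, hxs⟩ := Finset.mem_erase.1 hx'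
  obtain ⟨Q, hQ, hxQ⟩ := hF.cover x hxs
  have hQP : Q ≠ P := by
    rintro rfl
    rcases hPx x hxQ with h | h
    · exact hxa h
    · exact absurd hxp (not_lt.2 h)
  refine ⟨Q, Finset.mem_filter.2 ⟨hQ, ?_⟩, hxQ⟩
  refine (hF.side hmin hP haP hpP hQ hQP).resolve_right fun hsub => ?_
  exact absurd hxp (not_lt.2 (Finset.mem_filter.1 (hsub hxQ)).2)

theorem IsNCFamily.upper {s : Finset α} {a p : α} (hmin : ∀ x ∈ s, a ≤ x)
    {F : Finset (Finset α)} (hF : IsNCFamily s F) (h : IsSecond F a p) :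
    IsNCFamily ((s.erase a).filter (p ≤ ·))
      ((F.filter (¬ · ⊆ (s.erase a).filter (· < p))).image (·.erase a)) := by
  obtain ⟨P, hP, haP, hpP, hpa, hPx⟩ := h
  have hmem : ∀ Q, Q ∈ (F.filter (¬ · ⊆ (s.erase a).filter (· < p))).image (·.erase a) →
      ∃ R ∈ F, R.erase a = Q ∧ ¬ R ⊆ (s.erase a).filter (· < p) := fun Q hQ => by
    obtain ⟨R, hR, h⟩ := Finset.mem_image.1 hQ
    obtain ⟨hR, h'⟩ := Finset.mem_filter.1 hR
    exact ⟨R, hR, h, h'⟩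
  have hup : ∀ R ∈ F, ¬ R ⊆ (s.erase a).filter (· < p) → ∀ x ∈ R, x ≠ a → p ≤ x := by
    intro R hR hsub x hx hxa
    by_cases hRP : R = P
    · subst hRP
      exact (hPx x hx).resolve_left hxa
    · exact (Finset.mem_filter.1 ((hF.side hmin hP haP hpP hR hRP).resolve_left hsub hx)).2
  refine ⟨?_, ?_, ?_, ?_, ?_⟩
  · intro Q hQ
    obtain ⟨R, hR, rfl, hsub⟩ := hmem Q hQ
    by_cases hRP : R = P
    · subst hRP
      exact ⟨p, Finset.mem_erase.2 ⟨hpa, hpP⟩⟩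
    · obtain ⟨x, hx⟩ := hF.nonempty R hR
      exact ⟨x, Finset.mem_erase.2 ⟨fun h => hRP (hF.disj R hR P hP x hx (h ▸ haP)), hx⟩⟩
  · intro Q hQ x hx
    obtain ⟨R, hR, rfl, hsub⟩ := hmem Q hQ
    obtain ⟨hxa, hx⟩ := Finset.mem_erase.1 hx
    exact Finset.mem_filter.2 ⟨Finset.mem_erase.2 ⟨hxa, hF.subset R hR hx⟩,
      hup R hR hsub x hx hxa⟩
  · intro x hx
    obtain ⟨hx', hxp⟩ := Finset.mem_filter.1 hx
    obtain ⟨hxa, hxs⟩ := Finset.mem_erase.1 hx'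
    obtain ⟨R, hR, hxR⟩ := hF.cover x hxs
    refine ⟨R.erase a, Finset.mem_image_of_mem _ (Finset.mem_filter.2 ⟨hR, fun hsub => ?_⟩),
      Finset.mem_erase.2 ⟨hxa, hxR⟩⟩
    exact absurd (Finset.mem_filter.1 (hsub hxR)).2 (not_lt.2 hxp)
  · intro Q hQ Q' hQ' x hx hx'
    obtain ⟨R, hR, rfl, -⟩ := hmem Q hQ
    obtain ⟨R', hR', rfl, -⟩ := hmem Q' hQ'
    rw [hF.disj R hR R' hR' x (Finset.mem_of_mem_erase hx) (Finset.mem_of_mem_erase hx')]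
  · intro Q hQ Q' hQ' x y z t hxy hyz hzt hx hz hy ht
    obtain ⟨R, hR, rfl, -⟩ := hmem Q hQ
    obtain ⟨R', hR', rfl, -⟩ := hmem Q' hQ'
    rw [hF.nc R hR R' hR' x y z t hxy hyz hzt (Finset.mem_of_mem_erase hx)
      (Finset.mem_of_mem_erase hz) (Finset.mem_of_mem_erase hy) (Finset.mem_of_mem_erase ht)]

open Classical in
/-- The partitions in which `p` follows the minimum `a` in its block: the blocks between `a` and
`p` are inner and arbitrary, and the other ones, with `a` removed, form an arbitrary partition of
the elements from `p` on. -/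
theorem sum_isSecond (k kc w : ℕ → ℂ) {s : Finset α} {a p : α} (ha : a ∈ s)
    (hmin : ∀ x ∈ s, a ≤ x) (hp : p ∈ s.erase a) :
    ∑ F ∈ (ncFamilies s).filter (fun F => IsSecond F a p),
        ∏ P ∈ F, (if a ∈ P then w P.card else blockWeight k kc F P) =
      ncSum k k ((s.erase a).filter (· < p)) *
        ncSumAt k kc p (fun n => w (n + 1)) ((s.erase a).filter (p ≤ ·)) := by
  have hap : a < p := by
    have := Finset.mem_erase.1 hp
    exact lt_of_le_of_ne (hmin p this.2) (Ne.symm this.1)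
  set u := (s.erase a).filter (· < p) with hu
  set v := (s.erase a).filter (p ≤ ·) with hv
  have hus : ∀ G ∈ ncFamilies u, ∀ P ∈ G, ∀ x ∈ P, a ≠ x ∧ x < p := fun G hG P hP x hx => by
    have := Finset.mem_filter.1 ((mem_ncFamilies.1 hG).subset P hP hx)
    exact ⟨(Finset.mem_erase.1 this.1).1.symm, this.2⟩
  have hvs : ∀ H ∈ ncFamilies v, ∀ P ∈ H, ∀ x ∈ P, a < x ∧ p ≤ x := fun H hH P hP x hx => by
    have := Finset.mem_filter.1 ((mem_ncFamilies.1 hH).subset P hP hx)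
    exact ⟨hap.trans_le this.2, this.2⟩
  have hva : ∀ H ∈ ncFamilies v, ∀ P ∈ H, a ∉ P := fun H hH P hP h =>
    lt_irrefl _ (hvs H hH P hP a h).1
  have hera : ∀ H ∈ ncFamilies v, ∀ P ∈ H, (insertAt a p P).erase a = P := by
    intro H hH P hP
    ext x
    rw [Finset.mem_erase, mem_insertAt]
    constructor
    · rintro ⟨hxa, hx | ⟨h, -⟩⟩
      · exact hx
      · exact absurd h hxa
    · intro hx
      exact ⟨(hvs H hH P hP x hx).1.ne', Or.inl hx⟩
  have hnsub : ∀ H ∈ ncFamilies v, ∀ P ∈ H, ¬ insertAt a p P ⊆ u := by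
    intro H hH P hP hsub
    obtain ⟨x, hx⟩ := (mem_ncFamilies.1 hH).nonempty P hP
    have := Finset.mem_filter.1 (hsub (mem_insertAt.2 (Or.inl hx)))
    exact absurd this.2 (not_lt.2 (hvs H hH P hP x hx).2)
  rw [ncSum, ncSumAt, Finset.sum_mul_sum, ← Finset.sum_product']
  refine (Finset.sum_nbij' (fun GH => GH.1 ∪ GH.2.image (insertAt a p))
    (fun F => (F.filter (· ⊆ u), (F.filter (¬ · ⊆ u)).image (·.erase a)))
    ?_ ?_ ?_ ?_ ?_).symm
  · rintro ⟨G, H⟩ hGH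
    obtain ⟨hG, hH⟩ := Finset.mem_product.1 hGH
    obtain ⟨P₀, hP₀, hpP₀⟩ := (mem_ncFamilies.1 hH).cover p (Finset.mem_filter.2 ⟨hp, le_rfl⟩)
    refine Finset.mem_filter.2 ⟨mem_ncFamilies.2 ((mem_ncFamilies.1 hG).glue ha hmin hp
      (mem_ncFamilies.1 hH)), insertAt a p P₀,
      Finset.mem_union_right _ (Finset.mem_image_of_mem _ hP₀), mem_insertAt.2 (Or.inr ⟨rfl, hpP₀⟩),
      mem_insertAt.2 (Or.inl hpP₀), hap.ne', fun x hx => ?_⟩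
    rcases mem_insertAt.1 hx with hx | hx
    · exact Or.inr (hvs H hH P₀ hP₀ x hx).2
    · exact Or.inl hx.1
  · intro F hF
    obtain ⟨hF, h⟩ := Finset.mem_filter.1 hF
    exact Finset.mem_product.2 ⟨mem_ncFamilies.2 ((mem_ncFamilies.1 hF).lower hmin h),
      mem_ncFamilies.2 ((mem_ncFamilies.1 hF).upper hmin h)⟩
  · rintro ⟨G, H⟩ hGH
    obtain ⟨hG, hH⟩ := Finset.mem_product.1 hGH
    have h₁ : G.filter (· ⊆ u) = G :=
      Finset.filter_true_of_mem fun P hP => (mem_ncFamilies.1 hG).subset P hP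
    have h₂ : (H.image (insertAt a p)).filter (· ⊆ u) = ∅ := by
      refine Finset.filter_false_of_mem fun P hP => ?_
      obtain ⟨Q, hQ, rfl⟩ := Finset.mem_image.1 hP
      exact hnsub H hH Q hQ
    have h₃ : G.filter (¬ · ⊆ u) = ∅ :=
      Finset.filter_false_of_mem fun P hP => not_not.2 ((mem_ncFamilies.1 hG).subset P hP)
    have h₄ : (H.image (insertAt a p)).filter (¬ · ⊆ u) = H.image (insertAt a p) := by
      refine Finset.filter_true_of_mem fun P hP => ?_
      obtain ⟨Q, hQ, rfl⟩ := Finset.mem_image.1 hP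
      exact hnsub H hH Q hQ
    have h₅ : (H.image (insertAt a p)).image (·.erase a) = H := by
      rw [Finset.image_image]
      conv_rhs => rw [← Finset.image_id (s := H)]
      exact Finset.image_congr fun P hP => hera H hH P hP
    simp only [Finset.filter_union, h₁, h₂, h₃, h₄, h₅, Finset.union_empty, Finset.empty_union]
  · intro F hF
    obtain ⟨hF, P, hP, haP, hpP, hpa, hPx⟩ := Finset.mem_filter.1 hF
    have hF' := mem_ncFamilies.1 hF
    have h₁ : ((F.filter (¬ · ⊆ u)).image (·.erase a)).image (insertAt a p) =
        F.filter (¬ · ⊆ u) := by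
      rw [Finset.image_image]
      conv_rhs => rw [← Finset.image_id (s := F.filter (¬ · ⊆ u))]
      refine Finset.image_congr fun Q hQ => ?_
      have hQF : Q ∈ F := (Finset.mem_filter.1 hQ).1
      ext x
      simp only [Function.comp_apply, mem_insertAt, Finset.mem_erase, id]
      constructor
      · rintro (⟨-, hx⟩ | ⟨rfl, -, hpQ⟩)
        · exact hx
        · rwa [hF'.disj Q hQF P hP p hpQ hpP]
      · intro hx
        by_cases hxa : x = a
        · subst hxa
          exact Or.inr ⟨rfl, hpa, by rwa [hF'.disj Q hQF P hP x hx haP]⟩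
        · exact Or.inl ⟨hxa, hx⟩
    simp only [h₁]
    exact Finset.filter_union_filter_not_eq _ _
  · rintro ⟨G, H⟩ hGH
    obtain ⟨hG, hH⟩ := Finset.mem_product.1 hGH
    have hG' := mem_ncFamilies.1 hG
    have hH' := mem_ncFamilies.1 hH
    obtain ⟨P₀, hP₀, hpP₀⟩ := hH'.cover p (Finset.mem_filter.2 ⟨hp, le_rfl⟩)
    have hdisj : Disjoint G (H.image (insertAt a p)) := by
      rw [Finset.disjoint_left]
      intro P hP hP'
      obtain ⟨Q, hQ, rfl⟩ := Finset.mem_image.1 hP'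
      exact hnsub H hH Q hQ (hG'.subset _ hP)
    have hinj : Set.InjOn (insertAt a p) (H : Set (Finset α)) := fun P hP Q hQ h => by
      rw [← hera H hH P hP, ← hera H hH Q hQ, h]
    simp only
    rw [Finset.prod_union hdisj, Finset.prod_image hinj]
    congr 1
    · refine Finset.prod_congr rfl fun P hP => ?_
      have hin : ¬ IsOuterIn (G ∪ H.image (insertAt a p)) P := by
        refine not_not.2 ⟨insertAt a p P₀,
          Finset.mem_union_right _ (Finset.mem_image_of_mem _ hP₀), fun h => ?_, a,
          mem_insertAt.2 (Or.inr ⟨rfl, hpP₀⟩), p, mem_insertAt.2 (Or.inl hpP₀), fun c hc => ?_⟩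
        · exact hnsub H hH P₀ hP₀ (h ▸ hG'.subset P hP)
        · have := Finset.mem_erase.1 (Finset.mem_filter.1 (hG'.subset P hP hc)).1
          exact ⟨lt_of_le_of_ne (hmin c this.2) (Ne.symm this.1), (hus G hG P hP c hc).2⟩
      rw [if_neg fun h => (hus G hG P hP a h).1 rfl, blockWeight_self, blockWeight, if_neg hin]
    · refine Finset.prod_congr rfl fun Q hQ => ?_
      by_cases hpQ : p ∈ Q
      · have haQ : insertAt a p Q = insert a Q := by rw [insertAt, if_pos hpQ]
        rw [if_pos hpQ, haQ, if_pos (Finset.mem_insert_self a Q),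
          Finset.card_insert_of_notMem (hva H hH Q hQ)]
      · have haQ : insertAt a p Q = Q := by rw [insertAt, if_neg hpQ]
        rw [if_neg hpQ, haQ, if_neg (hva H hH Q hQ), blockWeight, blockWeight]
        have : IsOuterIn (G ∪ H.image (insertAt a p)) Q ↔ IsOuterIn H Q := by
          unfold IsOuterIn
          refine not_congr ⟨?_, ?_⟩
          · rintro ⟨R, hR, hne, x, hx, y, hy, h⟩
            obtain ⟨c, hc⟩ := hH'.nonempty Q hQ
            rcases Finset.mem_union.1 hR with hRG | hRH
            · exact absurd ((h c hc).2.trans (hus G hG R hRG y hy).2)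
                (not_lt.2 (hvs H hH Q hQ c hc).2)
            · obtain ⟨R, hRH', rfl⟩ := Finset.mem_image.1 hRH
              have hy' : y ∈ R := by
                rcases mem_insertAt.1 hy with hy | ⟨rfl, -⟩
                · exact hy
                · exact absurd ((hvs H hH Q hQ c hc).1.trans (h c hc).2) (lt_irrefl _)
              have hne' : R ≠ Q := by
                rintro rfl
                exact hne haQ
              rcases mem_insertAt.1 hx with hx | ⟨-, hpR⟩
              · exact ⟨R, hRH', hne', x, hx, y, hy', h⟩
              · refine ⟨R, hRH', hne', p, hpR, y, hy', fun d hd => ⟨?_, (h d hd).2⟩⟩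
                exact lt_of_le_of_ne (hvs H hH Q hQ d hd).2 fun h' => hpQ (h' ▸ hd)
          · rintro ⟨R, hR, hne, x, hx, y, hy, h⟩
            refine ⟨insertAt a p R, Finset.mem_union_right _ (Finset.mem_image_of_mem _ hR),
              fun h' => hne ?_, x, mem_insertAt.2 (Or.inl hx), y, mem_insertAt.2 (Or.inl hy), h⟩
            rw [← hera H hH R hR, h', Finset.erase_eq_of_notMem (hva H hH Q hQ)]
        simp only [this]

theorem IsSecond.unique {s : Finset α} {F : Finset (Finset α)} (hF : IsNCFamily s F)
    {a p q : α} (hp : IsSecond F a p) (hq : IsSecond F a q) : p = q := by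
  obtain ⟨P, hP, haP, hpP, hpa, hPx⟩ := hp
  obtain ⟨Q, hQ, haQ, hqQ, hqa, hQx⟩ := hq
  obtain rfl := hF.disj P hP Q hQ a haP haQ
  exact le_antisymm ((hPx q hqQ).resolve_left hqa) ((hQx p hpP).resolve_left hpa)

theorem IsNCFamily.exists_isSecond {s : Finset α} {F : Finset (Finset α)} (hF : IsNCFamily s F)
    {a : α} (ha : a ∈ s) (h : {a} ∉ F) : ∃ p ∈ s.erase a, IsSecond F a p := by
  obtain ⟨P, hP, haP⟩ := hF.cover a ha
  have hne : (P.erase a).Nonempty := by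
    rw [Finset.nonempty_iff_ne_empty]
    intro h'
    rw [Finset.erase_eq_empty_iff] at h'
    rcases h' with rfl | rfl
    · simp at haP
    · exact h hP
  have hm := Finset.mem_erase.1 ((P.erase a).min'_mem hne)
  refine ⟨(P.erase a).min' hne, Finset.mem_erase.2 ⟨hm.1, hF.subset P hP hm.2⟩, P, hP, haP, hm.2,
    hm.1, fun x hx => ?_⟩
  by_cases hxa : x = a
  · exact Or.inl hxa
  · exact Or.inr (Finset.min'_le _ _ (Finset.mem_erase.2 ⟨hxa, hx⟩))

/-- The recursion for sums over non-crossing partitions, by the second element of the block of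
the minimum `a`. -/
theorem ncSumAt_rec (k kc w : ℕ → ℂ) {s : Finset α} {a : α} (ha : a ∈ s)
    (hmin : ∀ x ∈ s, a ≤ x) :
    ncSumAt k kc a w s = w 1 * ncSum k kc (s.erase a) +
      ∑ p ∈ s.erase a, ncSum k k ((s.erase a).filter (· < p)) *
        ncSumAt k kc p (fun n => w (n + 1)) ((s.erase a).filter (p ≤ ·)) := by
  classical
  rw [← sum_singleton_mem k kc w ha hmin, ncSumAt,
    ← Finset.sum_filter_add_sum_filter_not _ (fun F : Finset (Finset α) => {a} ∈ F)]
  congr 1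
  rw [← Finset.sum_congr rfl fun p hp => sum_isSecond k kc w ha hmin hp]
  simp only [Finset.sum_filter]
  rw [Finset.sum_comm]
  refine Finset.sum_congr rfl fun F hF => ?_
  have hF' := mem_ncFamilies.1 hF
  by_cases h : {a} ∈ F
  · rw [if_neg (not_not.2 h)]
    refine (Finset.sum_eq_zero fun p _ => if_neg ?_).symm
    rintro ⟨P, hP, haP, hpP, hpa, -⟩
    obtain rfl := hF'.disj P hP _ h a haP (by simp)
    exact hpa (by simpa using hpP)
  · obtain ⟨p, hp, hp'⟩ := hF'.exists_isSecond ha h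
    rw [if_pos h, Finset.sum_eq_single_of_mem p hp, if_pos hp']
    intro q _ hq
    exact if_neg fun hq' => hq (hq'.unique hF' hp')

end NonCrossing

/-! ### Generating series of non-crossing sums -/

section CardInvariance

theorem sum_card_filter_lt {α : Type*} [LinearOrder α] {M : Type*} [AddCommMonoid M]
    (t : Finset α) (f : ℕ → M) :
    ∑ p ∈ t, f (t.filter (· < p)).card = ∑ i ∈ Finset.range t.card, f i := by
  induction t using Finset.induction_on_max with
  | empty => simp
  | insert a t hlt ih =>
    have ha : a ∉ t := fun h => lt_irrefl _ (hlt a h)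
    rw [Finset.sum_insert ha, Finset.card_insert_of_notMem ha, Finset.sum_range_succ, ← ih,
      add_comm]
    congr 1
    · refine Finset.sum_congr rfl fun p hp => ?_
      rw [Finset.filter_insert, if_neg (hlt p hp).not_gt]
    · rw [Finset.filter_insert, if_neg (lt_irrefl a), Finset.filter_true_of_mem hlt]

/-- Non-crossing sums over the `n`-element subsets of `α` agree with those over
`{0, …, n - 1}`. -/
def NCSumInvariant (α : Type*) [LinearOrder α] (n : ℕ) : Prop :=
  ∀ s : Finset α, s.card = n →
    (∀ k kc : ℕ → ℂ, ncSum k kc s = ncSum k kc (Finset.range n)) ∧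
    ∀ (k kc w : ℕ → ℂ) (a : α), a ∈ s → (∀ x ∈ s, a ≤ x) →
      ncSumAt k kc a w s = ncSumAt k kc 0 w (Finset.range n)

theorem ncFamilies_empty {α : Type*} [LinearOrder α] :
    ncFamilies (∅ : Finset α) = {∅} := by
  ext F
  rw [mem_ncFamilies, Finset.mem_singleton]
  constructor
  · intro hF
    refine Finset.eq_empty_of_forall_notMem fun P hP => ?_
    obtain ⟨x, hx⟩ := hF.nonempty P hP
    simpa using hF.subset P hP hx
  · rintro rfl
    exact ⟨by simp, by simp, by simp, by simp, by simp⟩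

theorem ncSum_empty {α : Type*} [LinearOrder α] (k kc : ℕ → ℂ) :
    ncSum k kc (∅ : Finset α) = 1 := by
  simp [ncSum, ncFamilies_empty]

theorem ncSumAt_eq_of_invariant {α : Type*} [LinearOrder α] {n : ℕ}
    (h : ∀ m ≤ n, NCSumInvariant α m) {s : Finset α} (hs : s.card = n + 1) (k kc w : ℕ → ℂ)
    {a : α} (ha : a ∈ s) (hmin : ∀ x ∈ s, a ≤ x) :
    ncSumAt k kc a w s = w 1 * ncSum k kc (Finset.range n) +
      ∑ i ∈ Finset.range n, ncSum k k (Finset.range i) *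
        ncSumAt k kc 0 (fun n => w (n + 1)) (Finset.range (n - i)) := by
  have hcard : (s.erase a).card = n := by rw [Finset.card_erase_of_mem ha, hs]; rfl
  rw [ncSumAt_rec k kc w ha hmin, (h n le_rfl _ hcard).1]
  congr 1
  have := sum_card_filter_lt (s.erase a) fun i => ncSum k k (Finset.range i) *
        ncSumAt k kc 0 (fun n => w (n + 1)) (Finset.range (n - i))
  rw [hcard] at this
  rw [← this]
  refine Finset.sum_congr rfl fun p hp => ?_
  have h₁ := Finset.card_le_card (Finset.filter_subset (· < p) (s.erase a))
  have h₂ : ((s.erase a).filter (· < p)).card + ((s.erase a).filter (p ≤ ·)).card = n := by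
    rw [← hcard, ← Finset.card_filter_add_card_filter_not (s := s.erase a) (fun x => x < p)]
    simp only [not_lt]
  have h₃ := (h _ (by omega) ((s.erase a).filter (p ≤ ·)) rfl).2 k kc (fun n => w (n + 1)) p
    (Finset.mem_filter.2 ⟨hp, le_rfl⟩) fun x hx => (Finset.mem_filter.1 hx).2
  rw [(h _ (by omega) ((s.erase a).filter (· < p)) rfl).1, h₃]
  congr 3
  omega

theorem ncSumInvariant_succ {α : Type*} [LinearOrder α] {n : ℕ}
    (h : ∀ m ≤ n, NCSumInvariant α m) (h' : ∀ m ≤ n, NCSumInvariant ℕ m) :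
    NCSumInvariant α (n + 1) := by
  intro s hs
  have key : ∀ (k kc w : ℕ → ℂ) (a : α), a ∈ s → (∀ x ∈ s, a ≤ x) →
      ncSumAt k kc a w s = ncSumAt k kc 0 w (Finset.range (n + 1)) := by
    intro k kc w a ha hmin
    rw [ncSumAt_eq_of_invariant h hs k kc w ha hmin,
      ncSumAt_eq_of_invariant h' (Finset.card_range _) k kc w (by simp) fun x _ => Nat.zero_le x]
  refine ⟨fun k kc => ?_, key⟩
  have hne : s.Nonempty := by
    rw [← Finset.card_pos]
    omega
  rw [ncSum_eq_ncSumAt k kc (a := s.min' hne) fun x hx => s.min'_le x hx, key _ _ _ _ (s.min'_mem hne)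
    fun x hx => s.min'_le x hx, ncSum_eq_ncSumAt k kc fun x _ => Nat.zero_le x]

theorem ncSumInvariant_zero (α : Type*) [LinearOrder α] : NCSumInvariant α 0 := by
  intro s hs
  rw [Finset.card_eq_zero] at hs
  subst hs
  exact ⟨fun k kc => by rw [Finset.range_zero, ncSum_empty, ncSum_empty], by simp⟩

theorem ncSumInvariant (α : Type*) [LinearOrder α] (n : ℕ) : NCSumInvariant α n := by
  have hℕ : ∀ n, NCSumInvariant ℕ n := by
    intro n
    induction n using Nat.strong_induction_on with
    | _ n ih =>
      cases n with
      | zero => exact ncSumInvariant_zero ℕ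
      | succ n =>
        have : ∀ m ≤ n, NCSumInvariant ℕ m := fun m hm => ih m (Nat.lt_succ_of_le hm)
        exact ncSumInvariant_succ this this
  induction n using Nat.strong_induction_on with
  | _ n ih =>
    cases n with
    | zero => exact ncSumInvariant_zero α
    | succ n => exact ncSumInvariant_succ (fun m hm => ih m (Nat.lt_succ_of_le hm)) fun m _ => hℕ m

theorem ncSumAt_range_succ (k kc w : ℕ → ℂ) (n : ℕ) :
    ncSumAt k kc 0 w (Finset.range (n + 1)) = w 1 * ncSum k kc (Finset.range n) +
      ∑ i ∈ Finset.range n, ncSum k k (Finset.range i) *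
        ncSumAt k kc 0 (fun n => w (n + 1)) (Finset.range (n - i)) :=
  ncSumAt_eq_of_invariant (fun m _ => ncSumInvariant ℕ m) (Finset.card_range _) k kc w (by simp)
    fun x _ => Nat.zero_le x

end CardInvariance

open PowerSeries in
/-- The composition of `∑_{s ≥ 1} w_s z^s` with `z G`. -/
noncomputable def cumulantSubst (G : PowerSeries ℂ) (w : ℕ → ℂ) : PowerSeries ℂ :=
  PowerSeries.subst (X * G) (X * PowerSeries.mk fun n => w (n + 1))

section Series

open PowerSeries

theorem hasSubst_X_mul (G : PowerSeries ℂ) : PowerSeries.HasSubst (X * G) :=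
  PowerSeries.HasSubst.of_constantCoeff_zero' (by simp)

theorem cumulantSubst_rec (G : PowerSeries ℂ) (w : ℕ → ℂ) :
    cumulantSubst G w = X * G * (C (w 1) + cumulantSubst G fun n => w (n + 1)) := by
  have h : (PowerSeries.mk fun n => w (n + 1)) =
      C (w 1) + X * PowerSeries.mk fun n => w (n + 1 + 1) := by
    ext n
    cases n with
    | zero => simp
    | succ n => simp [coeff_succ_X_mul]
  have hC : PowerSeries.subst (X * G) (C (w 1) : PowerSeries ℂ) = C (w 1) := by
    rw [← PowerSeries.coe_substAlgHom (hasSubst_X_mul G)]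
    exact (PowerSeries.substAlgHom (hasSubst_X_mul G)).commutes (w 1)
  unfold cumulantSubst
  rw [PowerSeries.subst_mul (hasSubst_X_mul G), PowerSeries.subst_X (hasSubst_X_mul G), h,
    PowerSeries.subst_add (hasSubst_X_mul G), hC]

theorem cumulantSubst_add (G : PowerSeries ℂ) (w w' : ℕ → ℂ) :
    cumulantSubst G (w + w') = cumulantSubst G w + cumulantSubst G w' := by
  unfold cumulantSubst
  rw [← PowerSeries.subst_add (hasSubst_X_mul G), ← mul_add]
  rfl

theorem cumulantSubst_one (w : ℕ → ℂ) :
    cumulantSubst 1 w = X * PowerSeries.mk fun n => w (n + 1) := by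
  unfold cumulantSubst
  rw [mul_one, ← PowerSeries.map_algebraMap_eq_subst_X]
  simp

/-- The recursion determines the composition, for all `w` at once. -/
theorem eq_cumulantSubst {G : PowerSeries ℂ} {H : (ℕ → ℂ) → PowerSeries ℂ}
    (hH : ∀ w, H w = X * G * (C (w 1) + H fun n => w (n + 1))) (w : ℕ → ℂ) :
    H w = cumulantSubst G w := by
  ext n
  induction n using Nat.strong_induction_on generalizing w with
  | _ n ih =>
    rw [hH, cumulantSubst_rec, mul_assoc, mul_assoc]
    cases n with
    | zero => simp
    | succ n =>
      rw [coeff_succ_X_mul, coeff_succ_X_mul, coeff_mul, coeff_mul]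
      refine Finset.sum_congr rfl fun ij hij => ?_
      rw [map_add, map_add, ih ij.2 (by
        have := Finset.HasAntidiagonal.mem_antidiagonal.1 hij
        omega)]

/-- Boolean form of the c-free moment-cumulant relation: the first block of a non-crossing
partition has arbitrary partitions of inner blocks in its gaps, followed by an arbitrary
partition. -/
theorem exists_boolean_ncSum (k kc : ℕ → ℂ) :
    ∃ B : PowerSeries ℂ,
      (PowerSeries.mk fun n => ncSum k kc (Finset.range n)) =
        1 + B * PowerSeries.mk (fun n => ncSum k kc (Finset.range n)) ∧
      (PowerSeries.mk fun n => ncSum k k (Finset.range n)) * B =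
        cumulantSubst (PowerSeries.mk fun n => ncSum k k (Finset.range n)) kc := by
  set M : PowerSeries ℂ := PowerSeries.mk fun n => ncSum k k (Finset.range n) with hM
  set Mc : PowerSeries ℂ := PowerSeries.mk fun n => ncSum k kc (Finset.range n) with hMc
  set T : (ℕ → ℂ) → PowerSeries ℂ := fun w => PowerSeries.mk fun n =>
    if n = 0 then 0 else ncSumAt k kc 0 w (Finset.range n) with hT
  have hrec : ∀ w, T w = X * (C (w 1) * Mc + M * T fun n => w (n + 1)) := by
    intro w
    ext n
    cases n with
    | zero => simp [hT]
    | succ n =>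
      rw [coeff_succ_X_mul, map_add, coeff_C_mul, coeff_mul,
        Finset.Nat.sum_antidiagonal_eq_sum_range_succ
          (fun i j => coeff i M * coeff j (T fun n => w (n + 1))), Finset.sum_range_succ]
      simp only [hT, hM, hMc, coeff_mk, if_neg (Nat.succ_ne_zero n), ncSumAt_range_succ]
      simp only [Nat.sub_self, if_true, mul_zero, add_zero]
      congr 1
      refine Finset.sum_congr rfl fun i hi => ?_
      have := Finset.mem_range.1 hi
      rw [if_neg (by omega)]
  have hMc0 : constantCoeff Mc ≠ 0 := by
    rw [← coeff_zero_eq_constantCoeff_apply, hMc, coeff_mk, Finset.range_zero, ncSum_empty]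
    exact one_ne_zero
  have hMcT : Mc = 1 + T kc := by
    ext n
    cases n with
    | zero => simp [hT, hMc, ncSum_empty]
    | succ n =>
      simp [hT, hMc, ncSum_eq_ncSumAt k kc (s := Finset.range (n + 1)) fun x _ => Nat.zero_le x,
        coeff_one]
  have hinv := PowerSeries.mul_inv_cancel Mc hMc0
  refine ⟨T kc * Mc⁻¹, ?_, ?_⟩
  · rw [mul_assoc, mul_comm Mc⁻¹, hinv, mul_one]
    exact hMcT
  · refine eq_cumulantSubst (G := M) (H := fun w => M * (T w * Mc⁻¹)) (fun w => ?_) kc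
    conv_lhs => rw [hrec w]
    linear_combination (X * M * C (w 1)) * hinv

end Series

/-! ### Cumulants of distributions -/

section Cumulants

theorem isNCFamily_parts {n : ℕ} {π : Finpartition (Finset.univ : Finset (Fin n))}
    (hπ : IsNonCrossing π) : IsNCFamily Finset.univ π.parts := by
  refine ⟨fun P hP => π.nonempty_of_mem_parts hP, fun P _ => Finset.subset_univ P,
    fun x _ => π.exists_mem (Finset.mem_univ x), fun P hP Q hQ x hxP hxQ => ?_, ?_⟩
  · exact π.eq_of_mem_parts hP hQ hxP hxQ
  · intro P hP Q hQ a b c d hab hbc hcd ha hc hb hd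
    exact hπ P hP Q hQ a b c d hab hbc hcd ha hc hb hd

theorem sum_nonCrossing_eq {n : ℕ} (f : Finset (Finset (Fin n)) → ℂ) :
    ∑ π ∈ nonCrossing n, f π.parts = ∑ F ∈ ncFamilies (Finset.univ : Finset (Fin n)), f F := by
  classical
  refine Finset.sum_bij (fun π _ => π.parts) ?_ ?_ ?_ fun _ _ => rfl
  · intro π hπ
    exact mem_ncFamilies.2 (isNCFamily_parts (Finset.mem_filter.1 hπ).2)
  · intro π _ π' _ h
    exact Finpartition.ext h
  · intro F hF
    have hF' := mem_ncFamilies.1 hF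
    refine ⟨Finpartition.ofExistsUnique F hF'.subset (fun x hx => ?_) ?_, ?_, rfl⟩
    · obtain ⟨P, hP, hxP⟩ := hF'.cover x hx
      exact ⟨P, ⟨hP, hxP⟩, fun Q hQ => hF'.disj Q hQ.1 P hP x hQ.2 hxP⟩
    · intro h
      simpa using hF'.nonempty ∅ h
    · refine Finset.mem_filter.2 ⟨Finset.mem_univ _, ?_⟩
      intro P hP Q hQ a b c d hab hbc hcd ha hc hb hd
      exact hF'.nc P hP Q hQ a b c d hab hbc hcd ha hc hb hd

theorem sum_nonCrossing_prod (n : ℕ) (k : ℕ → ℂ) :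
    ∑ π ∈ nonCrossing n, ∏ P ∈ π.parts, k P.card = ncSum k k (Finset.range n) := by
  rw [sum_nonCrossing_eq fun F => ∏ P ∈ F, k P.card,
    ← ((ncSumInvariant (Fin n) n) Finset.univ (by simp)).1]
  simp only [ncSum, blockWeight_self]

open Classical in
theorem sum_nonCrossing_outer_inner (n : ℕ) (k kc : ℕ → ℂ) :
    ∑ π ∈ nonCrossing n, (∏ P ∈ π.parts.filter (fun P => IsOuterBlock π P), kc P.card) *
        ∏ P ∈ π.parts.filter (fun P => ¬ IsOuterBlock π P), k P.card =
      ncSum k kc (Finset.range n) := by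
  rw [← ((ncSumInvariant (Fin n) n) Finset.univ (by simp)).1, ncSum,
    ← sum_nonCrossing_eq fun F => ∏ P ∈ F, blockWeight k kc F P]
  refine Finset.sum_congr rfl fun π _ => ?_
  rw [← Finset.prod_ite]
  rfl

/-- Sums over non-crossing partitions are triangular in the weights: only the partition with a
single block involves the weight of the full size. -/
theorem ncSum_sub_congr {k k' kc kc' : ℕ → ℂ} {n : ℕ} (hn : 1 ≤ n) (hk : ∀ m < n, k m = k' m)
    (hkc : ∀ m < n, kc m = kc' m) :
    ncSum k kc (Finset.range n) - kc n = ncSum k' kc' (Finset.range n) - kc' n := by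
  classical
  have hne : (Finset.range n).Nonempty := ⟨0, Finset.mem_range.2 hn⟩
  have htop : ({Finset.range n} : Finset (Finset ℕ)) ∈ ncFamilies (Finset.range n) :=
    mem_ncFamilies.2 ⟨by simpa using hne, by simp, fun x hx => ⟨_, by simp, hx⟩,
      fun P hP Q hQ _ _ _ => by rw [Finset.mem_singleton.1 hP, Finset.mem_singleton.1 hQ],
      fun P hP Q hQ _ _ _ _ _ _ _ _ _ _ _ => by
        rw [Finset.mem_singleton.1 hP, Finset.mem_singleton.1 hQ]⟩
  have hval : ∀ k kc : ℕ → ℂ, ∏ P ∈ ({Finset.range n} : Finset (Finset ℕ)),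
      blockWeight k kc {Finset.range n} P = kc n := by
    intro k kc
    have : IsOuterIn {Finset.range n} (Finset.range n) := by
      rintro ⟨Q, hQ, hne, -⟩
      exact hne (Finset.mem_singleton.1 hQ)
    rw [Finset.prod_singleton, blockWeight, if_pos this, Finset.card_range]
  rw [ncSum, ncSum, ← Finset.add_sum_erase _ _ htop, ← Finset.add_sum_erase _ _ htop, hval, hval,
    add_sub_cancel_left, add_sub_cancel_left]
  refine Finset.sum_congr rfl fun F hF => ?_
  obtain ⟨hFne, hF⟩ := Finset.mem_erase.1 hF
  have hF' := mem_ncFamilies.1 hF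
  refine Finset.prod_congr rfl fun P hP => ?_
  have hlt : P.card < n := by
    have hPs := hF'.subset P hP
    refine lt_of_le_of_ne (by simpa using Finset.card_le_card hPs) fun h => hFne ?_
    have hPr : P = Finset.range n := Finset.eq_of_subset_of_card_le hPs (by simp [h])
    subst hPr
    refine Finset.eq_singleton_iff_unique_mem.2 ⟨hP, fun Q hQ => ?_⟩
    obtain ⟨x, hx⟩ := hF'.nonempty Q hQ
    exact hF'.disj Q hQ _ hP x hx (hF'.subset Q hQ hx)
  rw [blockWeight, blockWeight, hk _ hlt, hkc _ hlt]

/-- A triangular system with unit diagonal has a solution with any prescribed values. -/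
theorem exists_seq_of_triangular (Q : (ℕ → ℂ) → ℕ → ℂ)
    (hQ : ∀ n, 1 ≤ n → ∀ k k' : ℕ → ℂ, (∀ m < n, k m = k' m) → Q k n - k n = Q k' n - k' n)
    (t : ℕ → ℂ) : ∃ k, ∀ n, 1 ≤ n → Q k n = t n := by
  classical
  let step : (n : ℕ) → ((m : ℕ) → m < n → ℂ) → ℂ := fun n r =>
    t n - Q (fun m => if h : m < n then r m h else 0) n
  let k : ℕ → ℂ := fun n => WellFounded.fix Nat.lt_wfRel.wf step n
  have hk : ∀ n, k n = t n - Q (fun m => if m < n then k m else 0) n := by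
    intro n
    have := WellFounded.fix_eq Nat.lt_wfRel.wf step n
    simp only [k]
    rw [this]
    simp only [step, dite_eq_ite]
  refine ⟨k, fun n hn => ?_⟩
  have := hQ n hn k (fun m => if m < n then k m else 0) fun m hm => by simp [hm]
  rw [if_neg (lt_irrefl n), sub_zero] at this
  linear_combination this + hk n

theorem exists_isFreeCumulants (ν : ℂ[X] →ₗ[ℂ] ℂ) : ∃ k, IsFreeCumulants ν k := by
  obtain ⟨k, hk⟩ := exists_seq_of_triangular (fun k n => ncSum k k (Finset.range n))
    (fun n hn k k' h => ncSum_sub_congr hn h h) (fun n => ν (Polynomial.X ^ n))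
  exact ⟨k, fun n hn => by rw [sum_nonCrossing_prod, hk n hn]⟩

theorem isCFreeCumulants_iff {μ ν : ℂ[X] →ₗ[ℂ] ℂ} {kc : ℕ → ℂ} :
    IsCFreeCumulants μ ν kc ↔ ∃ k, IsFreeCumulants ν k ∧
      ∀ n, 1 ≤ n → μ (Polynomial.X ^ n) = ncSum k kc (Finset.range n) := by
  simp only [IsCFreeCumulants, sum_nonCrossing_outer_inner]

theorem exists_isCFreeCumulants (μ ν : ℂ[X] →ₗ[ℂ] ℂ) : ∃ kc, IsCFreeCumulants μ ν kc := by
  obtain ⟨k, hk⟩ := exists_isFreeCumulants ν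
  obtain ⟨kc, hkc⟩ := exists_seq_of_triangular (fun kc n => ncSum k kc (Finset.range n))
    (fun n hn kc kc' h => ncSum_sub_congr hn (fun _ _ => rfl) h) (fun n => μ (Polynomial.X ^ n))
  exact ⟨kc, isCFreeCumulants_iff.2 ⟨k, hk, fun n hn => (hkc n hn).symm⟩⟩

/-- The linear functional on polynomials with given moments. -/
noncomputable def ofMoments (m : ℕ → ℂ) : ℂ[X] →ₗ[ℂ] ℂ :=
  (Polynomial.basisMonomials ℂ).constr ℂ m

@[simp] theorem ofMoments_X_pow (m : ℕ → ℂ) (n : ℕ) : ofMoments m (Polynomial.X ^ n) = m n := by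
  have := (Polynomial.basisMonomials ℂ).constr_basis ℂ m n
  rw [Polynomial.coe_basisMonomials] at this
  rw [← Polynomial.monomial_one_right_eq_X_pow]
  exact this

theorem exists_isDistribution_isCFreeCumulants (ν : ℂ[X] →ₗ[ℂ] ℂ) (kc : ℕ → ℂ) :
    ∃ μ, IsDistribution μ ∧ IsCFreeCumulants μ ν kc := by
  obtain ⟨k, hk⟩ := exists_isFreeCumulants ν
  refine ⟨ofMoments fun n => ncSum k kc (Finset.range n), ?_, isCFreeCumulants_iff.2
    ⟨k, hk, fun n _ => ofMoments_X_pow _ n⟩⟩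
  have := ofMoments_X_pow (fun n => ncSum k kc (Finset.range n)) 0
  rwa [pow_zero, Finset.range_zero, ncSum_empty] at this

/-- The moment generating series. -/
noncomputable def momentSeries (μ : ℂ[X] →ₗ[ℂ] ℂ) : PowerSeries ℂ :=
  PowerSeries.mk fun n => μ (Polynomial.X ^ n)

theorem IsDistribution.constantCoeff_momentSeries {μ : ℂ[X] →ₗ[ℂ] ℂ} (hμ : IsDistribution μ) :
    PowerSeries.constantCoeff (momentSeries μ) = 1 := by
  rw [← PowerSeries.coeff_zero_eq_constantCoeff_apply, momentSeries, PowerSeries.coeff_mk, pow_zero]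
  exact hμ

theorem IsCFreeCumulants.exists_boolean {μ ν : ℂ[X] →ₗ[ℂ] ℂ} {kc : ℕ → ℂ}
    (h : IsCFreeCumulants μ ν kc) (hμ : IsDistribution μ) (hν : IsDistribution ν) :
    ∃ B : PowerSeries ℂ, momentSeries μ = 1 + B * momentSeries μ ∧
      momentSeries ν * B = cumulantSubst (momentSeries ν) kc := by
  obtain ⟨k, hk, hkc⟩ := isCFreeCumulants_iff.1 h
  have h₁ : momentSeries μ = PowerSeries.mk fun n => ncSum k kc (Finset.range n) := by
    ext n
    rw [momentSeries, PowerSeries.coeff_mk, PowerSeries.coeff_mk]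
    rcases Nat.eq_zero_or_pos n with rfl | hn
    · rw [pow_zero, Finset.range_zero, ncSum_empty]
      exact hμ
    · exact hkc n hn
  have h₂ : momentSeries ν = PowerSeries.mk fun n => ncSum k k (Finset.range n) := by
    ext n
    rw [momentSeries, PowerSeries.coeff_mk, PowerSeries.coeff_mk]
    rcases Nat.eq_zero_or_pos n with rfl | hn
    · rw [pow_zero, Finset.range_zero, ncSum_empty]
      exact hν
    · rw [hk n hn, sum_nonCrossing_prod]
  rw [h₁, h₂]
  exact exists_boolean_ncSum k kc

end Cumulants

/-! ### Monotone independence -/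

/-- The moments of a distribution, as a series in one letter. -/
noncomputable def momentWord (ν : ℂ[X] →ₗ[ℂ] ℂ) : List Unit → ℂ :=
  fun l => ν (Polynomial.X ^ l.length)

section Monotone

theorem distributionOf_X_pow {B : Type*} [Ring B] [Algebra ℂ B] (χ : B →ₗ[ℂ] ℂ) (x : B) (n : ℕ) :
    distributionOf χ x (Polynomial.X ^ n) = χ (x ^ n) := by
  simp [distributionOf]

theorem dual_ext_X_pow {μ ν : ℂ[X] →ₗ[ℂ] ℂ}
    (h : ∀ n, μ (Polynomial.X ^ n) = ν (Polynomial.X ^ n)) : μ = ν := by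
  refine Polynomial.lhom_ext' fun n => LinearMap.ext_ring ?_
  simpa [Polynomial.monomial_one_right_eq_X_pow] using h n

/-- A non-empty word in two letters is the product of an alternating word in powers of the
letters. -/
theorem exists_alternating {B : Type*} [Ring B] [Algebra ℂ B] (x y : B) (i : Fin 2)
    (ls : List (Fin 2)) :
    ∃ (b : B) (v : List (Fin 2 × B)), (((i, b) :: v).map Prod.fst).IsChain (· ≠ ·) ∧
      (∀ p ∈ (i, b) :: v, p.2 ∈ (![NonUnitalAlgebra.adjoin ℂ {x},
        NonUnitalAlgebra.adjoin ℂ {y}] : Fin 2 → NonUnitalSubalgebra ℂ B) p.1) ∧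
      (((i, b) :: v).map Prod.snd).prod = ((i :: ls).map ![x, y]).prod := by
  have hz : ∀ i : Fin 2, (![x, y] : Fin 2 → B) i ∈ (![NonUnitalAlgebra.adjoin ℂ {x},
        NonUnitalAlgebra.adjoin ℂ {y}] : Fin 2 → NonUnitalSubalgebra ℂ B) i := by
    intro i
    fin_cases i
    · exact NonUnitalAlgebra.self_mem_adjoin_singleton ℂ x
    · exact NonUnitalAlgebra.self_mem_adjoin_singleton ℂ y
  induction ls generalizing i with
  | nil =>
    refine ⟨(![x, y] : Fin 2 → B) i, [], by simp, ?_, by simp⟩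
    intro p hp
    obtain rfl := List.mem_singleton.1 hp
    exact hz i
  | cons j ls ih =>
    obtain ⟨b, v, hc, hm, hp⟩ := ih j
    by_cases hij : i = j
    · subst hij
      refine ⟨(![x, y] : Fin 2 → B) i * b, v, hc, ?_, ?_⟩
      · intro p hp
        rcases List.mem_cons.1 hp with rfl | hp
        · exact mul_mem (hz i) (hm (i, b) (by simp))
        · exact hm p (by simp [hp])
      · rw [List.map_cons, List.prod_cons, mul_assoc, ← List.prod_cons, ← List.map_cons (f := Prod.snd)
          (a := (i, b)), hp, List.map_cons (l := i :: ls), List.prod_cons]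
    · refine ⟨(![x, y] : Fin 2 → B) i, (j, b) :: v, ?_, ?_, ?_⟩
      · rw [List.map_cons, List.map_cons, List.isChain_cons_cons]
        exact ⟨hij, by simpa using hc⟩
      · intro p hp
        rcases List.mem_cons.1 hp with rfl | hp
        · exact hz i
        · exact hm p hp
      · rw [List.map_cons, List.prod_cons, hp, List.map_cons (l := j :: ls), List.prod_cons]

theorem pow_succ_mem_adjoin {B : Type*} [Ring B] [Algebra ℂ B] (x : B) (n : ℕ) :
    x ^ (n + 1) ∈ NonUnitalAlgebra.adjoin ℂ {x} := by
  induction n with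
  | zero => simp
  | succ n ih =>
    rw [pow_succ]
    exact mul_mem ih (NonUnitalAlgebra.self_mem_adjoin_singleton ℂ x)

variable {B : Type*} [Ring B] [Algebra ℂ B] {χ : B →ₗ[ℂ] ℂ} {x y : B}
  {ν₁ ν₂ : ℂ[X] →ₗ[ℂ] ℂ}

theorem IsMonotoneRealization.factor_end (h : IsMonotoneRealization χ x y ν₁ ν₂) (i j : ℕ) :
    χ (x ^ i * y ^ j) = χ (y ^ j) * χ (x ^ i) := by
  obtain ⟨h₁, hm, -, -⟩ := h
  cases j with
  | zero => simp [h₁]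
  | succ j =>
    cases i with
    | zero => simp [h₁]
    | succ i =>
      have := hm [(0, x ^ (i + 1))] [] (1, y ^ (j + 1)) (by simp) (by
        intro p hp
        simp only [List.cons_append, List.nil_append, List.mem_cons, List.not_mem_nil,
          or_false] at hp
        rcases hp with rfl | rfl
        · exact pow_succ_mem_adjoin x i
        · exact pow_succ_mem_adjoin y j) (by simp) (by simp)
      simpa using this

theorem IsMonotoneRealization.factor_word (h : IsMonotoneRealization χ x y ν₁ ν₂) (i j : ℕ)
    (ls : List (Fin 2)) :
    χ (x ^ i * y ^ j * (x * (ls.map ![x, y]).prod)) =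
      χ (y ^ j) * χ (x ^ i * (x * (ls.map ![x, y]).prod)) := by
  obtain ⟨h₁, hm, -, -⟩ := h
  cases j with
  | zero => simp [h₁]
  | succ j =>
    obtain ⟨b, v, hc, hmem, hp⟩ := exists_alternating x y 0 ls
    have hp' : b * (v.map Prod.snd).prod = x * (ls.map ![x, y]).prod := by simpa using hp
    cases i with
    | zero =>
      have := hm [] ((0, b) :: v) (1, y ^ (j + 1))
        (by
          rw [List.nil_append, List.map_cons, List.map_cons, List.isChain_cons_cons]
          exact ⟨by simp, by simpa using hc⟩)
        (by
          intro p hp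
          simp only [List.nil_append, List.mem_cons] at hp
          rcases hp with rfl | hp
          · exact pow_succ_mem_adjoin y j
          · exact hmem p (List.mem_cons.2 hp)) (by simp) (by simp)
      simp only [List.nil_append, List.map_cons, List.prod_cons, hp'] at this
      simpa using this
    | succ i =>
      have := hm [(0, x ^ (i + 1))] ((0, b) :: v) (1, y ^ (j + 1))
        (by
          rw [List.cons_append, List.nil_append, List.map_cons, List.map_cons, List.map_cons,
            List.isChain_cons_cons, List.isChain_cons_cons]
          exact ⟨by simp, by simp, by simpa using hc⟩)
        (by
          intro p hp
          simp only [List.cons_append, List.nil_append, List.mem_cons] at hp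
          rcases hp with rfl | rfl | hp
          · exact pow_succ_mem_adjoin x i
          · exact pow_succ_mem_adjoin y j
          · exact hmem p (List.mem_cons.2 hp)) (by simp) (by simp)
      simp only [List.cons_append, List.nil_append, List.map_cons, List.prod_cons, hp'] at this
      rw [mul_assoc]
      exact this

theorem IsMonotoneRealization.factor (h : IsMonotoneRealization χ x y ν₁ ν₂) (i j n : ℕ) :
    χ (x ^ i * y ^ j * (x * (x + y) ^ n)) = χ (y ^ j) * χ (x ^ i * (x * (x + y) ^ n)) := by
  have key : ∀ (n : ℕ) (ls : List (Fin 2)),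
      χ (x ^ i * y ^ j * (x * ((ls.map ![x, y]).prod * (x + y) ^ n))) =
        χ (y ^ j) * χ (x ^ i * (x * ((ls.map ![x, y]).prod * (x + y) ^ n))) := by
    intro n
    induction n with
    | zero => intro ls; simpa using h.factor_word i j ls
    | succ n ih =>
      intro ls
      have hx := ih (ls ++ [0])
      have hy := ih (ls ++ [1])
      have hsplit : (ls.map ![x, y]).prod * (x + y) ^ (n + 1) =
          ((ls ++ [0]).map ![x, y]).prod * (x + y) ^ n +
            ((ls ++ [1]).map ![x, y]).prod * (x + y) ^ n := by
        simp [pow_succ', mul_add, add_mul, mul_assoc]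
      rw [hsplit]
      simp only [mul_add, map_add, hx, hy]
  simpa using key n []

/-- The moments of a sum of monotone independent variables. -/
theorem IsMonotoneRealization.moments (h : IsMonotoneRealization χ x y ν₁ ν₂) (n : ℕ) :
    χ ((x + y) ^ n) = wsubst (momentWord ν₂) (momentWord ν₁) (momentWord ν₂)
      (List.replicate n ()) := by
  have hx : ∀ i, χ (x ^ i) = ν₁ (Polynomial.X ^ i) := fun i => by
    rw [← h.2.2.1, distributionOf_X_pow]
  have hy : ∀ i, χ (y ^ i) = ν₂ (Polynomial.X ^ i) := fun i => by
    rw [← h.2.2.2, distributionOf_X_pow]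
  have key : ∀ n i j, χ (x ^ i * y ^ j * (x + y) ^ n) = wsubst (momentWord ν₂)
      (fun l => ν₁ (Polynomial.X ^ (i + l.length))) (fun l => ν₂ (Polynomial.X ^ (j + l.length)))
      (List.replicate n ()) := by
    intro n
    induction n with
    | zero => intro i j; simp [h.factor_end, hx, hy]
    | succ n ih =>
      intro i j
      have hsplit : x ^ i * y ^ j * (x + y) ^ (n + 1) =
          x ^ i * y ^ j * (x * (x + y) ^ n) + x ^ i * y ^ (j + 1) * (x + y) ^ n := by
        simp only [pow_succ', pow_succ y, mul_add, add_mul, mul_assoc]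
      have h₁ := ih (i + 1) 0
      have h₂ := ih i (j + 1)
      rw [pow_zero, mul_one, pow_succ, mul_assoc] at h₁
      rw [hsplit, map_add, h.factor, h₁, h₂, List.replicate_succ, wsubst_cons, hy]
      simp only [List.length_nil, add_zero, zero_add, smul_eq_mul]
      congr 2
      · congr 1
        funext l
        rw [lderiv_apply, List.length_cons, add_assoc, add_comm 1]
      · funext l
        rw [lderiv_apply, List.length_cons, add_assoc, add_comm 1]
  have := key n 0 0
  simp only [pow_zero, one_mul, zero_add] at this
  exact this

end Monotone

section MonotoneModel

open TensorProduct

variable (ν₁ ν₂ : ℂ[X] →ₗ[ℂ] ℂ)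

/-- The projection of `ℂ[X]` onto the constants along the kernel of `ν`. -/
noncomputable def vacuumProj (ν : ℂ[X] →ₗ[ℂ] ℂ) : ℂ[X] →ₗ[ℂ] ℂ[X] :=
  LinearMap.toSpanSingleton ℂ ℂ[X] 1 ∘ₗ ν

theorem vacuumProj_apply (ν : ℂ[X] →ₗ[ℂ] ℂ) (p : ℂ[X]) : vacuumProj ν p = ν p • 1 := rfl

/-- The vacuum state of `End (ℂ[X] ⊗ ℂ[X])`. -/
noncomputable def tensorState : Module.End ℂ (ℂ[X] ⊗[ℂ] ℂ[X]) →ₗ[ℂ] ℂ :=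
  LinearMap.mul' ℂ ℂ ∘ₗ TensorProduct.map ν₁ ν₂ ∘ₗ LinearMap.applyₗ (1 ⊗ₜ[ℂ] 1)

theorem tensorState_apply (T : Module.End ℂ (ℂ[X] ⊗[ℂ] ℂ[X])) :
    tensorState ν₁ ν₂ T = LinearMap.mul' ℂ ℂ (TensorProduct.map ν₁ ν₂ (T (1 ⊗ₜ[ℂ] 1))) := rfl

/-- Monotone independent variables, on the tensor product of the two polynomial models: the first
one acts as multiplication by `X` on the first factor and as the vacuum projection on the second
one, the second one as multiplication by `X` on the second factor. -/
theorem exists_isMonotoneRealization (h₁ : IsDistribution ν₁) (h₂ : IsDistribution ν₂) :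
    ∃ x y : Module.End ℂ (ℂ[X] ⊗[ℂ] ℂ[X]),
      IsMonotoneRealization (tensorState ν₁ ν₂) x y ν₁ ν₂ := by
  have h₁' : ν₁ 1 = 1 := h₁
  have h₂' : ν₂ 1 = 1 := h₂
  set χ := tensorState ν₁ ν₂ with hχ
  set E : Module.End ℂ (ℂ[X] ⊗[ℂ] ℂ[X]) := TensorProduct.map LinearMap.id (vacuumProj ν₂) with hE
  set x : Module.End ℂ (ℂ[X] ⊗[ℂ] ℂ[X]) :=
    TensorProduct.map (LinearMap.mulLeft ℂ Polynomial.X) (vacuumProj ν₂) with hx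
  set m : ℂ[X] → Module.End ℂ (ℂ[X] ⊗[ℂ] ℂ[X]) := fun q =>
    TensorProduct.map LinearMap.id (LinearMap.mulLeft ℂ q) with hm
  have hEE : E * E = E := by
    refine TensorProduct.ext' fun p q => ?_
    simp [hE, vacuumProj_apply, h₂', Module.End.mul_apply]
  have hEx : E * x = x := by
    refine TensorProduct.ext' fun p q => ?_
    simp [hE, hx, vacuumProj_apply, h₂', Module.End.mul_apply]
  have hxE : x * E = x := by
    refine TensorProduct.ext' fun p q => ?_
    simp [hE, hx, vacuumProj_apply, h₂', Module.End.mul_apply]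
  have hEqE : ∀ q, E * m q * E = ν₂ q • E := by
    intro q
    refine TensorProduct.ext' fun p r => ?_
    simp [hE, hm, vacuumProj_apply, Module.End.mul_apply, smul_tmul', smul_smul]
  have hχm : ∀ q, χ (m q) = ν₂ q := by
    intro q
    simp [hχ, hm, tensorState_apply, h₁']
  have hχE : ∀ T, χ (T * E) = χ T := by
    intro T
    simp [hχ, hE, tensorState_apply, vacuumProj_apply, h₂', Module.End.mul_apply]
  have hEχ : ∀ T, χ (E * T) = χ T := by
    intro T
    rw [hχ, tensorState_apply, tensorState_apply, Module.End.mul_apply]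
    generalize T (1 ⊗ₜ[ℂ] 1) = t
    induction t with
    | zero => simp
    | tmul p q => simp [hE, vacuumProj_apply, h₂', mul_comm]
    | add s t hs ht => simp only [map_add, hs, ht]
  have hxadj : ∀ a ∈ NonUnitalAlgebra.adjoin ℂ {x}, E * a = a ∧ a * E = a := by
    intro a ha
    induction ha using NonUnitalAlgebra.adjoin_induction with
    | mem a ha =>
      obtain rfl := Set.mem_singleton_iff.1 ha
      exact ⟨hEx, hxE⟩
    | add a b _ _ ha hb => exact ⟨by rw [mul_add, ha.1, hb.1], by rw [add_mul, ha.2, hb.2]⟩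
    | zero => simp
    | mul a b _ _ ha hb => exact ⟨by rw [← mul_assoc, ha.1], by rw [mul_assoc, hb.2]⟩
    | smul c a _ ha => exact ⟨by rw [mul_smul_comm, ha.1], by rw [smul_mul_assoc, ha.2]⟩
  have hyadj : ∀ c ∈ NonUnitalAlgebra.adjoin ℂ {m Polynomial.X}, ∃ q, c = m q := by
    intro a ha
    induction ha using NonUnitalAlgebra.adjoin_induction with
    | mem a ha => exact ⟨_, Set.mem_singleton_iff.1 ha⟩
    | add a b _ _ ha hb =>
      obtain ⟨p, rfl⟩ := ha
      obtain ⟨q, rfl⟩ := hb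
      exact ⟨p + q, TensorProduct.ext' fun r s => by simp [hm, add_mul, tmul_add]⟩
    | zero => exact ⟨0, TensorProduct.ext' fun r s => by simp [hm]⟩
    | mul a b _ _ ha hb =>
      obtain ⟨p, rfl⟩ := ha
      obtain ⟨q, rfl⟩ := hb
      exact ⟨p * q, TensorProduct.ext' fun r s => by simp [hm, Module.End.mul_apply]⟩
    | smul c a _ ha =>
      obtain ⟨p, rfl⟩ := ha
      exact ⟨c • p, TensorProduct.ext' fun r s => by simp [hm]⟩
  have hxpow : ∀ n, (x ^ n) (1 ⊗ₜ[ℂ] 1) = (Polynomial.X ^ n) ⊗ₜ[ℂ] 1 := by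
    intro n
    induction n with
    | zero => simp
    | succ n ih =>
      rw [pow_succ', Module.End.mul_apply, ih]
      simp [hx, vacuumProj_apply, h₂', pow_succ']
  have hypow : ∀ n, (m Polynomial.X ^ n) (1 ⊗ₜ[ℂ] 1) = 1 ⊗ₜ[ℂ] (Polynomial.X ^ n) := by
    intro n
    induction n with
    | zero => simp
    | succ n ih =>
      rw [pow_succ', Module.End.mul_apply, ih]
      simp [hm, pow_succ']
  have hχ1 : χ 1 = 1 := by simp [hχ, tensorState_apply, h₁', h₂']
  refine ⟨x, m Polynomial.X, hχ1, ?_, ?_, ?_⟩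
  · rintro u v ⟨i, c⟩ - hmem hu hv
    have hi : i = 0 ∨ i = 1 := by fin_cases i <;> simp
    rcases hi with rfl | rfl
    · have hu' : u = [] := by
        rw [← List.getLast?_eq_none_iff]
        by_contra hne
        obtain ⟨d, hd⟩ := Option.ne_none_iff_exists'.1 hne
        exact absurd (hu d hd) (by simp)
      have hv' : v = [] := by
        rw [← List.head?_eq_none_iff]
        by_contra hne
        obtain ⟨d, hd⟩ := Option.ne_none_iff_exists'.1 hne
        exact absurd (hv d hd) (by simp)
      subst hu' hv'
      simp [hχ1]
    · obtain ⟨q, rfl⟩ := hyadj c (hmem (1, c) (by simp))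
      have hU : ∀ T, χ ((u.map Prod.snd).prod * T) = χ ((u.map Prod.snd).prod * (E * T)) := by
        intro T
        rcases List.eq_nil_or_concat u with rfl | ⟨u', d, rfl⟩
        · simp [hEχ]
        · have hd : d.1 = 0 := by
            have := hu d (by simp)
            exact (Fin.lt_one_iff d.1).1 this
          have hdm := hmem d (by simp)
          rw [hd] at hdm
          rw [List.concat_eq_append, List.map_append, List.prod_append, ← mul_assoc _ E]
          simp only [List.map_cons, List.map_nil, List.prod_singleton]
          rw [mul_assoc _ d.2 E, (hxadj d.2 hdm).2]
      have hV : ∀ T, χ (T * (v.map Prod.snd).prod) = χ (T * E * (v.map Prod.snd).prod) := by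
        intro T
        cases v with
        | nil => simp [hχE]
        | cons d v =>
          have hd : d.1 = 0 := by
            have := hv d (by simp)
            exact (Fin.lt_one_iff d.1).1 this
          have hdm := hmem d (by simp)
          rw [hd] at hdm
          rw [List.map_cons, List.prod_cons, mul_assoc T E, ← mul_assoc E, (hxadj d.2 hdm).1]
      rw [List.map_append, List.prod_append, List.map_cons, List.prod_cons, List.map_append,
        List.prod_append, hU, ← mul_assoc E, ← mul_assoc, hV, mul_assoc _ (E * m q) E, hEqE,
        mul_smul_comm, smul_mul_assoc, map_smul, ← hV, smul_eq_mul, hχm]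
  · refine dual_ext_X_pow fun n => ?_
    rw [distributionOf_X_pow, hχ, tensorState_apply, hxpow]
    simp [h₂']
  · refine dual_ext_X_pow fun n => ?_
    rw [distributionOf_X_pow, hχ, tensorState_apply, hypow]
    simp [h₁']

theorem exists_isMonotoneConv (h₁ : IsDistribution ν₁) (h₂ : IsDistribution ν₂) :
    ∃ ν, IsMonotoneConv ν₁ ν₂ ν := by
  obtain ⟨x, y, h⟩ := exists_isMonotoneRealization ν₁ ν₂ h₁ h₂
  refine ⟨distributionOf (tensorState ν₁ ν₂) (x + y), ⟨_, _, _, _, x, y, h⟩,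
    fun B _ _ χ x' y' h' => dual_ext_X_pow fun n => ?_⟩
  rw [distributionOf_X_pow, distributionOf_X_pow, h.moments, h'.moments]

variable {ν₁ ν₂}

theorem IsMonotoneConv.moments {ν : ℂ[X] →ₗ[ℂ] ℂ} (h : IsMonotoneConv ν₁ ν₂ ν) (n : ℕ) :
    ν (Polynomial.X ^ n) = wsubst (momentWord ν₂) (momentWord ν₁) (momentWord ν₂)
      (List.replicate n ()) := by
  obtain ⟨⟨B, _, _, χ, x, y, hr⟩, hall⟩ := h
  rw [← hall B χ x y hr, distributionOf_X_pow, hr.moments]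

end MonotoneModel

/-! ### Free convolution with `δ₀` -/

section FreeDeltaZero

variable {B : Type*} [Ring B] [Algebra ℂ B] {χ : B →ₗ[ℂ] ℂ} {x y : B} {ν : ℂ[X] →ₗ[ℂ] ℂ}

theorem IsFreeRealization.apply_mul_eq_zero (h : IsFreeRealization χ x y deltaZero ν) {a : B}
    (ha : a ∈ Algebra.adjoin ℂ {x}) : χ (a * x) = 0 := by
  obtain ⟨p, rfl⟩ := (Algebra.adjoin_singleton_eq_range_aeval ℂ x ▸ ha :
    a ∈ (Polynomial.aeval x).range)
  have h₁ := LinearMap.congr_fun h.2.2.1 (p * Polynomial.X)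
  simpa [distributionOf, deltaZero] using h₁

/-- A word that starts with an alternating product of centred elements whose last factor is a
polynomial in `x` has expectation zero.  The powers of `y` that follow are centred one at a
time, and the neighbouring polynomials in `x` are merged. -/
theorem IsFreeRealization.centred_mul_eq_zero (h : IsFreeRealization χ x y deltaZero ν) (n : ℕ) :
    ∀ (j : ℕ) (w : List (Fin 2 × B)) (a : B),
      ((w ++ [((0 : Fin 2), a)]).map Prod.fst).IsChain (· ≠ ·) →
      (∀ p ∈ w ++ [((0 : Fin 2), a)], p.2 ∈ (![Algebra.adjoin ℂ {x}, Algebra.adjoin ℂ {y}] :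
        Fin 2 → Subalgebra ℂ B) p.1 ∧ χ p.2 = 0) →
      χ ((w.map Prod.snd).prod * a * y ^ j * (x + y) ^ n) = 0 := by
  obtain ⟨hχ1, hfree, -, -⟩ := id h
  -- the centred power of `y`
  have hy : ∀ j, y ^ j - algebraMap ℂ B (χ (y ^ j)) ∈ Algebra.adjoin ℂ {y} := fun j =>
    sub_mem (pow_mem (Algebra.self_mem_adjoin_singleton ℂ y) j) (Subalgebra.algebraMap_mem _ _)
  have hy0 : ∀ j, χ (y ^ j - algebraMap ℂ B (χ (y ^ j))) = 0 := fun j => by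
    rw [map_sub, Algebra.algebraMap_eq_smul_one, map_smul, hχ1, smul_eq_mul, mul_one, sub_self]
  have hsplit : ∀ (j : ℕ) (U V : B), χ (U * y ^ j * V) =
      χ (U * (y ^ j - algebraMap ℂ B (χ (y ^ j))) * V) + χ (y ^ j) * χ (U * V) := by
    intro j U V
    rw [mul_sub, sub_mul, map_sub, Algebra.algebraMap_eq_smul_one, mul_smul_comm, mul_one,
      smul_mul_assoc, map_smul, smul_eq_mul]
    ring
  induction n with
  | zero =>
    intro j w a hc hmem
    rw [hsplit]
    simp only [pow_zero, mul_one]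
    have h₁ : χ ((w.map Prod.snd).prod * a) = 0 := by
      rcases List.eq_nil_or_concat w with rfl | ⟨w', d, rfl⟩
      · simpa using (hmem (0, a) (by simp)).2
      · have := hfree _ (by simp) hc hmem
        simpa [mul_assoc] using this
    have h₂ := hfree (w ++ [((0 : Fin 2), a)] ++ [((1 : Fin 2),
      y ^ j - algebraMap ℂ B (χ (y ^ j)))]) (by simp) (by
        rw [List.map_append, List.isChain_append]
        exact ⟨hc, by simp, by simp⟩) (by
        intro p hp
        rcases List.mem_append.1 hp with hp | hp
        · exact hmem p hp
        · obtain rfl := List.mem_singleton.1 hp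
          exact ⟨hy j, hy0 j⟩)
    have h₃ : χ ((w.map Prod.snd).prod * a * (y ^ j - algebraMap ℂ B (χ (y ^ j)))) = 0 := by
      simpa [mul_assoc] using h₂
    rw [h₁, h₃, mul_zero, add_zero]
  | succ n ih =>
    intro j w a hc hmem
    have hpow : (w.map Prod.snd).prod * a * y ^ j * (x + y) ^ (n + 1) =
        (w.map Prod.snd).prod * a * y ^ j * (x * (x + y) ^ n) +
          (w.map Prod.snd).prod * a * y ^ (j + 1) * (x + y) ^ n := by
      simp only [pow_succ', pow_succ y, mul_add, add_mul, mul_assoc]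
    rw [hpow, map_add, ih (j + 1) w a hc hmem, add_zero, hsplit]
    have ha := (hmem (0, a) (by simp)).1
    have hxa := Algebra.self_mem_adjoin_singleton ℂ x
    have hax : χ (a * x) = 0 := h.apply_mul_eq_zero ha
    have hx0 : χ x = 0 := by simpa using h.apply_mul_eq_zero (one_mem (Algebra.adjoin ℂ {x}))
    have h₁ := ih 0 (w ++ [((0 : Fin 2), a), ((1 : Fin 2),
      y ^ j - algebraMap ℂ B (χ (y ^ j)))]) x (by
        have hl : (w ++ [((0 : Fin 2), a), ((1 : Fin 2), y ^ j - algebraMap ℂ B (χ (y ^ j)))]) ++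
          [((0 : Fin 2), x)] = (w ++ [((0 : Fin 2), a)]) ++ [((1 : Fin 2),
            y ^ j - algebraMap ℂ B (χ (y ^ j))), ((0 : Fin 2), x)] := by simp
        rw [hl, List.map_append, List.isChain_append]
        exact ⟨hc, by simp, by simp⟩) (by
        intro p hp
        simp only [List.append_assoc, List.mem_append, List.cons_append, List.nil_append,
          List.mem_cons, List.not_mem_nil, or_false] at hp
        rcases hp with hp | rfl | rfl | rfl
        · exact hmem p (by simp [hp])
        · exact hmem _ (by simp)
        · exact ⟨hy j, hy0 j⟩
        · exact ⟨hxa, hx0⟩)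
    have h₂ := ih 0 w (a * x) (by simpa using hc) (by
        intro p hp
        rcases List.mem_append.1 hp with hp | hp
        · exact hmem p (by simp [hp])
        · obtain rfl := List.mem_singleton.1 hp
          exact ⟨mul_mem ha hxa, hax⟩)
    have h₁' : χ ((w.map Prod.snd).prod * a * (y ^ j - algebraMap ℂ B (χ (y ^ j))) *
        (x * (x + y) ^ n)) = 0 := by
      simpa [mul_assoc] using h₁
    have h₂' : χ ((w.map Prod.snd).prod * a * (x * (x + y) ^ n)) = 0 := by
      simpa [mul_assoc] using h₂
    rw [h₁', h₂', mul_zero, add_zero]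

theorem IsFreeRealization.distributionOf_add (h : IsFreeRealization χ x y deltaZero ν) :
    distributionOf χ (x + y) = ν := by
  obtain ⟨hχ1, hfree, -, hν⟩ := id h
  have hx0 : χ x = 0 := by simpa using h.apply_mul_eq_zero (one_mem (Algebra.adjoin ℂ {x}))
  have hxa := Algebra.self_mem_adjoin_singleton ℂ x
  have key : ∀ n j, χ (y ^ j * (x + y) ^ n) = χ (y ^ (j + n)) := by
    intro n
    induction n with
    | zero => simp
    | succ n ih =>
      intro j
      have hpow : y ^ j * (x + y) ^ (n + 1) =
          (y ^ j - algebraMap ℂ B (χ (y ^ j))) * x * (x + y) ^ n +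
            χ (y ^ j) • (x * (x + y) ^ n) + y ^ (j + 1) * (x + y) ^ n := by
        rw [sub_mul, sub_mul, Algebra.algebraMap_eq_smul_one, smul_mul_assoc, one_mul,
          smul_mul_assoc, sub_add_cancel, pow_succ', pow_succ, add_mul, mul_add, mul_assoc,
          mul_assoc]
      have hy : y ^ j - algebraMap ℂ B (χ (y ^ j)) ∈ Algebra.adjoin ℂ {y} :=
        sub_mem (pow_mem (Algebra.self_mem_adjoin_singleton ℂ y) j)
          (Subalgebra.algebraMap_mem _ _)
      have hy0 : χ (y ^ j - algebraMap ℂ B (χ (y ^ j))) = 0 := by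
        rw [map_sub, Algebra.algebraMap_eq_smul_one, map_smul, hχ1, smul_eq_mul, mul_one, sub_self]
      have h₁ := h.centred_mul_eq_zero n 0 [((1 : Fin 2), y ^ j - algebraMap ℂ B (χ (y ^ j)))] x
        (by simp) (by
          intro p hp
          simp only [List.cons_append, List.nil_append, List.mem_cons, List.not_mem_nil,
            or_false] at hp
          rcases hp with rfl | rfl
          · exact ⟨hy, hy0⟩
          · exact ⟨hxa, hx0⟩)
      have h₂ := h.centred_mul_eq_zero n 0 [] x (by simp) (by
          intro p hp
          obtain rfl := List.mem_singleton.1 hp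
          exact ⟨hxa, hx0⟩)
      simp only [List.map_cons, List.map_nil, List.prod_cons, List.prod_nil, mul_one,
        pow_zero, one_mul] at h₁ h₂
      rw [hpow, map_add, map_add, map_smul, h₁, h₂, smul_zero, add_zero, zero_add, ih,
        add_right_comm, add_assoc]
  refine dual_ext_X_pow fun n => ?_
  have := key n 0
  rw [pow_zero, one_mul, zero_add] at this
  rw [distributionOf_X_pow, this, ← hν, distributionOf_X_pow]

/-- `0` and `X` are free with respect to `ν`, since a centred scalar is `0`. -/
theorem isFreeRealization_zero_X (hν : IsDistribution ν) :
    IsFreeRealization ν (0 : ℂ[X]) Polynomial.X deltaZero ν := by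
  have hν1 : ν 1 = 1 := hν
  refine ⟨hν, ?_, ?_, ?_⟩
  · intro w hw hc hmem
    have hzero : ∀ p ∈ w, p.1 = 0 → p.2 = 0 := by
      intro p hp hp0
      obtain ⟨h₁, h₂⟩ := hmem p hp
      rw [hp0] at h₁
      have h₁' : p.2 ∈ Algebra.adjoin ℂ ({0} : Set ℂ[X]) := h₁
      rw [Algebra.adjoin_singleton_zero, Algebra.mem_bot] at h₁'
      obtain ⟨c, hc⟩ := h₁'
      rw [← hc, Algebra.algebraMap_eq_smul_one, map_smul, hν1, smul_eq_mul, mul_one] at h₂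
      rw [← hc, h₂, map_zero]
    have hex : ∃ p ∈ w, p.1 = 0 := by
      match w, hw, hc with
      | p :: q :: w, _, hc =>
        rw [List.map_cons, List.map_cons, List.isChain_cons_cons] at hc
        by_cases hp : p.1 = 0
        · exact ⟨p, by simp, hp⟩
        · refine ⟨q, by simp, ?_⟩
          have := hc.1
          omega
    obtain ⟨p, hp, hp0⟩ := hex
    rw [List.prod_eq_zero, map_zero]
    exact List.mem_map.2 ⟨p, hp, hzero p hp hp0⟩
  · refine dual_ext_X_pow fun n => ?_
    rw [distributionOf_X_pow]
    rcases Nat.eq_zero_or_pos n with rfl | hn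
    · simp [deltaZero, hν1]
    · simp [deltaZero, hn.ne']
  · refine dual_ext_X_pow fun n => ?_
    rw [distributionOf_X_pow]

theorem isFreeConv_deltaZero_iff {ν' : ℂ[X] →ₗ[ℂ] ℂ} (hν : IsDistribution ν) :
    IsFreeConv deltaZero ν ν' ↔ ν' = ν := by
  constructor
  · rintro ⟨-, h⟩
    rw [← h _ _ _ _ (isFreeRealization_zero_X hν), (isFreeRealization_zero_X hν).distributionOf_add]
  · rintro rfl
    exact ⟨⟨_, _, _, _, _, _, isFreeRealization_zero_X hν⟩,
      fun B _ _ χ x y h => h.distributionOf_add⟩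

end FreeDeltaZero

/-! ### Restriction of word series to selected letters -/

/-- The values of a linear form on the words in the letters `φ c`. -/
noncomputable def hatVia {A γ : Type*} [AddCommGroup A] [Module ℂ A] (φ : γ → A)
    (f : Module.Dual ℂ (DoubleTensor A)) : List γ → ℂ := fun l => hat f (l.map φ)

/-- The power series of a series in the words in one letter. -/
noncomputable def letterSeries (u : List Unit → ℂ) : PowerSeries ℂ :=
  PowerSeries.mk fun n => u (List.replicate n ())

section Restriction

variable {A γ : Type*} [AddCommGroup A] [Module ℂ A] (φ : γ → A)

theorem unitSeries_map {α : Type*} (φ : γ → α) :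
    (fun l : List γ => unitSeries (l.map φ)) = unitSeries := by
  funext l
  cases l <;> rfl

theorem hatVia_add (f g : Module.Dual ℂ (DoubleTensor A)) :
    hatVia φ (f + g) = hatVia φ f + hatVia φ g := rfl

theorem IsRightExp.cauchy_hatVia {β Φ : Module.Dual ℂ (DoubleTensor A)} (h : IsRightExp β Φ)
    (hβ : IsInfinitesimal β) :
    hatVia φ Φ = unitSeries + cauchy (hatVia φ β) (hatVia φ Φ) := by
  funext l
  have := congrFun (h.cauchy_hat hβ) (l.map φ)
  rw [Pi.add_apply, cauchy_map, congrFun (unitSeries_map φ) l] at this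
  exact this

theorem hatVia_conv {f g : Module.Dual ℂ (DoubleTensor A)} (hg : IsCharacter g) :
    hatVia φ (conv f g) = wsubst (hatVia φ g) (hatVia φ f) (hatVia φ g) := by
  funext l
  rw [hatVia, hat_conv hg, wsubst_map]
  rfl

theorem IsInfinitesimal.hat_leftShuffle {β ψ : Module.Dual ℂ (DoubleTensor A)}
    (hβ : IsInfinitesimal β) (hψ : IsCharacter ψ) :
    hat (leftShuffle β ψ) = wsubst (hat ψ) (hat β) unitSeries := by
  funext l
  cases l with
  | nil => simp [leftShuffle_one, hβ.one]
  | cons a l => simp [hat_leftShuffle_cons hψ, wsubst_cons]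

theorem IsInfinitesimal.hatVia_adjoint {β ψ θ : Module.Dual ℂ (DoubleTensor A)}
    (hβ : IsInfinitesimal β) (hψ : IsCharacter ψ) (hθψ : conv θ ψ = counitForm) :
    ∃ y : List γ → ℂ, cauchy (hatVia φ ψ) y = unitSeries ∧
      hatVia φ (rightShuffle θ (leftShuffle β ψ)) =
        cauchy (wsubst (hatVia φ ψ) (hatVia φ β) unitSeries) y := by
  obtain ⟨y, hy, h⟩ := hβ.hat_adjoint hψ hθψ
  refine ⟨fun l => y (l.map φ), ?_, ?_⟩
  · funext l
    have := congrFun hy (l.map φ)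
    rwa [cauchy_map, congrFun (unitSeries_map φ) l] at this
  · funext l
    rw [hatVia, h, cauchy_map, hβ.hat_leftShuffle hψ]
    congr 1
    funext l'
    rw [wsubst_map, unitSeries_map]
    rfl

theorem VanishesOff.unitSeries (s : Set γ) (n : ℕ) : VanishesOff s n _root_.unitSeries := by
  rintro (- | ⟨a, l⟩) - ⟨b, hb, -⟩
  · simp at hb
  · rfl

/-- The counterpart of `VanishesOff.inverse` for the left factor. -/
theorem VanishesOff.of_cauchy {s : Set γ} {u v : List γ → ℂ} (hv : ∀ n, VanishesOff s n v)
    (h₀ : v [] ≠ 0) (h : ∀ n, VanishesOff s n (_root_.cauchy u v)) (n : ℕ) :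
    VanishesOff s n u := by
  induction n with
  | zero =>
    rintro l hl ⟨b, hb, -⟩
    obtain rfl := List.length_eq_zero_iff.1 (Nat.le_zero.1 hl)
    simp at hb
  | succ n ih =>
    intro l hl hbad
    -- the values of `u` at words longer than `n` do not matter apart from `u l`
    let u' : List γ → ℂ := fun l' => if l'.length ≤ n then u l' else 0
    have hu' : VanishesOff s (n + 1) u' := fun l' _ hbad' => by
      simp only [u']
      split_ifs with hl'
      · exact ih l' hl' hbad'
      · rfl
    have key := cauchy_sub_congr_left (u := u) (u' := u') v l fun l' hl' => by
      simp only [u', if_pos (show l'.length ≤ n by omega)]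
    rw [h _ l hl hbad, hu'.cauchy (hv _) l hl hbad, hu' l hl hbad, zero_smul, sub_zero, zero_sub,
      neg_eq_zero, smul_eq_mul] at key
    exact (mul_eq_zero.1 key).resolve_right h₀

theorem IsRightExp.vanishesOff_left {β Φ : Module.Dual ℂ (DoubleTensor A)} (h : IsRightExp β Φ)
    (hβ : IsInfinitesimal β) {s : Set γ} (hΦ : ∀ n, VanishesOff s n (hatVia φ Φ)) (n : ℕ) :
    VanishesOff s n (hatVia φ β) := by
  refine VanishesOff.of_cauchy hΦ ?_ (fun n l hl hbad => ?_) n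
  · simp [hatVia, (h.isCharacter hβ).1]
  · have := congrFun (h.cauchy_hatVia φ hβ) l
    rw [Pi.add_apply, hΦ n l hl hbad, VanishesOff.unitSeries s n l hl hbad, zero_add] at this
    exact this.symm

theorem IsRightExp.vanishesOff {β Φ : Module.Dual ℂ (DoubleTensor A)} (h : IsRightExp β Φ)
    (hβ : IsInfinitesimal β) {s : Set γ} (hβs : ∀ n, VanishesOff s n (hatVia φ β)) (n : ℕ) :
    VanishesOff s n (hatVia φ Φ) := by
  refine VanishesOff.inverse (u := _root_.unitSeries + (-1 : ℂ) • hatVia φ β)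
    (fun n l hl hbad => ?_) ?_ n
  · rw [Pi.add_apply, Pi.smul_apply, VanishesOff.unitSeries s n l hl hbad, hβs n l hl hbad,
      smul_zero, add_zero]
  · rw [cauchy_add_left, cauchy_smul_left, unitSeries_cauchy]
    nth_rewrite 1 [h.cauchy_hatVia φ hβ]
    funext l
    simp

theorem VanishesOff.hatVia_adjoint {β ψ θ : Module.Dual ℂ (DoubleTensor A)}
    (hβ : IsInfinitesimal β) (hψ : IsCharacter ψ) (hθψ : conv θ ψ = counitForm) {s : Set γ}
    (hβs : ∀ n, VanishesOff s n (hatVia φ β)) (hψs : ∀ n, VanishesOff s n (hatVia φ ψ)) (n : ℕ) :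
    VanishesOff s n (hatVia φ (rightShuffle θ (leftShuffle β ψ))) := by
  obtain ⟨y, hy, h⟩ := hβ.hatVia_adjoint φ hψ hθψ
  rw [h]
  exact (VanishesOff.wsubst hψs hβs (VanishesOff.unitSeries s) n).cauchy
    (VanishesOff.inverse hψs hy n)

end Restriction

/-! ### Words in one letter -/

section OneLetter

open PowerSeries

theorem letterSeries_injective {u v : List Unit → ℂ} (h : letterSeries u = letterSeries v) :
    u = v := by
  funext l
  have := congrArg (coeff l.length) h
  rwa [letterSeries, letterSeries, coeff_mk, coeff_mk,
    show List.replicate l.length () = l from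
      (List.eq_replicate_of_mem fun _ _ => rfl).symm] at this

theorem letterSeries_add (u v : List Unit → ℂ) :
    letterSeries (u + v) = letterSeries u + letterSeries v := by
  ext n
  simp [letterSeries]

theorem letterSeries_eq (u : List Unit → ℂ) :
    letterSeries u = C (u []) + X * letterSeries (lderiv () u) := by
  ext n
  cases n with
  | zero => simp [letterSeries]
  | succ n => simp [letterSeries, coeff_succ_X_mul, List.replicate_succ]

theorem letterSeries_unitSeries : letterSeries unitSeries = 1 := by
  have h : letterSeries (0 : List Unit → ℂ) = 0 := by
    ext n
    simp [letterSeries]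
  rw [letterSeries_eq, lderiv_unitSeries, h]
  simp

theorem letterSeries_cauchy (u v : List Unit → ℂ) :
    letterSeries (cauchy u v) = letterSeries u * letterSeries v := by
  ext n
  induction n generalizing u with
  | zero =>
    rw [letterSeries_eq u, letterSeries_eq v]
    simp [letterSeries]
  | succ n ih =>
    have h := ih (lderiv () u)
    have hc : coeff (n + 1) (letterSeries (cauchy u v)) =
        u [] * coeff (n + 1) (letterSeries v) +
          coeff n (letterSeries (cauchy (lderiv () u) v)) := by
      simp [letterSeries, List.replicate_succ, cauchy_cons]
    rw [hc, h, letterSeries_eq u, add_mul, map_add, coeff_C_mul, mul_assoc, coeff_succ_X_mul]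

/-- In one letter, `wsubst` is composition with `z G`. -/
theorem letterSeries_wsubst (g u : List Unit → ℂ) (hu : u [] = 0) :
    letterSeries (wsubst g u unitSeries) =
      cumulantSubst (letterSeries g) fun n => u (List.replicate n ()) := by
  have split : ∀ f : List Unit → ℂ, letterSeries (wsubst g f unitSeries) =
      C (f []) + X * letterSeries (wsubst g (lderiv () f) g) := by
    intro f
    rw [letterSeries_eq, lderiv_wsubst, lderiv_unitSeries, wsubst_zero_right]
    simp
  have key := eq_cumulantSubst (G := letterSeries g)
    (H := fun w => X * letterSeries (wsubst g (fun l => w (l.length + 1)) g)) (fun w => by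
      conv_lhs => rw [wsubst_eq_cauchy, letterSeries_cauchy, split]
      rw [mul_assoc]
      rfl) fun n => u (List.replicate n ())
  have hl : (fun l : List Unit => u (List.replicate (l.length + 1) ())) = lderiv () u := by
    funext l
    rw [lderiv_apply, ← List.length_cons (a := ()), show List.replicate (() :: l).length () =
      () :: l from (List.eq_replicate_of_mem fun _ _ => rfl).symm]
  rw [← key, split, hu]
  simp only [hl, map_zero, zero_add]

theorem letterSeries_momentWord (μ : ℂ[X] →ₗ[ℂ] ℂ) :
    letterSeries (momentWord μ) = momentSeries μ := by
  ext n
  simp [letterSeries, momentWord, momentSeries]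

theorem momentSeries_injective {μ ν : ℂ[X] →ₗ[ℂ] ℂ} (h : momentSeries μ = momentSeries ν) :
    μ = ν := by
  refine dual_ext_X_pow fun n => ?_
  have := congrArg (coeff n) h
  rwa [momentSeries, momentSeries, coeff_mk, coeff_mk] at this

theorem momentSeries_deltaZero : momentSeries deltaZero = 1 := by
  ext n
  rw [momentSeries, coeff_mk, coeff_one]
  simp [deltaZero, zero_pow_eq]

theorem boolean_unique {M B B' : PowerSeries ℂ} (h₀ : constantCoeff M = 1) (h : M = 1 + B * M)
    (h' : M = 1 + B' * M) : B = B' := by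
  have hM : M ≠ 0 := fun h => by simp [h] at h₀
  refine mul_right_cancel₀ hM ?_
  linear_combination h' - h

theorem moments_unique {M M' B : PowerSeries ℂ} (h : M = 1 + B * M) (h' : M' = 1 + B * M') :
    M = M' := by
  have h₁ : (1 - B) * M = 1 := by linear_combination h
  have h₂ : (1 - B) * M' = 1 := by linear_combination h'
  have : (1 - B) ≠ 0 := fun h => by simp [h] at h₁
  exact mul_left_cancel₀ this (h₁.trans h₂.symm)

/-- The Boolean cumulants of the first component of `(μ₁, δ₀) ⊞ (μ₂, ν₂)`. -/
theorem IsCFreeConv.boolean {μ₁ μ₂ ν₂ μ ν' : ℂ[X] →ₗ[ℂ] ℂ} (hμ₁ : IsDistribution μ₁)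
    (hμ₂ : IsDistribution μ₂) (hν₂ : IsDistribution ν₂)
    (h : IsCFreeConv (μ₁, deltaZero) (μ₂, ν₂) (μ, ν')) {B₁ B₂ : PowerSeries ℂ}
    (h₁ : momentSeries μ₁ = 1 + B₁ * momentSeries μ₁)
    (h₂ : momentSeries μ₂ = 1 + B₂ * momentSeries μ₂) :
    ∃ B, momentSeries μ = 1 + B * momentSeries μ ∧
      momentSeries ν₂ * B =
        cumulantSubst (momentSeries ν₂) (fun n => coeff n B₁) + momentSeries ν₂ * B₂ := by
  obtain ⟨hμ, hν', k₁, k₂, hk₁, hk₂, hk⟩ := h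
  simp only at hμ hν' hk₁ hk₂ hk
  obtain rfl := (isFreeConv_deltaZero_iff hν₂).1 hν'
  have hδ : IsDistribution deltaZero := by simp [IsDistribution, deltaZero]
  obtain ⟨B, hB, hGB⟩ := hk.exists_boolean hμ hν₂
  obtain ⟨B₁', hB₁, hGB₁⟩ := hk₁.exists_boolean hμ₁ hδ
  obtain ⟨B₂', hB₂, hGB₂⟩ := hk₂.exists_boolean hμ₂ hν₂
  obtain rfl := boolean_unique hμ₁.constantCoeff_momentSeries h₁ hB₁
  obtain rfl := boolean_unique hμ₂.constantCoeff_momentSeries h₂ hB₂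
  refine ⟨B, hB, ?_⟩
  -- with respect to `δ₀`, c-free and Boolean cumulants coincide
  rw [momentSeries_deltaZero, one_mul, cumulantSubst_one] at hGB₁
  have hcoeff : ∀ n, coeff (n + 1) B₁ = k₁ (n + 1) := fun n => by
    rw [hGB₁, coeff_succ_X_mul, coeff_mk]
  rw [hGB, cumulantSubst_add, hGB₂]
  congr 1
  unfold cumulantSubst
  simp only [hcoeff]

variable {A : Type*} [AddCommGroup A] [Module ℂ A]

/-- The first component on the powers of a letter `x`: the Boolean cumulants of
`𝓔_≻(β₂ + θ ≻ β₁ ≺ ψ)` are those of the first component of `(μ₁, δ₀) ⊞ (μ₂, ν₂)`. -/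
theorem hatVia_eq_momentWord {x : A} {μ₁ μ₂ ν₂ μ ν' : ℂ[X] →ₗ[ℂ] ℂ}
    {Φ₁ Φ₂ ψ θ β₁ β₂ Φ : Module.Dual ℂ (DoubleTensor A)} (hμ₁ : IsDistribution μ₁)
    (hμ₂ : IsDistribution μ₂) (hν₂ : IsDistribution ν₂)
    (h : IsCFreeConv (μ₁, deltaZero) (μ₂, ν₂) (μ, ν'))
    (hΦ₁ : hatVia (fun _ : Unit => x) Φ₁ = momentWord μ₁)
    (hΦ₂ : hatVia (fun _ : Unit => x) Φ₂ = momentWord μ₂)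
    (hψ : IsCharacter ψ) (hψx : hatVia (fun _ : Unit => x) ψ = momentWord ν₂)
    (hβ₁ : IsInfinitesimal β₁) (hβ₂ : IsInfinitesimal β₂) (h₁ : IsRightExp β₁ Φ₁)
    (h₂ : IsRightExp β₂ Φ₂) (hθ : IsCharacter θ) (hθψ : conv θ ψ = counitForm)
    (hΦ : IsRightExp (β₂ + rightShuffle θ (leftShuffle β₁ ψ)) Φ) :
    hatVia (fun _ : Unit => x) Φ = momentWord μ := by
  have e₁ := congrArg letterSeries (h₁.cauchy_hatVia (fun _ : Unit => x) hβ₁)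
  have e₂ := congrArg letterSeries (h₂.cauchy_hatVia (fun _ : Unit => x) hβ₂)
  have e := congrArg letterSeries (hΦ.cauchy_hatVia (fun _ : Unit => x)
    (hβ₂.add (hβ₁.adjoint hψ hθ hθψ)))
  rw [letterSeries_add, letterSeries_cauchy, letterSeries_unitSeries] at e₁ e₂ e
  rw [hΦ₁, letterSeries_momentWord] at e₁
  rw [hΦ₂, letterSeries_momentWord] at e₂
  obtain ⟨B, hB, hGB⟩ := h.boolean hμ₁ hμ₂ hν₂ e₁ e₂
  obtain ⟨y, hy, hγ⟩ := hβ₁.hatVia_adjoint (fun _ : Unit => x) hψ hθψ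
  have hy' := congrArg letterSeries hy
  have hγ' := congrArg letterSeries hγ
  rw [letterSeries_cauchy, letterSeries_unitSeries, hψx, letterSeries_momentWord] at hy'
  have hβ0 : hatVia (fun _ : Unit => x) β₁ [] = 0 := by simp [hatVia, hβ₁.one]
  rw [letterSeries_cauchy, letterSeries_wsubst _ _ hβ0, hψx, letterSeries_momentWord] at hγ'
  have hcoeff : (fun n => coeff n (letterSeries (hatVia (fun _ : Unit => x) β₁))) =
      fun n => hatVia (fun _ : Unit => x) β₁ (List.replicate n ()) := by
    funext n
    rw [letterSeries, coeff_mk]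
  rw [hcoeff] at hGB
  rw [hatVia_add, letterSeries_add, hγ'] at e
  have hG : momentSeries ν₂ ≠ 0 := fun h => by simp [h] at hy'
  have hBB : B = letterSeries (hatVia (fun _ : Unit => x) β₂) +
      cumulantSubst (momentSeries ν₂)
        (fun n => hatVia (fun _ : Unit => x) β₁ (List.replicate n ())) * letterSeries y := by
    refine mul_left_cancel₀ hG ?_
    rw [hGB]
    linear_combination -(cumulantSubst (momentSeries ν₂)
        (fun n => hatVia (fun _ : Unit => x) β₁ (List.replicate n ()))) * hy'
  rw [← hBB] at e
  refine letterSeries_injective ?_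
  rw [letterSeries_momentWord]
  exact moments_unique e hB

theorem hatVia_const_eq_momentWord_iff {x : A} {μ : ℂ[X] →ₗ[ℂ] ℂ}
    {Φ : Module.Dual ℂ (DoubleTensor A)} :
    hatVia (fun _ : Unit => x) Φ = momentWord μ ↔
      ∀ n : ℕ, Φ (wordMap A n fun _ => x) = μ (Polynomial.X ^ n) := by
  have h : ∀ n : ℕ, Φ (wordMap A n fun _ => x) =
      hatVia (fun _ : Unit => x) Φ (List.replicate n ()) := fun n => by
    rw [wordMap_eq_word, hatVia, hat, List.map_replicate, List.ofFn_const]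
  constructor
  · intro h' n
    rw [h, h', momentWord, List.length_replicate]
  · intro h'
    funext l
    obtain ⟨n, rfl⟩ : ∃ n, l = List.replicate n () :=
      ⟨l.length, List.eq_replicate_of_mem fun _ _ => rfl⟩
    rw [← h, h', momentWord, List.length_replicate]

end OneLetter

section Letters

variable {A : Type*} [AddCommGroup A] [Module ℂ A] {I : Type*} {e : Module.Basis I ℂ A}

/-- A letter on which `Φ` vanishes may be added. -/
theorem ExtendsOnLetter.hatVia_add {i j : I} (hij : j ≠ i) {μ : ℂ[X] →ₗ[ℂ] ℂ}
    {Φ : Module.Dual ℂ (DoubleTensor A)} (h : ExtendsOnLetter e i μ Φ) :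
    hatVia (fun _ : Unit => e i + e j) Φ = momentWord μ := by
  classical
  rw [hatVia_const_eq_momentWord_iff]
  intro n
  have hexp := (wordMap A n).map_add_univ (fun _ => e i) (fun _ => e j)
  have hfun : ((fun _ : Fin n => e i) + fun _ => e j) = fun _ => e i + e j := rfl
  rw [hfun] at hexp
  rw [hexp, map_sum, Finset.sum_eq_single_of_mem Finset.univ (Finset.mem_univ _)]
  · rw [Finset.piecewise_univ, h.2.1]
  · intro s _ hs
    obtain ⟨k, hk⟩ : ∃ k, k ∉ s := by
      by_contra! hcon
      exact hs (Finset.eq_univ_iff_forall.2 hcon)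
    have hw : s.piecewise (fun _ : Fin n => e i) (fun _ => e j) =
        fun m => e (if m ∈ s then i else j) := by
      funext m
      by_cases hm : m ∈ s <;> simp [hm]
    rw [hw]
    exact h.2.2 n _ ⟨k, by simpa [hk] using hij⟩

theorem extendsOnLetter_iff {i : I} {μ : ℂ[X] →ₗ[ℂ] ℂ} {Φ : Module.Dual ℂ (DoubleTensor A)} :
    ExtendsOnLetter e i μ Φ ↔ IsCharacter Φ ∧
      hatVia (fun _ : Unit => e i) Φ = momentWord μ ∧
      ∀ n, VanishesOff {i} n (hatVia e Φ) := by
  unfold ExtendsOnLetter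
  rw [hatVia_const_eq_momentWord_iff]
  refine and_congr_right fun _ => and_congr_right fun _ => ?_
  constructor
  · rintro h n l - ⟨a, ha, hai⟩
    obtain ⟨k, hk⟩ := List.get_of_mem ha
    have := h l.length l.get ⟨k, by rw [hk]; exact hai⟩
    rw [wordMap_eq_word] at this
    rw [hatVia, hat, ← this]
    congr 2
    exact List.ext_get (by simp) fun m h₁ h₂ => by simp
  · rintro h n w ⟨k, hk⟩
    have := h n (List.ofFn w) (by simp) ⟨w k, by simp, hk⟩
    rw [wordMap_eq_word, ← this, hatVia, hat, List.map_ofFn]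
    rfl

end Letters

/-! ### The convolution of pairs of characters -/

theorem existsUnique_isCharConv {A : Type*} [AddCommGroup A] [Module ℂ A]
    {Φ₁ Ψ₁ Φ₂ Ψ₂ : Module.Dual ℂ (DoubleTensor A)} (hΦ₁ : IsCharacter Φ₁) (hΦ₂ : IsCharacter Φ₂)
    (hΨ₂ : IsCharacter Ψ₂) : ∃! P, IsCharConv (Φ₁, Ψ₁) (Φ₂, Ψ₂) P := by
  obtain ⟨β₁, hβ₁, h₁⟩ := hΦ₁.exists_isRightExp
  obtain ⟨β₂, hβ₂, h₂⟩ := hΦ₂.exists_isRightExp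
  obtain ⟨θ, hθ, hθi⟩ := exists_isConvInverse hΨ₂
  obtain ⟨Φ, -, hΦ, -⟩ := (hβ₂.add (hβ₁.adjoint hΨ₂ hθ hθi.2)).exists_isRightExp
  refine ⟨(Φ, conv Ψ₁ Ψ₂), ⟨β₁, β₂, θ, ⟨hβ₁, h₁⟩, ⟨hβ₂, h₂⟩, hθi, hΦ, rfl⟩, ?_⟩
  rintro ⟨Φ', Ψ'⟩ ⟨β₁', β₂', θ', ⟨hβ₁', h₁'⟩, ⟨hβ₂', h₂'⟩, hθi', hΦ', hΨ'⟩
  obtain rfl := h₁'.unique_left h₁ hβ₁' hβ₁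
  obtain rfl := h₂'.unique_left h₂ hβ₂' hβ₂
  obtain rfl := hθi.unique hΨ₂ hθ hθi'
  exact Prod.ext (hΦ'.unique hΦ) hΨ'

theorem existsUnique_isCMonotoneConv {μ₁ ν₁ μ₂ ν₂ : ℂ[X] →ₗ[ℂ] ℂ}
    (hμ₁ : IsDistribution μ₁) (hν₁ : IsDistribution ν₁)
    (hμ₂ : IsDistribution μ₂) (hν₂ : IsDistribution ν₂) :
    ∃! p, IsCMonotoneConv (μ₁, ν₁) (μ₂, ν₂) p := by
  obtain ⟨k₁, hk₁⟩ := exists_isCFreeCumulants μ₁ deltaZero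
  obtain ⟨k₂, hk₂⟩ := exists_isCFreeCumulants μ₂ ν₂
  obtain ⟨μ, hμ, hk⟩ := exists_isDistribution_isCFreeCumulants ν₂ (k₁ + k₂)
  obtain ⟨ν, hν⟩ := exists_isMonotoneConv ν₁ ν₂ hν₁ hν₂
  have hfree : IsFreeConv deltaZero ν₂ ν₂ := (isFreeConv_deltaZero_iff hν₂).2 rfl
  have hconv : IsCFreeConv (μ₁, deltaZero) (μ₂, ν₂) (μ, ν₂) := ⟨hμ, hfree, k₁, k₂, hk₁, hk₂, hk⟩
  refine ⟨(μ, ν), ⟨⟨ν₂, hconv⟩, hν⟩, ?_⟩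
  rintro ⟨μ', ν'⟩ ⟨⟨ν'', hconv'⟩, hν'⟩
  have hδ : IsDistribution deltaZero := by simp [IsDistribution, deltaZero]
  obtain ⟨B₁, hB₁, -⟩ := hk₁.exists_boolean hμ₁ hδ
  obtain ⟨B₂, hB₂, -⟩ := hk₂.exists_boolean hμ₂ hν₂
  obtain ⟨B, hB, hGB⟩ := hconv.boolean hμ₁ hμ₂ hν₂ hB₁ hB₂
  obtain ⟨B', hB', hGB'⟩ := hconv'.boolean hμ₁ hμ₂ hν₂ hB₁ hB₂
  have hG : momentSeries ν₂ ≠ 0 := fun h => by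
    have := hν₂.constantCoeff_momentSeries
    simp [h] at this
  obtain rfl := mul_left_cancel₀ hG (hGB'.trans hGB.symm)
  refine Prod.ext (momentSeries_injective (moments_unique hB' hB)) (dual_ext_X_pow fun n => ?_)
  exact (hν'.moments n).trans (hν.moments n).symm

theorem mainTheorem2 {A : Type*} [Ring A] [Algebra ℂ A] {I : Type*}
    (e : Module.Basis I ℂ A) (i₁ i₂ : I)
    (μ₁ ν₁ μ₂ ν₂ : ℂ[X] →ₗ[ℂ] ℂ)
    (hμ₁ : IsDistribution μ₁) (hν₁ : IsDistribution ν₁)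
    (hμ₂ : IsDistribution μ₂) (hν₂ : IsDistribution ν₂)
    (Φ₁ Ψ₁ Φ₂ Ψ₂ : Module.Dual ℂ (DoubleTensor A))
    (hΦ₁ : ExtendsOnLetter e i₁ μ₁ Φ₁) (hΨ₁ : ExtendsOnLetter e i₁ ν₁ Ψ₁)
    (hΦ₂ : ExtendsOnLetter e i₂ μ₂ Φ₂) (hΨ₂ : ExtendsOnLetter e i₂ ν₂ Ψ₂) :
    (∃! p, IsCMonotoneConv (μ₁, ν₁) (μ₂, ν₂) p) ∧
    (∃! P, IsCharConv (Φ₁, Ψ₁) (Φ₂, Ψ₂) P) ∧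
    ∀ μ ν Φ Ψ, IsCMonotoneConv (μ₁, ν₁) (μ₂, ν₂) (μ, ν) →
      IsCharConv (Φ₁, Ψ₁) (Φ₂, Ψ₂) (Φ, Ψ) →
      (i₁ ≠ i₂ → ExtendsAt (e i₁ + e i₂) μ Φ ∧ ExtendsAt (e i₁ + e i₂) ν Ψ) ∧
      (i₁ = i₂ → ExtendsOnLetter e i₁ μ Φ ∧ ExtendsOnLetter e i₁ ν Ψ) := by
  refine ⟨existsUnique_isCMonotoneConv hμ₁ hν₁ hμ₂ hν₂,
    existsUnique_isCharConv hΦ₁.1 hΦ₂.1 hΨ₂.1, ?_⟩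
  rintro μ ν Φ Ψ ⟨⟨ν', hfree⟩, hmon⟩ ⟨β₁, β₂, θ, ⟨hβ₁, h₁⟩, ⟨hβ₂, h₂⟩, hθi, hΦ, hΨ⟩
  simp only at hfree hmon h₁ h₂ hθi hΦ hΨ
  obtain ⟨θ', hθ', hθi'⟩ := exists_isConvInverse hΨ₂.1
  obtain rfl := hθi'.unique hΨ₂.1 hθ' hθi
  have hγ := hβ₁.adjoint hΨ₂.1 hθ' hθi.2
  have hΦc : IsCharacter Φ := hΦ.isCharacter (hβ₂.add hγ)
  have hΨc : IsCharacter Ψ := hΨ ▸ hΨ₁.1.conv hΨ₂.1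
  -- the moments at any letter `x` at which the given characters have the given moments
  have moments : ∀ x : A, hatVia (fun _ : Unit => x) Φ₁ = momentWord μ₁ →
      hatVia (fun _ : Unit => x) Ψ₁ = momentWord ν₁ →
      hatVia (fun _ : Unit => x) Φ₂ = momentWord μ₂ →
      hatVia (fun _ : Unit => x) Ψ₂ = momentWord ν₂ →
      hatVia (fun _ : Unit => x) Φ = momentWord μ ∧
        hatVia (fun _ : Unit => x) Ψ = momentWord ν := by
    intro x hΦ₁x hΨ₁x hΦ₂x hΨ₂x
    refine ⟨hatVia_eq_momentWord hμ₁ hμ₂ hν₂ hfree hΦ₁x hΦ₂x hΨ₂.1 hΨ₂x hβ₁ hβ₂ h₁ h₂ hθ' hθi.2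
      hΦ, letterSeries_injective ?_⟩
    rw [hΨ, hatVia_conv _ hΨ₂.1, hΨ₁x, hΨ₂x, letterSeries_momentWord]
    ext n
    rw [letterSeries, momentSeries, PowerSeries.coeff_mk, PowerSeries.coeff_mk, hmon.moments]
  constructor
  · intro hne
    obtain ⟨hm₁, hm₂⟩ := moments (e i₁ + e i₂) (hΦ₁.hatVia_add hne.symm)
      (hΨ₁.hatVia_add hne.symm) (add_comm (e i₂) (e i₁) ▸ hΦ₂.hatVia_add hne)
      (add_comm (e i₂) (e i₁) ▸ hΨ₂.hatVia_add hne)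
    exact ⟨⟨hΦc, hatVia_const_eq_momentWord_iff.1 hm₁⟩,
      ⟨hΨc, hatVia_const_eq_momentWord_iff.1 hm₂⟩⟩
  · rintro rfl
    obtain ⟨-, hΦ₁m, hΦ₁v⟩ := extendsOnLetter_iff.1 hΦ₁
    obtain ⟨-, hΨ₁m, hΨ₁v⟩ := extendsOnLetter_iff.1 hΨ₁
    obtain ⟨-, hΦ₂m, hΦ₂v⟩ := extendsOnLetter_iff.1 hΦ₂
    obtain ⟨-, hΨ₂m, hΨ₂v⟩ := extendsOnLetter_iff.1 hΨ₂
    obtain ⟨hm₁, hm₂⟩ := moments (e i₁) hΦ₁m hΨ₁m hΦ₂m hΨ₂m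
    have hβ₁v := h₁.vanishesOff_left e hβ₁ hΦ₁v
    have hβ₂v := h₂.vanishesOff_left e hβ₂ hΦ₂v
    have hγv := VanishesOff.hatVia_adjoint e hβ₁ hΨ₂.1 hθi.2 hβ₁v hΨ₂v
    refine ⟨extendsOnLetter_iff.2 ⟨hΦc, hm₁, hΦ.vanishesOff e (hβ₂.add hγ) fun n l hl hbad => ?_⟩,
      extendsOnLetter_iff.2 ⟨hΨc, hm₂, fun n => ?_⟩⟩
    · rw [hatVia_add, Pi.add_apply, hβ₂v n l hl hbad, hγv n l hl hbad, add_zero]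
    · rw [hΨ, hatVia_conv _ hΨ₂.1]
      exact VanishesOff.wsubst hΨ₂v hΨ₁v hΨ₂v n
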